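/- Let $A=\mathbb C^n/\Lambda$ be an abelian variety with projection $\pi:\mathbb C^n\to A$, and let $N$ be a negative holomorphic line bundle on $A$, i.e. $N$ has a smooth Hermitian metric of negative curvature. Then $N$ has a smooth Hermitian metric $\rho$ whose curvature form is negative and translation invariant (its coefficients in the linear coordinates of $\mathbb C^n$ are constant). Fix any such $\rho$ and put $\mathcal D_k=\{v\in N: 0<\rho(v,v)<e^{-k}\}$. Let $o$ be the point to which the zero section of $N$ is contracted, so that the sets $\mathcal D_k$ are punctured neighborhoods of $o$. There is a holomorphic covering map $\Psi$ from the unit ball $\mathbb B^{n+1}\subset\mathbb C^{n+1}$ onto $\mathcal D_0$, and the Bergman metric of $\mathbb B^{n+1}$ descends along $\Psi$ to a metric $g$ on $\mathcal D_0$. For every $k>0$, with $\mathcal U=\mathcal D_k$, the pair $(\mathcal U,g|_{\mathcal U})$ has a system of quasi-coordinates. That is, there is a set of pairs $(V_\alpha,\phi_\alpha)$, where $V_\alpha\subset\mathbb C^{n+1}$ is a domain and $\phi_\alpha:V_\alpha\to\mathcal U$ is a holomorphic map of maximal rank everywhere, such that: (a) $\mathcal U=\bigcup_\alpha\phi_\alpha(V_\alpha)$;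 (b) there is a punctured open neighborhood $U\subset\mathcal U$ of $o$ such that $\mathcal U\setminus U$ is covered by the images of finitely many of the $(V_\alpha,\phi_\alpha)$ for which $\phi_\alpha$ is injective (so that they are coordinate charts in the usual sense); (c) there is $\epsilon>0$ such that for each $x\in U$ there are an index $\beta$ and a point $\tilde x\in V_\beta$ with $\phi_\beta(\tilde x)=x$ and Euclidean distance $\operatorname{dist}(\tilde x,\partial V_\beta)\ge\epsilon$; moreover $V_\beta$ can be taken to be one and the same bounded domain $T\subset\mathbb C^{n+1}$ for all $x\in U$; (d) there are positive constants $c$ and $A_0,A_1,A_2,\dots$, independent of $\alpha$, such that the components $g_{\alpha i\bar j}$ of $\phi_\alpha^*g$ in the coordinates $v=(v^1,\dots,v^{n+1})$ of $V_\alpha$ are smooth and satisfy on $V_\alpha$ $$c^{-1}(\delta_{i\bar j})\le(g_{\alpha i\bar j})\le c\,(\delta_{i\bar j}),\qquad \Big|\frac{\partial^{|p|+|q|}}{\partial v^p\,\partial\bar v^q}\,g_{\alpha i\bar j}\Big|<A_{|p|+|q|}$$ for all $i,j$ and all multi-indices $p,q$. -/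

import Mathlib

open Set Bundle MeasureTheory
open scoped Manifold ContDiff Topology ComplexOrder

/-- `ℂᵐ` with its Euclidean norm. -/
abbrev CSpace (m : ℕ) : Type := EuclideanSpace ℂ (Fin m)

noncomputable section

/-! ### Complex calculus on `ℂᵐ` -/

/-- The `i`-th standard basis vector of `ℂᵐ`. -/
def stdVec {m : ℕ} (i : Fin m) : CSpace m := EuclideanSpace.single i (1 : ℂ)

/-- The operator `∂/∂vⁱ = (∂/∂xⁱ - √-1 ∂/∂yⁱ) / 2`. -/
def dHol {m : ℕ} (i : Fin m) (f : CSpace m → ℂ) (v : CSpace m) : ℂ :=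
  (fderiv ℝ f v (stdVec i) - Complex.I * fderiv ℝ f v (Complex.I • stdVec i)) / 2

/-- The operator `∂/∂v̄ⁱ = (∂/∂xⁱ + √-1 ∂/∂yⁱ) / 2`. -/
def dAnti {m : ℕ} (i : Fin m) (f : CSpace m → ℂ) (v : CSpace m) : ℂ :=
  (fderiv ℝ f v (stdVec i) + Complex.I * fderiv ℝ f v (Complex.I • stdVec i)) / 2

/-- The iterated mixed derivative `∂^{|p|+|q|} f / ∂v^p ∂v̄^q` for multi-indices `p`, `q`,
each given as the list of the indices (with repetition) in which one differentiates. -/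
def mixedDeriv {m : ℕ} (p q : List (Fin m)) (f : CSpace m → ℂ) : CSpace m → ℂ :=
  p.foldr dHol (q.foldr dAnti f)

/-- The complex Hessian `(∂² f / ∂vⁱ ∂v̄ʲ)` of a real-valued function. -/
def complexHessian {m : ℕ} (f : CSpace m → ℝ) (v : CSpace m) : Matrix (Fin m) (Fin m) ℂ :=
  Matrix.of fun i j => dHol i (dAnti j fun w => (f w : ℂ)) v

/-! ### The Bergman metric -/

/-- The Bergman kernel on the diagonal, `K_Ω(z, z) = sup |f(z)|²` over the holomorphic functions
`f` on `Ω` with `∫_Ω |f|² ≤ 1`. -/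
def bergmanKernel {m : ℕ} (Ω : Set (CSpace m)) (z : CSpace m) : ℝ :=
  sSup {t : ℝ | ∃ f : CSpace m → ℂ, DifferentiableOn ℂ f Ω ∧
    ∫⁻ x in Ω, ‖f x‖ₑ ^ 2 ≤ 1 ∧ t = ‖f z‖ ^ 2}

/-- The Bergman metric `g_{i j̄} = ∂² log K_Ω(z, z) / ∂zⁱ ∂z̄ʲ`. -/
def bergmanMetric {m : ℕ} (Ω : Set (CSpace m)) (z : CSpace m) : Matrix (Fin m) (Fin m) ℂ :=
  complexHessian (fun w => Real.log (bergmanKernel Ω w)) z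

/-- The open unit ball of `ℂᵐ`. -/
def unitBall (m : ℕ) : Set (CSpace m) := Metric.ball 0 1

/-! ### Quasi-coordinates on a complex manifold -/

section QuasiCoordinates

variable {m : ℕ} {E : Type*} [NormedAddCommGroup E] [NormedSpace ℂ E]
  {H : Type*} [TopologicalSpace H] (I : ModelWithCorners ℂ E H)
  {M : Type*} [TopologicalSpace M] [ChartedSpace H M]

/-- A field of sesquilinear forms on the holomorphic tangent spaces of `M`, linear in the first
argument and conjugate-linear in the second. -/
abbrev SesquilinearField (M : Type*) [TopologicalSpace M] [ChartedSpace H M] :=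
  (x : M) → TangentSpace I x →ₗ[ℂ] TangentSpace I x →ₗ⋆[ℂ] ℂ

/-- The components `g_{i j̄} = g(φ_* ∂/∂vⁱ, φ_* ∂/∂vʲ)` of the pullback of `g` by `φ : ℂᵐ → M`. -/
def metricTensor (g : SesquilinearField I M) (φ : CSpace m → M) (v : CSpace m) :
    Matrix (Fin m) (Fin m) ℂ :=
  Matrix.of fun i j =>
    g (φ v) (mfderiv 𝓘(ℂ, CSpace m) I φ v (stdVec i)) (mfderiv 𝓘(ℂ, CSpace m) I φ v (stdVec j))

/-- A quasi-coordinate `(V, φ)` of an open subset `𝒰` of a complex manifold: a domain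
`V ⊆ ℂᵐ` and a holomorphic map `φ : V → 𝒰` whose differential is everywhere invertible. -/
structure QuasiCoordinate (m : ℕ) (𝒰 : Set M) where
  domain : Set (CSpace m)
  map : CSpace m → M
  isOpen_domain : IsOpen domain
  isConnected_domain : IsConnected domain
  mapsTo : MapsTo map domain 𝒰
  holomorphic : MDifferentiableOn 𝓘(ℂ, CSpace m) I map domain
  maxRank : ∀ v ∈ domain, Function.Bijective (mfderiv 𝓘(ℂ, CSpace m) I map v)

/-- `U` is a neighbourhood of the exceptional set `Z` with `Z` itself removed. When `Z` is
compact and is contracted to a point `o`, these are exactly the punctured open neighbourhoods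
of `o`. -/
def IsPuncturedNhd (Z U : Set M) : Prop :=
  IsOpen U ∧ Disjoint U Z ∧ IsOpen (U ∪ Z)

/-- `Γ` is a system of quasi-coordinates of `(𝒰, g)`, where `𝒰` is a punctured neighbourhood of
the point `o` to which `Z` is contracted, and `U ⊆ 𝒰` is the smaller neighbourhood of `o` that
occurs in the definition. -/
structure IsQuasiCoordinateSystem (Z 𝒰 U : Set M) (g : SesquilinearField I M)
    (Γ : Set (QuasiCoordinate I m 𝒰)) : Prop where
  cover : 𝒰 = ⋃ α ∈ Γ, α.map '' α.domain
  isPuncturedNhd : IsPuncturedNhd Z U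
  subset : U ⊆ 𝒰
  finite_cover : ∃ F ⊆ Γ, F.Finite ∧ (∀ α ∈ F, InjOn α.map α.domain) ∧
    𝒰 \ U ⊆ ⋃ α ∈ F, α.map '' α.domain
  uniform_interior : ∃ ε : ℝ, 0 < ε ∧ ∀ x ∈ U, ∃ β ∈ Γ, ∃ y ∈ β.domain, β.map y = x ∧
    ENNReal.ofReal ε ≤ Metric.infEDist y (frontier β.domain)
  smooth : ∀ α ∈ Γ, ∀ i j, ContDiffOn ℝ ∞ (fun v => metricTensor I g α.map v i j) α.domain
  uniform_equiv : ∃ c : ℝ, 0 < c ∧ ∀ α ∈ Γ, ∀ v ∈ α.domain,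
    (metricTensor I g α.map v - ((c⁻¹ : ℝ) : ℂ) • (1 : Matrix (Fin m) (Fin m) ℂ)).PosSemidef ∧
    ((c : ℂ) • (1 : Matrix (Fin m) (Fin m) ℂ) - metricTensor I g α.map v).PosSemidef
  uniform_deriv : ∃ B : ℕ → ℝ, ∀ α ∈ Γ, ∀ v ∈ α.domain, ∀ (p q : List (Fin m)) (i j : Fin m),
    ‖mixedDeriv p q (fun w => metricTensor I g α.map w i j) v‖ < B (p.length + q.length)

/-- `Ψ` exhibits the open set `D ⊆ M` as a holomorphic quotient of the unit ball of `ℂᵐ`: its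
restriction to the ball is a holomorphic covering map onto `D`. -/
structure IsBallUniformization (D : Set M) (Ψ : CSpace m → M) : Prop where
  holomorphic : MDifferentiableOn 𝓘(ℂ, CSpace m) I Ψ (unitBall m)
  image_eq : Ψ '' unitBall m = D
  isCovering : IsCoveringMapOn ((unitBall m).domRestrict Ψ) D

/-- `g` is the metric that the Bergman metric of the unit ball induces on its quotient by `Ψ`. -/
def IsInducedBergmanMetric (Ψ : CSpace m → M) (g : SesquilinearField I M) : Prop :=
  ∀ y ∈ unitBall m, metricTensor I g Ψ y = bergmanMetric (unitBall m) y

end QuasiCoordinates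

/-! ### Hermitian line bundles on a complex torus -/

section LineBundle

variable {n : ℕ} {A : Type*} [TopologicalSpace A] [ChartedSpace (CSpace n) A]

/-- `pr : ℂⁿ → A` identifies the complex manifold `A` with the complex torus `ℂⁿ / Λ`. -/
structure IsTorusProjection (Λ : Submodule ℤ (CSpace n)) (pr : CSpace n → A) : Prop where
  holomorphic : MDifferentiable 𝓘(ℂ, CSpace n) 𝓘(ℂ, CSpace n) pr
  bijective_mfderiv :
    ∀ z, Function.Bijective (mfderiv 𝓘(ℂ, CSpace n) 𝓘(ℂ, CSpace n) pr z)
  surjective : Function.Surjective pr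
  eq_iff : ∀ z z', pr z = pr z' ↔ z' - z ∈ Λ

variable {N : A → Type*} [TopologicalSpace (TotalSpace ℂ N)] [∀ x, TopologicalSpace (N x)]
  [∀ x, AddCommGroup (N x)] [∀ x, Module ℂ (N x)] [FiberBundle ℂ N]

/-- The zero section of `N`, as a subset of the total space. -/
def zeroSectionSet (N : A → Type*) [∀ x, AddCommGroup (N x)] : Set (TotalSpace ℂ N) :=
  {v | v.2 = 0}

variable (n) in
/-- A smooth Hermitian metric on the line bundle `N`, given as its quadratic form
`v ↦ ρ(v, v)` on the total space. -/
structure IsHermitianMetric (ρ : TotalSpace ℂ N → ℝ) : Prop where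
  pos : ∀ (x : A) (v : N x), v ≠ 0 → 0 < ρ ⟨x, v⟩
  smul : ∀ (x : A) (a : ℂ) (v : N x), ρ ⟨x, a • v⟩ = ‖a‖ ^ 2 * ρ ⟨x, v⟩
  smooth : ContMDiff (𝓘(ℝ, CSpace n).prod 𝓘(ℝ, ℂ)) 𝓘(ℝ, ℝ) ∞ ρ

/-- `s` is a holomorphic frame of `pr^* N` over the open set `O ⊆ ℂⁿ`. -/
structure IsLocalFrame (pr : CSpace n → A) (O : Set (CSpace n)) (s : CSpace n → TotalSpace ℂ N) :
    Prop where
  isOpen : IsOpen O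
  holomorphic : MDifferentiableOn 𝓘(ℂ, CSpace n) (𝓘(ℂ, CSpace n).prod 𝓘(ℂ, ℂ)) s O
  proj_eq : ∀ z ∈ O, (s z).proj = pr z
  ne_zero : ∀ z ∈ O, (s z).2 ≠ 0

/-- The Chern curvature `Θ = -∂∂̄ log ρ(s, s)` of `(N, ρ)` is negative definite everywhere. -/
def IsNegativelyCurved (pr : CSpace n → A) (ρ : TotalSpace ℂ N → ℝ) : Prop :=
  ∀ (O : Set (CSpace n)) (s : CSpace n → TotalSpace ℂ N), IsLocalFrame pr O s →
    ∀ z ∈ O, (complexHessian (fun w => Real.log (ρ (s w))) z).PosDef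

/-- The line bundle `N` is negative: it has a smooth Hermitian metric of negative curvature. -/
def IsNegativeLineBundle (pr : CSpace n → A) (N : A → Type*) [TopologicalSpace (TotalSpace ℂ N)]
    [∀ x, TopologicalSpace (N x)] [∀ x, AddCommGroup (N x)] [∀ x, Module ℂ (N x)]
    [FiberBundle ℂ N] : Prop :=
  ∃ ρ : TotalSpace ℂ N → ℝ, IsHermitianMetric n ρ ∧ IsNegativelyCurved pr ρ

/-- The curvature form of `(N, ρ)` is translation invariant on the torus: its coefficients in the
linear coordinates of `ℂⁿ` are constant. -/
def HasInvariantCurvature (pr : CSpace n → A) (ρ : TotalSpace ℂ N → ℝ) : Prop :=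
  ∃ W : Matrix (Fin n) (Fin n) ℂ,
    ∀ (O : Set (CSpace n)) (s : CSpace n → TotalSpace ℂ N), IsLocalFrame pr O s →
      ∀ z ∈ O, complexHessian (fun w => Real.log (ρ (s w))) z = W

/-- The punctured disc bundle `{v ∈ N : 0 < ρ(v, v) < e^{-k}}`. -/
def puncturedDiscBundle (ρ : TotalSpace ℂ N → ℝ) (k : ℝ) : Set (TotalSpace ℂ N) :=
  {v | 0 < ρ v ∧ ρ v < Real.exp (-k)}

end LineBundle

end

/-!
A negative line bundle on a complex torus, minus its zero section, is a quotient of the Siegel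
domain, an unbounded model of the ball, near the cusp at infinity. The dilations and Heisenberg
translations of the Siegel domain are isometries of the Bergman metric and act transitively.
Composing the quotient map with them, one obtains around every point of the cusp a chart in which
the metric is literally the same, which is what quasi-coordinates require.

*A metric of constant curvature.* The curvature of a given metric is a lattice periodic field of
matrices on `ℂⁿ` that is locally a complex Hessian `∂∂̄u`. One solves the Poisson equation for its
trace by Fourier series (`IsLatticePeriodic.exists_sumSqDeriv_eq`): the coefficients of a smooth
periodic function decay rapidly, and the symbol of the Laplacian is bounded away from zero at the
nonzero frequencies. Subtracting the Hessian of the solution leaves a Hessian field of constant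
trace; its entries are harmonic and periodic, hence constant
(`IsHessianField.exists_sub_complexHessian_eq`). The constant is the mean of the original
curvature, so that it is again negative. This gives `IsTorusProjection.exists_invariant_metric`.

*Uniformization.* Let the curvature be constant. After a linear change of coordinates it has the
potential `2 ‖z‖²` on `ℂⁿ`. Any other local potential differs from this one by the real part of a
holomorphic function (`exists_re_eq_of_complexHessian_eq_zero`), so that the pull-back of the bundle
has local holomorphic frames of squared norm `exp (2 ‖z‖²)`. Two of them differ by a locally
constant factor, and since `ℂⁿ` is simply connected they can be glued to a global frame `s`
(`IsHermitianMetric.exists_global_frame_eq_exp`). The map `(z, ζ) ↦ e^ζ s(z)` takes the Siegel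
domain `Re ζ + ‖z‖² < 0` onto the punctured disc bundle. By Liouville's theorem the automorphy
factors of `s` are those of the Heisenberg group (`exists_automorphy_factor`), and therefore the
fibres are the orbits of a group of Heisenberg translations (`isCuspUniformization_expFrame`).
Together with the Cayley transform this is a covering by the ball.

*The metric and the charts.* The transformation law of the Bergman kernel shows that the kernel of
the Siegel domain is a constant times `r ^ (-(n + 2))`, where `r = -Re ζ - ‖z‖²`; the constant is
positive by the mean value property. The metric `-(n + 2) ∂∂̄ log r` is then positive definite and
descends to the quotient. The part of the disc bundle away from the cusp is the image of a compact
set, because the translations are cocompact, and needs only finitely many injective charts. Near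
the cusp a fixed ball about `(0, -1)` serves at all points, and the uniform bounds follow from the
compactness of its closure (`IsCuspUniformization.exists_quasiCoordinateSystem`).
-/

noncomputable section

set_option linter.unusedSectionVars false

/-! ### Smoothness of holomorphic functions of several variables -/

section SeveralVariables

variable {E F : Type*} [NormedAddCommGroup E] [NormedSpace ℂ E]
  [NormedAddCommGroup F] [NormedSpace ℂ F] [CompleteSpace F]

/-- Cauchy's formula for a directional derivative, on the complex line through `z` spanned
by `v`. -/
lemma fderiv_apply_eq_circleIntegral {f : E → F} {s : Set E} (hs : IsOpen s)
    (hf : DifferentiableOn ℂ f s) {z v : E} {R : ℝ} (hR : 0 < R)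
    (hz : ∀ w : ℂ, ‖w‖ ≤ R → z + w • v ∈ s) :
    fderiv ℂ f z v =
      (2 * Real.pi * Complex.I : ℂ)⁻¹ • ∮ w in C(0, R), w⁻¹ ^ 2 • f (z + w • v) := by
  have hline : ∀ w : ℂ, HasDerivAt (fun w : ℂ => z + w • v) v w := fun w => by
    simpa using ((hasDerivAt_id w).smul_const v).const_add z
  have hd : ∀ w : ℂ, ‖w‖ ≤ R → HasDerivAt (fun w : ℂ => f (z + w • v))
      (fderiv ℂ f (z + w • v) v) w := fun w hw =>
    (hf.differentiableAt (hs.mem_nhds (hz w hw))).hasFDerivAt.comp_hasDerivAt w (hline w)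
  have h0 := (hd 0 (by simpa using hR.le)).deriv
  simp only [zero_smul, add_zero] at h0
  have hdc : DiffContOnCl ℂ (fun w : ℂ => f (z + w • v)) (Metric.ball 0 R) := by
    refine DifferentiableOn.diffContOnCl fun w hw => ?_
    have : ‖w‖ ≤ R := by simpa using Metric.closure_ball_subset_closedBall hw
    exact (hd w this).differentiableAt.differentiableWithinAt
  have := hdc.deriv_eq_smul_circleIntegral hR
  rw [h0] at this
  have h2 : ∮ w in C(0, R), w⁻¹ ^ 2 • f (z + w • v) =
      (2 * Real.pi * Complex.I : ℂ) • fderiv ℂ f z v := by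
    simpa [zpow_neg, inv_pow] using this
  rw [h2, inv_smul_smul₀ Complex.two_pi_I_ne_zero]

lemma exists_ball_add_smul_mem {s : Set E} (hs : IsOpen s) {z₀ : E} (hz₀ : z₀ ∈ s) (v : E) :
    ∃ R > 0, ∃ δ > 0, ∀ z ∈ Metric.ball z₀ δ, ∀ w : ℂ, ‖w‖ ≤ R → z + w • v ∈ s := by
  have hc : ContinuousAt (fun p : ℂ × E => p.2 + p.1 • v) (0, z₀) := by fun_prop
  have h := hc.preimage_mem_nhds (t := s) (by simpa using hs.mem_nhds hz₀)
  rw [nhds_prod_eq] at h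
  obtain ⟨t, ht, u, hu, htu⟩ := Filter.mem_prod_iff.mp h
  obtain ⟨R, hR, hRt⟩ := Metric.nhds_basis_closedBall.mem_iff.mp ht
  obtain ⟨δ, hδ, hδu⟩ := Metric.mem_nhds_iff.mp hu
  exact ⟨R, hR, δ, hδ, fun z hz w hw => htu (mk_mem_prod (hRt (by simpa using hw)) (hδu hz))⟩

omit [NormedSpace ℂ E] [NormedSpace ℂ F] [CompleteSpace F] in
lemma exists_bound_of_continuousOn [ProperSpace E] {G : E × ℝ → F} {z₀ : E} {δ : ℝ} (hδ : 0 < δ)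
    (hG : ContinuousOn G (Metric.ball z₀ δ ×ˢ univ)) :
    ∃ C : ℝ, ∀ t ∈ uIoc 0 (2 * Real.pi), ∀ z ∈ Metric.ball z₀ (δ / 2), ‖G (z, t)‖ ≤ C := by
  have hK : IsCompact (Metric.closedBall z₀ (δ / 2) ×ˢ uIcc (0 : ℝ) (2 * Real.pi)) :=
    (isCompact_closedBall _ _).prod isCompact_uIcc
  obtain ⟨C, hC⟩ := hK.exists_bound_of_continuousOn (f := G) (hG.mono (prod_mono
    (Metric.closedBall_subset_ball (by linarith)) (subset_univ _)))
  exact ⟨C, fun t ht z hz => hC _ ⟨Metric.ball_subset_closedBall hz, uIoc_subset_uIcc ht⟩⟩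

/-- The integrand of Cauchy's formula for the derivative is jointly continuous. -/
lemma continuousOn_cauchy_integrand {X : Type*} [NormedAddCommGroup X] [NormedSpace ℂ X]
    {g : E → X} {s : Set E} (hg : ContinuousOn g s) {z₀ v : E} {R δ : ℝ} (hR : 0 < R)
    (h : ∀ z ∈ Metric.ball z₀ δ, ∀ w : ℂ, ‖w‖ ≤ R → z + w • v ∈ s) :
    ContinuousOn (fun p : E × ℝ => deriv (circleMap 0 R) p.2 •
      (circleMap 0 R p.2)⁻¹ ^ 2 • g (p.1 + circleMap 0 R p.2 • v)) (Metric.ball z₀ δ ×ˢ univ) := by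
  have h1 : Continuous fun p : E × ℝ => circleMap 0 R p.2 :=
    (continuous_circleMap 0 R).comp continuous_snd
  have hne : ∀ p : E × ℝ, circleMap 0 R p.2 ≠ 0 := fun p => circleMap_ne_center hR.ne'
  refine ContinuousOn.smul ?_ (ContinuousOn.smul ?_ ?_)
  · simp only [deriv_circleMap]
    fun_prop
  · exact ((h1.inv₀ hne).pow 2).continuousOn
  · refine hg.comp (by fun_prop) fun p hp => ?_
    exact h _ hp.1 _ (by simp [abs_of_pos hR])

lemma eventually_fderiv_apply_eq {f : E → F} {s : Set E} (hs : IsOpen s)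
    (hf : DifferentiableOn ℂ f s) {z₀ v : E} {R δ : ℝ} (hR : 0 < R) (hδ : 0 < δ)
    (h : ∀ z ∈ Metric.ball z₀ δ, ∀ w : ℂ, ‖w‖ ≤ R → z + w • v ∈ s) :
    (fun z => (2 * Real.pi * Complex.I : ℂ)⁻¹ • ∫ t in (0 : ℝ)..2 * Real.pi,
      deriv (circleMap 0 R) t • (circleMap 0 R t)⁻¹ ^ 2 • f (z + circleMap 0 R t • v))
      =ᶠ[𝓝 z₀] fun z => fderiv ℂ f z v := by
  filter_upwards [Metric.ball_mem_nhds _ hδ] with z hz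
  rw [fderiv_apply_eq_circleIntegral hs hf hR (h z hz), circleIntegral]

variable [FiniteDimensional ℂ E]

lemma continuousOn_fderiv_apply {f : E → F} {s : Set E} (hs : IsOpen s)
    (hf : DifferentiableOn ℂ f s) (v : E) : ContinuousOn (fun z => fderiv ℂ f z v) s := by
  have : ProperSpace E := FiniteDimensional.proper ℂ E
  intro z₀ hz₀
  obtain ⟨R, hR, δ, hδ, h⟩ := exists_ball_add_smul_mem hs hz₀ v
  refine ContinuousAt.continuousWithinAt ?_
  refine ContinuousAt.congr ?_ (eventually_fderiv_apply_eq hs hf hR hδ h)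
  refine ContinuousAt.const_smul ?_ _
  have hcont := continuousOn_cauchy_integrand hf.continuousOn hR h
  obtain ⟨C, hC⟩ := exists_bound_of_continuousOn hδ hcont
  have hopen : IsOpen (Metric.ball z₀ δ ×ˢ (univ : Set ℝ)) := Metric.isOpen_ball.prod isOpen_univ
  refine intervalIntegral.continuousAt_of_dominated_interval (bound := fun _ => C) ?_ ?_
    intervalIntegrable_const ?_
  · filter_upwards [Metric.ball_mem_nhds _ hδ] with z hz
    refine Continuous.aestronglyMeasurable ?_
    exact hcont.comp_continuous (by fun_prop : Continuous fun t : ℝ => (z, t))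
      fun t => ⟨hz, mem_univ _⟩
  · filter_upwards [Metric.ball_mem_nhds _ (half_pos hδ)] with z hz
    exact Filter.Eventually.of_forall fun t ht => hC t ht z hz
  · refine Filter.Eventually.of_forall fun t _ => ?_
    exact (hcont.continuousAt (hopen.mem_nhds (mk_mem_prod (Metric.mem_ball_self hδ)
      (mem_univ t)))).comp (f := fun z => (z, t)) (by fun_prop)

lemma continuousOn_fderiv_of_differentiableOn {f : E → F} {s : Set E} (hs : IsOpen s)
    (hf : DifferentiableOn ℂ f s) : ContinuousOn (fderiv ℂ f) s :=
  continuousOn_clm_apply.mpr (continuousOn_fderiv_apply hs hf)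

/-- A directional derivative of a holomorphic function is holomorphic: Cauchy's formula may be
differentiated under the integral sign, the derivative being continuous. -/
lemma differentiableOn_fderiv_apply {f : E → F} {s : Set E} (hs : IsOpen s)
    (hf : DifferentiableOn ℂ f s) (v : E) : DifferentiableOn ℂ (fun z => fderiv ℂ f z v) s := by
  have : ProperSpace E := FiniteDimensional.proper ℂ E
  intro z₀ hz₀
  obtain ⟨R, hR, δ, hδ, h⟩ := exists_ball_add_smul_mem hs hz₀ v
  refine DifferentiableAt.differentiableWithinAt ?_
  refine DifferentiableAt.congr_of_eventuallyEq ?_ (eventually_fderiv_apply_eq hs hf hR hδ h).symm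
  refine DifferentiableAt.const_smul ?_ _
  have hcont := continuousOn_cauchy_integrand hf.continuousOn hR h
  have hcont' := continuousOn_cauchy_integrand (continuousOn_fderiv_of_differentiableOn hs hf) hR h
  obtain ⟨C, hC⟩ := exists_bound_of_continuousOn hδ hcont'
  have hslice : ∀ z : E, Continuous fun t : ℝ => (z, t) := fun z => by fun_prop
  refine (intervalIntegral.hasFDerivAt_integral_of_dominated_of_fderiv_le (𝕜 := ℂ)
    (bound := fun _ => C) (s := Metric.ball z₀ (δ / 2))
    (F' := fun z t => deriv (circleMap 0 R) t • (circleMap 0 R t)⁻¹ ^ 2 •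
      fderiv ℂ f (z + circleMap 0 R t • v))
    (Metric.ball_mem_nhds _ (half_pos hδ)) ?_ ?_ ?_ ?_ intervalIntegrable_const
    ?_).differentiableAt
  · filter_upwards [Metric.ball_mem_nhds _ hδ] with z hz
    exact (hcont.comp_continuous (hslice z) fun t => ⟨hz, mem_univ _⟩).aestronglyMeasurable
  · exact (hcont.comp_continuous (hslice z₀)
      fun t => ⟨Metric.mem_ball_self hδ, mem_univ _⟩).intervalIntegrable _ _
  · exact (hcont'.comp_continuous (hslice z₀)
      fun t => ⟨Metric.mem_ball_self hδ, mem_univ _⟩).aestronglyMeasurable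
  · exact Filter.Eventually.of_forall fun t ht z hz => hC t ht z hz
  · refine Filter.Eventually.of_forall fun t _ z hz => ?_
    refine HasFDerivAt.const_smul (HasFDerivAt.const_smul ?_ _) _
    have hmem : z + circleMap 0 R t • v ∈ s :=
      h z (Metric.ball_subset_ball (by linarith) hz) _ (by simp [abs_of_pos hR])
    exact (hasFDerivAt_comp_add_right (circleMap 0 R t • v)).mpr
      (hf.differentiableAt (hs.mem_nhds hmem)).hasFDerivAt

/-- A function of several complex variables that is complex differentiable on an open set is
smooth there. -/
theorem DifferentiableOn.contDiffOn_of_isOpen {f : E → F} {s : Set E}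
    (hf : DifferentiableOn ℂ f s) (hs : IsOpen s) : ContDiffOn ℂ ∞ f s := by
  refine contDiffOn_infty.mpr fun k => ?_
  induction k generalizing f with
  | zero => exact contDiffOn_zero.mpr hf.continuousOn
  | succ k ih =>
    rw [Nat.cast_add, Nat.cast_one, contDiffOn_succ_iff_fderiv_of_isOpen hs]
    refine ⟨hf, by simp, contDiffOn_clm_apply.mpr fun v => ?_⟩
    exact ih (differentiableOn_fderiv_apply hs hf v)

end SeveralVariables

/-! ### Wirtinger calculus -/

section Wirtinger

variable {m l : ℕ}

lemma contDiffAt_of_eventually_differentiableAt {E F : Type*} [NormedAddCommGroup E]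
    [NormedSpace ℂ E] [FiniteDimensional ℂ E] [NormedAddCommGroup F] [NormedSpace ℂ F]
    [CompleteSpace F] {f : E → F} {v : E} (hf : ∀ᶠ w in 𝓝 v, DifferentiableAt ℂ f w) :
    ContDiffAt ℂ ∞ f v := by
  obtain ⟨s, hs, hso, hvs⟩ := eventually_nhds_iff.mp hf
  have : DifferentiableOn ℂ f s := fun w hw => (hs w hw).differentiableWithinAt
  exact (this.contDiffOn_of_isOpen hso).contDiffAt (hso.mem_nhds hvs)

/-- The first order operator `(∂/∂xⁱ + c ∂/∂yⁱ) / 2`; the values `c = ∓√-1` give `∂/∂vⁱ` and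
`∂/∂v̄ⁱ`. -/
def wirtinger (c : ℂ) (i : Fin m) (f : CSpace m → ℂ) (v : CSpace m) : ℂ :=
  (fderiv ℝ f v (stdVec i) + c * fderiv ℝ f v (Complex.I • stdVec i)) / 2

lemma dHol_eq_wirtinger (i : Fin m) : dHol i = wirtinger (-Complex.I) i := by
  funext f v
  simp [dHol, wirtinger, sub_eq_add_neg]

lemma dAnti_eq_wirtinger (i : Fin m) : dAnti i = wirtinger Complex.I i := rfl

lemma wirtinger_congr {c : ℂ} {i : Fin m} {f g : CSpace m → ℂ} {v : CSpace m}
    (h : f =ᶠ[𝓝 v] g) : wirtinger c i f =ᶠ[𝓝 v] wirtinger c i g := by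
  filter_upwards [h.fderiv (𝕜 := ℝ)] with w hw
  rw [wirtinger, wirtinger, hw]

lemma ContDiffAt.wirtinger {c : ℂ} {i : Fin m} {f : CSpace m → ℂ} {v : CSpace m}
    (h : ContDiffAt ℝ ∞ f v) : ContDiffAt ℝ ∞ (wirtinger c i f) v := by
  have h1 : ContDiffAt ℝ ∞ (fderiv ℝ f) v := h.fderiv_right (by simp)
  have h2 : ∀ x : CSpace m, ContDiffAt ℝ ∞ (fun w => fderiv ℝ f w x) v := fun x =>
    h1.clm_apply contDiffAt_const
  unfold _root_.wirtinger
  exact ((h2 _).add (contDiffAt_const.mul (h2 _))).div_const _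

lemma ContDiffOn.wirtinger {c : ℂ} {i : Fin m} {f : CSpace m → ℂ} {s : Set (CSpace m)}
    (hs : IsOpen s) (h : ContDiffOn ℝ ∞ f s) : ContDiffOn ℝ ∞ (wirtinger c i f) s :=
  fun _ hv => (ContDiffAt.wirtinger (h.contDiffAt (hs.mem_nhds hv))).contDiffWithinAt

lemma wirtinger_add {c : ℂ} {i : Fin m} {f g : CSpace m → ℂ} {v : CSpace m}
    (hf : DifferentiableAt ℝ f v) (hg : DifferentiableAt ℝ g v) :
    wirtinger c i (fun w => f w + g w) v = wirtinger c i f v + wirtinger c i g v := by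
  simp only [wirtinger, fderiv_fun_add hf hg, add_apply]
  ring

lemma wirtinger_mul {c : ℂ} {i : Fin m} {f g : CSpace m → ℂ} {v : CSpace m}
    (hf : DifferentiableAt ℝ f v) (hg : DifferentiableAt ℝ g v) :
    wirtinger c i (fun w => f w * g w) v =
      f v * wirtinger c i g v + g v * wirtinger c i f v := by
  simp only [wirtinger, fderiv_fun_mul hf hg, add_apply, smul_apply,
    smul_eq_mul]
  ring

lemma wirtinger_const {c a : ℂ} {i : Fin m} {v : CSpace m} :
    wirtinger c i (fun _ => a) v = 0 := by
  simp [wirtinger]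

lemma wirtinger_const_mul {c a : ℂ} {i : Fin m} {f : CSpace m → ℂ} {v : CSpace m}
    (hf : DifferentiableAt ℝ f v) :
    wirtinger c i (fun w => a * f w) v = a * wirtinger c i f v := by
  rw [wirtinger_mul (differentiableAt_const a) hf, wirtinger_const]
  ring

lemma wirtinger_sum {ι : Type*} {c : ℂ} {i : Fin m} (s : Finset ι) {f : ι → CSpace m → ℂ}
    {v : CSpace m} (hf : ∀ k ∈ s, DifferentiableAt ℝ (f k) v) :
    wirtinger c i (fun w => ∑ k ∈ s, f k w) v = ∑ k ∈ s, wirtinger c i (f k) v := by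
  simp only [wirtinger, fderiv_fun_sum hf, sum_apply, Finset.mul_sum,
    ← Finset.sum_add_distrib, Finset.sum_div]

lemma wirtinger_conj {c : ℂ} {i : Fin m} {f : CSpace m → ℂ} {v : CSpace m} :
    wirtinger c i (fun w => starRingEnd ℂ (f w)) v = starRingEnd ℂ (wirtinger (starRingEnd ℂ c) i f v) := by
  have h : fderiv ℝ (fun w => starRingEnd ℂ (f w)) v =
      (Complex.conjCLE : ℂ →L[ℝ] ℂ).comp (fderiv ℝ f v) :=
    Complex.conjCLE.comp_fderiv
  simp [wirtinger, h, map_ofNat]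

lemma ContDiffAt.fderiv_fderiv_apply {f : CSpace m → ℂ} {v : CSpace m} (hf : ContDiffAt ℝ ∞ f v)
    (x y : CSpace m) :
    fderiv ℝ (fun w => fderiv ℝ f w x) v y = fderiv ℝ (fderiv ℝ f) v y x := by
  have h1 : DifferentiableAt ℝ (fderiv ℝ f) v :=
    (hf.fderiv_right (m := ∞) (by simp)).differentiableAt (by simp)
  rw [fderiv_clm_apply h1 (differentiableAt_const x)]
  simp

lemma ContDiffAt.fderiv_fderiv_comm {f : CSpace m → ℂ} {v : CSpace m} (hf : ContDiffAt ℝ ∞ f v)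
    (x y : CSpace m) : fderiv ℝ (fderiv ℝ f) v x y = fderiv ℝ (fderiv ℝ f) v y x := by
  have h : IsSymmSndFDerivAt ℝ f v := hf.isSymmSndFDerivAt (by
    rw [minSmoothness_of_isRCLikeNormedField]
    exact WithTop.coe_le_coe.mpr (le_top : (2 : ℕ∞) ≤ ⊤))
  exact h x y

lemma fderiv_wirtinger {f : CSpace m → ℂ} {v : CSpace m} (hf : ContDiffAt ℝ ∞ f v) (c : ℂ)
    (i : Fin m) (y : CSpace m) : fderiv ℝ (wirtinger c i f) v y =
      (fderiv ℝ (fderiv ℝ f) v y (stdVec i) +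
        c * fderiv ℝ (fderiv ℝ f) v y (Complex.I • stdVec i)) / 2 := by
  have h1 : DifferentiableAt ℝ (fderiv ℝ f) v :=
    (hf.fderiv_right (m := ∞) (by simp)).differentiableAt (by simp)
  have h3 : ∀ x : CSpace m, DifferentiableAt ℝ (fun w => fderiv ℝ f w x) v := fun x =>
    h1.clm_apply (differentiableAt_const x)
  unfold wirtinger
  simp only [div_eq_mul_inv]
  rw [fderiv_mul_const (c := fun w => fderiv ℝ f w (stdVec i) +
      c * fderiv ℝ f w (Complex.I • stdVec i)) ((h3 _).add ((h3 _).const_mul _)),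
    fderiv_fun_add (h3 _) ((h3 _).const_mul _), fderiv_const_mul (h3 _)]
  simp only [smul_apply, add_apply, smul_eq_mul, hf.fderiv_fderiv_apply]
  ring

lemma wirtinger_comm {c d : ℂ} {i j : Fin m} {f : CSpace m → ℂ} {v : CSpace m}
    (hf : ContDiffAt ℝ ∞ f v) :
    wirtinger c i (wirtinger d j f) v = wirtinger d j (wirtinger c i f) v := by
  rw [wirtinger, wirtinger, fderiv_wirtinger hf, fderiv_wirtinger hf, fderiv_wirtinger hf,
    fderiv_wirtinger hf, hf.fderiv_fderiv_comm (stdVec j) (stdVec i),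
    hf.fderiv_fderiv_comm (stdVec j) (Complex.I • stdVec i),
    hf.fderiv_fderiv_comm (Complex.I • stdVec j) (stdVec i),
    hf.fderiv_fderiv_comm (Complex.I • stdVec j) (Complex.I • stdVec i)]
  ring

/-! ### The chain rule and the complex Hessian -/

lemma fderiv_real_eq {F : Type*} [NormedAddCommGroup F] [NormedSpace ℂ F] {f : CSpace m → F}
    {v : CSpace m} (hf : DifferentiableAt ℂ f v) (x : CSpace m) :
    fderiv ℝ f v x = fderiv ℂ f v x := by
  rw [(hf.hasFDerivAt.restrictScalars ℝ).fderiv]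
  rfl

lemma dAnti_of_differentiableAt {f : CSpace m → ℂ} {v : CSpace m} {i : Fin m}
    (hf : DifferentiableAt ℂ f v) : dAnti i f v = 0 := by
  rw [dAnti, fderiv_real_eq hf, fderiv_real_eq hf, map_smul, smul_eq_mul, ← mul_assoc,
    Complex.I_mul_I]
  ring

lemma dHol_of_differentiableAt {f : CSpace m → ℂ} {v : CSpace m} {i : Fin m}
    (hf : DifferentiableAt ℂ f v) : dHol i f v = fderiv ℂ f v (stdVec i) := by
  rw [dHol, fderiv_real_eq hf, fderiv_real_eq hf, map_smul, smul_eq_mul, ← mul_assoc,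
    Complex.I_mul_I]
  ring

lemma dHol_conj {f : CSpace m → ℂ} {v : CSpace m} {i : Fin m} :
    dHol i (fun w => starRingEnd ℂ (f w)) v = starRingEnd ℂ (dAnti i f v) := by
  rw [dHol_eq_wirtinger, wirtinger_conj]
  simp [dAnti_eq_wirtinger]

lemma dAnti_conj {f : CSpace m → ℂ} {v : CSpace m} {i : Fin m} :
    dAnti i (fun w => starRingEnd ℂ (f w)) v = starRingEnd ℂ (dHol i f v) := by
  rw [dAnti_eq_wirtinger, wirtinger_conj]
  simp [dHol_eq_wirtinger]

lemma CSpace.eq_sum_stdVec (x : CSpace m) :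
    x = ∑ b, ((x b).re • stdVec b + (x b).im • (Complex.I • stdVec b)) := by
  ext a
  rw [WithLp.ofLp_sum, Finset.sum_apply, Finset.sum_eq_single a]
  · simp [stdVec, mul_comm Complex.I]
  · intro b _ hb
    simp [stdVec, hb.symm]
  · simp

/-- The real differential in terms of the Wirtinger derivatives. -/
lemma fderiv_eq_sum_wirtinger (f : CSpace m → ℂ) (v x : CSpace m) :
    fderiv ℝ f v x = ∑ b, (x b * dHol b f v + starRingEnd ℂ (x b) * dAnti b f v) := by
  conv_lhs => rw [CSpace.eq_sum_stdVec x]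
  rw [map_sum]
  refine Finset.sum_congr rfl fun b _ => ?_
  simp only [map_add, map_smul, dHol, dAnti, Complex.real_smul]
  obtain ⟨p, q⟩ := x b
  simp only [Complex.mk_eq_add_mul_I, map_add, map_mul, Complex.conj_ofReal, Complex.conj_I]
  linear_combination ((q : ℂ) * fderiv ℝ f v (Complex.I • stdVec b)) * Complex.I_mul_I

/-- The sesquilinear form `∑ G_{a b̄} xᵃ ȳᵇ` with matrix `G`. -/
def sesqForm (G : Matrix (Fin m) (Fin m) ℂ) (x y : CSpace m) : ℂ :=
  ∑ a, ∑ b, x a * starRingEnd ℂ (y b) * G a b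

section ChainRule

variable {Φ : CSpace m → CSpace l} {v : CSpace m}

lemma differentiableAt_coord (hΦ : DifferentiableAt ℂ Φ v) (a : Fin l) :
    DifferentiableAt ℂ (fun w => Φ w a) v :=
  (EuclideanSpace.proj a : CSpace l →L[ℂ] ℂ).differentiableAt.comp v hΦ

lemma fderiv_comp_apply {g : CSpace l → ℂ} (hg : DifferentiableAt ℝ g (Φ v))
    (hΦ : DifferentiableAt ℂ Φ v) (x : CSpace m) :
    fderiv ℝ (fun w => g (Φ w)) v x =
      ∑ b, (fderiv ℂ Φ v x b * dHol b g (Φ v) + starRingEnd ℂ (fderiv ℂ Φ v x b) * dAnti b g (Φ v)) := by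
  have h := (hg.hasFDerivAt.comp v (hΦ.hasFDerivAt.restrictScalars ℝ)).fderiv
  have h' : fderiv ℝ (fun w => g (Φ w)) v x = fderiv ℝ g (Φ v) (fderiv ℂ Φ v x) :=
    congrArg (fun L => L x) h
  rw [h', fderiv_eq_sum_wirtinger]

lemma dHol_comp {g : CSpace l → ℂ} (hg : DifferentiableAt ℝ g (Φ v))
    (hΦ : DifferentiableAt ℂ Φ v) (i : Fin m) :
    dHol i (fun w => g (Φ w)) v = ∑ b, fderiv ℂ Φ v (stdVec i) b * dHol b g (Φ v) := by
  rw [dHol, fderiv_comp_apply hg hΦ, fderiv_comp_apply hg hΦ, Finset.mul_sum,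
    ← Finset.sum_sub_distrib, Finset.sum_div]
  refine Finset.sum_congr rfl fun b _ => ?_
  simp only [map_smul, PiLp.smul_apply, smul_eq_mul, map_mul, Complex.conj_I]
  linear_combination (-(fderiv ℂ Φ v (stdVec i) b * dHol b g (Φ v)) +
    starRingEnd ℂ (fderiv ℂ Φ v (stdVec i) b) * dAnti b g (Φ v)) / 2 * Complex.I_mul_I

lemma dAnti_comp {g : CSpace l → ℂ} (hg : DifferentiableAt ℝ g (Φ v))
    (hΦ : DifferentiableAt ℂ Φ v) (i : Fin m) :
    dAnti i (fun w => g (Φ w)) v = ∑ b, starRingEnd ℂ (fderiv ℂ Φ v (stdVec i) b) * dAnti b g (Φ v) := by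
  rw [dAnti, fderiv_comp_apply hg hΦ, fderiv_comp_apply hg hΦ, Finset.mul_sum,
    ← Finset.sum_add_distrib, Finset.sum_div]
  refine Finset.sum_congr rfl fun b _ => ?_
  simp only [map_smul, PiLp.smul_apply, smul_eq_mul, map_mul, Complex.conj_I]
  linear_combination ((fderiv ℂ Φ v (stdVec i) b * dHol b g (Φ v)) -
    starRingEnd ℂ (fderiv ℂ Φ v (stdVec i) b) * dAnti b g (Φ v)) / 2 * Complex.I_mul_I

lemma differentiableAt_fderiv_apply {F : Type*} [NormedAddCommGroup F] [NormedSpace ℂ F]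
    [CompleteSpace F] {f : CSpace m → F}
    (hf : ∀ᶠ w in 𝓝 v, DifferentiableAt ℂ f w) (x : CSpace m) :
    DifferentiableAt ℂ (fun w => fderiv ℂ f w x) v :=
  (((contDiffAt_of_eventually_differentiableAt hf).fderiv_right (m := ∞)
    (by simp)).differentiableAt (by simp)).clm_apply (differentiableAt_const x)

/-- The complex Hessian is natural under holomorphic maps. -/
lemma complexHessian_comp {u : CSpace l → ℝ} (hu : ContDiffAt ℝ ∞ u (Φ v))
    (hΦ : ∀ᶠ w in 𝓝 v, DifferentiableAt ℂ Φ w) (i j : Fin m) :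
    complexHessian (fun w => u (Φ w)) v i j =
      sesqForm (complexHessian u (Φ v)) (fderiv ℂ Φ v (stdVec i)) (fderiv ℂ Φ v (stdVec j)) := by
  have hΦv : DifferentiableAt ℂ Φ v := hΦ.self_of_nhds
  have hu' : ContDiffAt ℝ ∞ (fun w => (u w : ℂ)) (Φ v) :=
    Complex.ofRealCLM.contDiff.contDiffAt.comp _ hu
  have hev : ∀ᶠ w in 𝓝 v, DifferentiableAt ℝ (fun w => (u w : ℂ)) (Φ w) := by
    have h1 : ∀ᶠ y in 𝓝 (Φ v), ContDiffAt ℝ 1 (fun w => (u w : ℂ)) y :=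
      (hu'.of_le (by simp)).eventually (by simp)
    filter_upwards [hΦv.continuousAt.eventually h1] with w hw
    exact hw.differentiableAt (by simp)
  -- The chain rule is applied to `∂̄` on a neighbourhood of `v`, and then to `∂` at `v`.
  have h1 : dAnti j (fun w => (u (Φ w) : ℂ)) =ᶠ[𝓝 v] fun w =>
      ∑ b, starRingEnd ℂ (fderiv ℂ Φ w (stdVec j) b) * dAnti b (fun w => (u w : ℂ)) (Φ w) := by
    filter_upwards [hΦ, hev] with w hw hw'
    exact dAnti_comp hw' hw j
  have hd : ∀ b, DifferentiableAt ℂ (fun w => fderiv ℂ Φ w (stdVec j) b) v := fun b =>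
    differentiableAt_coord (Φ := fun w => fderiv ℂ Φ w (stdVec j))
      (differentiableAt_fderiv_apply hΦ _) b
  have hd' : ∀ b, DifferentiableAt ℝ (fun w => starRingEnd ℂ (fderiv ℂ Φ w (stdVec j) b)) v := fun b =>
    Complex.conjCLE.differentiableAt.comp v ((hd b).restrictScalars ℝ)
  have hg : ∀ b, DifferentiableAt ℝ (dAnti b (fun w => (u w : ℂ))) (Φ v) := fun b =>
    (ContDiffAt.wirtinger hu').differentiableAt (by simp)
  have hg' : ∀ b, DifferentiableAt ℝ (fun w => dAnti b (fun w => (u w : ℂ)) (Φ w)) v := fun b =>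
    (hg b).comp v (hΦv.restrictScalars ℝ)
  have h2 : complexHessian (fun w => u (Φ w)) v i j = dHol i (fun w =>
      ∑ b, starRingEnd ℂ (fderiv ℂ Φ w (stdVec j) b) * dAnti b (fun w => (u w : ℂ)) (Φ w)) v := by
    rw [complexHessian, Matrix.of_apply, dHol_eq_wirtinger]
    exact (wirtinger_congr h1).self_of_nhds
  rw [h2, dHol_eq_wirtinger, wirtinger_sum _ fun b _ => (hd' b).fun_mul (hg' b), sesqForm,
    Finset.sum_comm]
  refine Finset.sum_congr rfl fun b _ => ?_
  rw [wirtinger_mul (hd' b) (hg' b), ← dHol_eq_wirtinger, dHol_conj,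
    dAnti_of_differentiableAt (hd b), dHol_comp (hg b) hΦv, map_zero, mul_zero, add_zero,
    Finset.mul_sum]
  refine Finset.sum_congr rfl fun a _ => ?_
  rw [complexHessian, Matrix.of_apply]
  ring

end ChainRule

lemma complexHessian_congr {u u' : CSpace m → ℝ} {v : CSpace m} (h : u =ᶠ[𝓝 v] u') :
    complexHessian u v = complexHessian u' v := by
  ext i j
  have h' : (fun w => (u w : ℂ)) =ᶠ[𝓝 v] fun w => (u' w : ℂ) := by
    filter_upwards [h] with w hw
    rw [hw]
  simp only [complexHessian, Matrix.of_apply, dHol_eq_wirtinger, dAnti_eq_wirtinger]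
  exact (wirtinger_congr (wirtinger_congr h')).self_of_nhds

lemma ContDiffAt.ofReal {u : CSpace m → ℝ} {v : CSpace m} (hu : ContDiffAt ℝ ∞ u v) :
    ContDiffAt ℝ ∞ (fun w => (u w : ℂ)) v :=
  Complex.ofRealCLM.contDiff.contDiffAt.comp _ hu

lemma ContDiffAt.eventually_differentiableAt {F : Type*} [NormedAddCommGroup F]
    [NormedSpace ℝ F] {u : CSpace m → F} {v : CSpace m} (hu : ContDiffAt ℝ ∞ u v) :
    ∀ᶠ w in 𝓝 v, DifferentiableAt ℝ u w := by
  filter_upwards [(hu.of_le (m := 1) (by simp)).eventually (by simp)] with w hw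
  exact hw.differentiableAt (by simp)

lemma complexHessian_add {u u' : CSpace m → ℝ} {v : CSpace m} (hu : ContDiffAt ℝ ∞ u v)
    (hu' : ContDiffAt ℝ ∞ u' v) :
    complexHessian (fun w => u w + u' w) v = complexHessian u v + complexHessian u' v := by
  ext i j
  simp only [complexHessian, Matrix.of_apply, Matrix.add_apply, dHol_eq_wirtinger,
    dAnti_eq_wirtinger, Complex.ofReal_add]
  have h : wirtinger Complex.I j (fun w => (u w : ℂ) + (u' w : ℂ)) =ᶠ[𝓝 v] fun w =>
      wirtinger Complex.I j (fun w => (u w : ℂ)) w + wirtinger Complex.I j (fun w => (u' w : ℂ)) w := by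
    filter_upwards [hu.ofReal.eventually_differentiableAt, hu'.ofReal.eventually_differentiableAt]
      with w h1 h2
    exact wirtinger_add h1 h2
  rw [(wirtinger_congr h).self_of_nhds, wirtinger_add]
  · exact hu.ofReal.wirtinger.differentiableAt (by simp)
  · exact hu'.ofReal.wirtinger.differentiableAt (by simp)

lemma complexHessian_const_mul {u : CSpace m → ℝ} {v : CSpace m} (a : ℝ)
    (hu : ContDiffAt ℝ ∞ u v) :
    complexHessian (fun w => a * u w) v = (a : ℂ) • complexHessian u v := by
  ext i j
  simp only [complexHessian, Matrix.of_apply, Matrix.smul_apply, dHol_eq_wirtinger,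
    dAnti_eq_wirtinger, Complex.ofReal_mul, smul_eq_mul]
  have h : wirtinger Complex.I j (fun w => (a : ℂ) * (u w : ℂ)) =ᶠ[𝓝 v] fun w =>
      (a : ℂ) * wirtinger Complex.I j (fun w => (u w : ℂ)) w := by
    filter_upwards [hu.ofReal.eventually_differentiableAt] with w h1
    exact wirtinger_const_mul h1
  rw [(wirtinger_congr h).self_of_nhds, wirtinger_const_mul]
  exact hu.ofReal.wirtinger.differentiableAt (by simp)

lemma complexHessian_const {v : CSpace m} (a : ℝ) :
    complexHessian (fun _ : CSpace m => a) v = 0 := by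
  ext i j
  have h : wirtinger Complex.I j (fun _ : CSpace m => (a : ℂ)) = fun _ => 0 :=
    funext fun w => wirtinger_const
  simp [complexHessian, dHol_eq_wirtinger, dAnti_eq_wirtinger, h, wirtinger_const]

lemma complexHessian_const_add {u : CSpace m → ℝ} {v : CSpace m} (a : ℝ)
    (hu : ContDiffAt ℝ ∞ u v) :
    complexHessian (fun w => a + u w) v = complexHessian u v := by
  rw [complexHessian_add contDiffAt_const hu, complexHessian_const, zero_add]

/-- `log |h|²` is pluriharmonic for a holomorphic function `h` without zeros. -/
lemma complexHessian_log_norm_sq {h : CSpace m → ℂ} {v : CSpace m}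
    (hh : ∀ᶠ w in 𝓝 v, DifferentiableAt ℂ h w) (h0 : h v ≠ 0) :
    complexHessian (fun w => Real.log (‖h w‖ ^ 2)) v = 0 := by
  ext i j
  have hne : ∀ᶠ w in 𝓝 v, h w ≠ 0 := hh.self_of_nhds.continuousAt.eventually_ne h0
  have h1 : dAnti j (fun w => ((Real.log (‖h w‖ ^ 2) : ℝ) : ℂ)) =ᶠ[𝓝 v] fun w =>
      starRingEnd ℂ (fderiv ℂ h w (stdVec j) / h w) := by
    filter_upwards [hh, hne] with w hw hw0
    have hpos : ‖h w‖ ^ 2 ≠ 0 := by simpa using hw0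
    have hr : HasFDerivAt (fun w => ‖h w‖ ^ 2) _ w :=
      ((hw.hasFDerivAt).restrictScalars ℝ).norm_sq
    have hD : ∀ x, fderiv ℝ (fun w => ((Real.log (‖h w‖ ^ 2) : ℝ) : ℂ)) w x =
        fderiv ℂ h w x / h w + starRingEnd ℂ (fderiv ℂ h w x / h w) := fun x => by
      have := (Complex.ofRealCLM.hasFDerivAt.comp w (hr.log hpos)).fderiv
      refine (congrArg (fun L => L x) this).trans ?_
      have hn : ((‖h w‖ ^ 2 : ℝ) : ℂ) = h w * starRingEnd ℂ (h w) := by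
        rw [Complex.mul_conj, Complex.normSq_eq_norm_sq]
      have hc : starRingEnd ℂ (h w) ≠ 0 := by simpa using hw0
      simp only [ContinuousLinearMap.comp_apply, smul_apply, innerSL_apply_apply, smul_eq_mul,
        Complex.ofRealCLM_apply, ContinuousLinearMap.coe_restrictScalars', Complex.inner]
      rw [Complex.ofReal_mul, Complex.ofReal_inv, hn, two_smul, Complex.ofReal_add,
        Complex.re_eq_add_conj]
      simp only [map_mul, map_div₀, Complex.conj_conj]
      field_simp
      ring
    rw [dAnti, hD, hD]
    simp only [map_smul, smul_eq_mul, map_div₀, map_mul, Complex.conj_I]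
    linear_combination ((fderiv ℂ h w (stdVec j) / h w) -
      starRingEnd ℂ (fderiv ℂ h w (stdVec j)) / starRingEnd ℂ (h w)) / 2 * Complex.I_mul_I
  have hd : DifferentiableAt ℂ (fun w => fderiv ℂ h w (stdVec j) / h w) v := by
      simp only [div_eq_mul_inv]
      exact (differentiableAt_fderiv_apply hh _).fun_mul
        ((differentiableAt_inv h0).comp v hh.self_of_nhds)
  rw [complexHessian, Matrix.of_apply, dHol_eq_wirtinger, (wirtinger_congr h1).self_of_nhds,
    ← dHol_eq_wirtinger, dHol_conj, dAnti_of_differentiableAt hd]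
  simp

lemma contDiffAt_log_norm_sq {h : CSpace m → ℂ} {v : CSpace m}
    (hh : ∀ᶠ w in 𝓝 v, DifferentiableAt ℂ h w) (h0 : h v ≠ 0) :
    ContDiffAt ℝ ∞ (fun w => Real.log (‖h w‖ ^ 2)) v :=
  (((contDiffAt_of_eventually_differentiableAt hh).restrict_scalars ℝ).norm_sq ℝ).log (by simpa)

lemma complexHessian_norm_sq (v : CSpace m) :
    complexHessian (fun w : CSpace m => ‖w‖ ^ 2) v = 1 := by
  ext i j
  have h1 : dAnti j (fun w : CSpace m => ((‖w‖ ^ 2 : ℝ) : ℂ)) = fun w => w j := by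
    funext w
    have hr : HasFDerivAt (fun w : CSpace m => ‖w‖ ^ 2) _ w := (hasFDerivAt_id w).norm_sq
    have hD : ∀ x, fderiv ℝ (fun w : CSpace m => ((‖w‖ ^ 2 : ℝ) : ℂ)) w x =
        ((2 * (inner ℂ w x).re : ℝ) : ℂ) := fun x => by
      have := (Complex.ofRealCLM.hasFDerivAt.comp w hr).fderiv
      refine (congrArg (fun L => L x) this).trans ?_
      simp [two_smul, two_mul, PiLp.inner_apply]
    rw [dAnti, hD, hD, inner_smul_right]
    have : inner ℂ w (stdVec j) = starRingEnd ℂ (w j) := by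
      simp [stdVec, EuclideanSpace.inner_single_right]
    rw [this]
    apply Complex.ext <;> simp
  rw [complexHessian, Matrix.of_apply, h1]
  have hd : DifferentiableAt ℂ (fun w : CSpace m => w j) v :=
    (EuclideanSpace.proj j : CSpace m →L[ℂ] ℂ).differentiableAt
  rw [dHol_of_differentiableAt hd]
  have h2 := (EuclideanSpace.proj j : CSpace m →L[ℂ] ℂ).fderiv (x := v)
  have h3 : fderiv ℂ (fun w : CSpace m => w j) v (stdVec i) = stdVec i j :=
    congrArg (fun L => L (stdVec i)) h2
  rw [h3, Matrix.one_apply]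
  simp [stdVec, eq_comm]

end Wirtinger

/-! ### The Bergman kernel -/

section BergmanKernel

open scoped Pointwise

variable {m : ℕ}

/-- `Φ` maps `Ω₁` biholomorphically onto `Ω₂`, with inverse `Ψ`. -/
structure IsBiholomorphicOn (Φ Ψ : CSpace m → CSpace m) (Ω₁ Ω₂ : Set (CSpace m)) : Prop where
  isOpen_source : IsOpen Ω₁
  isOpen_target : IsOpen Ω₂
  differentiableOn : DifferentiableOn ℂ Φ Ω₁
  differentiableOn_symm : DifferentiableOn ℂ Ψ Ω₂
  mapsTo : MapsTo Φ Ω₁ Ω₂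
  mapsTo_symm : MapsTo Ψ Ω₂ Ω₁
  left_inv : ∀ z ∈ Ω₁, Ψ (Φ z) = z
  right_inv : ∀ z ∈ Ω₂, Φ (Ψ z) = z

lemma IsBiholomorphicOn.symm {Φ Ψ : CSpace m → CSpace m} {Ω₁ Ω₂ : Set (CSpace m)}
    (h : IsBiholomorphicOn Φ Ψ Ω₁ Ω₂) : IsBiholomorphicOn Ψ Φ Ω₂ Ω₁ :=
  ⟨h.2, h.1, h.4, h.3, h.6, h.5, h.8, h.7⟩

lemma IsBiholomorphicOn.image_eq {Φ Ψ : CSpace m → CSpace m} {Ω₁ Ω₂ : Set (CSpace m)}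
    (h : IsBiholomorphicOn Φ Ψ Ω₁ Ω₂) : Φ '' Ω₁ = Ω₂ :=
  h.mapsTo.image_subset.antisymm fun z hz => ⟨Ψ z, h.mapsTo_symm hz, h.right_inv z hz⟩

lemma IsBiholomorphicOn.injOn {Φ Ψ : CSpace m → CSpace m} {Ω₁ Ω₂ : Set (CSpace m)}
    (h : IsBiholomorphicOn Φ Ψ Ω₁ Ω₂) : InjOn Φ Ω₁ := fun x hx y hy hxy => by
  rw [← h.left_inv x hx, hxy, h.left_inv y hy]

/-- The complex Jacobian determinant. -/
def jacobian (Φ : CSpace m → CSpace m) (z : CSpace m) : ℂ := (fderiv ℂ Φ z).det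

/-- The real Jacobian of a holomorphic map is the squared modulus of the complex one. -/
lemma ofReal_abs_det_restrictScalars (L : CSpace m →L[ℂ] CSpace m) :
    ENNReal.ofReal |(L.restrictScalars ℝ).det| = ‖L.det‖ₑ ^ 2 := by
  have h : (L.restrictScalars ℝ).det = ‖L.det‖ ^ 2 := by
    have := LinearMap.det_restrictScalars (R := ℝ) (f := (L : CSpace m →ₗ[ℂ] CSpace m))
    rw [Algebra.norm_complex_apply, Complex.normSq_eq_norm_sq] at this
    exact this
  rw [h, abs_of_nonneg (by positivity), ENNReal.ofReal_pow (norm_nonneg _), ofReal_norm]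

lemma lintegral_image_eq_lintegral_jacobian {Φ : CSpace m → CSpace m} {Ω : Set (CSpace m)}
    (hΩ : IsOpen Ω) (hd : DifferentiableOn ℂ Φ Ω) (hinj : InjOn Φ Ω)
    (g : CSpace m → ENNReal) :
    ∫⁻ x in Φ '' Ω, g x = ∫⁻ x in Ω, ‖jacobian Φ x‖ₑ ^ 2 * g (Φ x) := by
  rw [lintegral_image_eq_lintegral_abs_det_fderiv_mul volume hΩ.measurableSet
    (f' := fun x => (fderiv ℂ Φ x).restrictScalars ℝ) (fun x hx =>
      ((hd.differentiableAt (hΩ.mem_nhds hx)).hasFDerivAt.restrictScalars ℝ).hasFDerivWithinAt)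
    hinj]
  simp only [ofReal_abs_det_restrictScalars, jacobian]

lemma differentiableAt_jacobian {Φ : CSpace m → CSpace m} {z : CSpace m}
    (hΦ : ∀ᶠ w in 𝓝 z, DifferentiableAt ℂ Φ w) : DifferentiableAt ℂ (jacobian Φ) z := by
  have h : jacobian Φ = fun w => Matrix.det (Matrix.of fun i j => fderiv ℂ Φ w (stdVec j) i) := by
    funext w
    rw [jacobian, ContinuousLinearMap.det,
      ← LinearMap.det_toMatrix (EuclideanSpace.basisFun (Fin m) ℂ).toBasis]
    congr 1
  have hd : ∀ i j, DifferentiableAt ℂ (fun w => fderiv ℂ Φ w (stdVec j) i) z := fun i j =>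
    differentiableAt_coord (Φ := fun w => fderiv ℂ Φ w (stdVec j))
      (differentiableAt_fderiv_apply hΦ _) i
  rw [h]
  simp only [Matrix.det_apply, Matrix.of_apply]
  refine DifferentiableAt.fun_sum fun σ _ => DifferentiableAt.const_smul ?_ _
  exact (HasFDerivAt.finsetProd fun i _ => (hd (σ i) i).hasFDerivAt).differentiableAt

/-- The set of values whose supremum is the Bergman kernel. -/
def bergmanValues (Ω : Set (CSpace m)) (z : CSpace m) : Set ℝ :=
  {t : ℝ | ∃ f : CSpace m → ℂ, DifferentiableOn ℂ f Ω ∧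
    ∫⁻ x in Ω, ‖f x‖ₑ ^ 2 ≤ 1 ∧ t = ‖f z‖ ^ 2}

lemma bergmanKernel_eq (Ω : Set (CSpace m)) (z : CSpace m) :
    bergmanKernel Ω z = sSup (bergmanValues Ω z) := rfl

section Transformation

variable {Φ Ψ : CSpace m → CSpace m} {Ω₁ Ω₂ : Set (CSpace m)}

/-- The pullback `f ↦ J · (f ∘ Φ)`, with `J` the Jacobian determinant, preserves `L²` norms. -/
lemma IsBiholomorphicOn.smul_mem (h : IsBiholomorphicOn Φ Ψ Ω₁ Ω₂) {z : CSpace m}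
    {t : ℝ} (ht : t ∈ bergmanValues Ω₂ (Φ z)) : ‖jacobian Φ z‖ ^ 2 * t ∈ bergmanValues Ω₁ z := by
  obtain ⟨f, hf, hint, rfl⟩ := ht
  refine ⟨fun w => jacobian Φ w * f (Φ w), ?_, ?_, ?_⟩
  · intro w hw
    have hev : ∀ᶠ x in 𝓝 w, DifferentiableAt ℂ Φ x := by
      filter_upwards [h.isOpen_source.mem_nhds hw] with x hx
      exact h.differentiableOn.differentiableAt (h.isOpen_source.mem_nhds hx)
    refine ((differentiableAt_jacobian hev).mul ?_).differentiableWithinAt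
    exact (hf.differentiableAt (h.isOpen_target.mem_nhds (h.mapsTo hw))).comp w hev.self_of_nhds
  · refine le_trans (le_of_eq ?_) hint
    rw [← h.image_eq, lintegral_image_eq_lintegral_jacobian h.isOpen_source h.differentiableOn
      h.injOn]
    simp only [enorm_mul, mul_pow]
  · rw [norm_mul, mul_pow]

lemma IsBiholomorphicOn.jacobian_mul (h : IsBiholomorphicOn Φ Ψ Ω₁ Ω₂) {z : CSpace m}
    (hz : z ∈ Ω₁) : jacobian Ψ (Φ z) * jacobian Φ z = 1 := by
  have h1 := h.differentiableOn.differentiableAt (h.isOpen_source.mem_nhds hz)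
  have h2 := h.differentiableOn_symm.differentiableAt (h.isOpen_target.mem_nhds (h.mapsTo hz))
  have h3 : fderiv ℂ (Ψ ∘ Φ) z = ContinuousLinearMap.id ℂ _ := by
    have : Ψ ∘ Φ =ᶠ[𝓝 z] id := by
      filter_upwards [h.isOpen_source.mem_nhds hz] with w hw
      exact h.left_inv w hw
    rw [this.fderiv_eq, fderiv_id]
  rw [fderiv_comp z h2 h1] at h3
  have h4 := congrArg (fun L : CSpace m →L[ℂ] CSpace m => LinearMap.det (L : CSpace m →ₗ[ℂ] CSpace m)) h3
  simp only [ContinuousLinearMap.toLinearMap_comp, LinearMap.det_comp] at h4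
  simpa [jacobian, ContinuousLinearMap.det] using h4

lemma IsBiholomorphicOn.jacobian_ne_zero (h : IsBiholomorphicOn Φ Ψ Ω₁ Ω₂) {z : CSpace m}
    (hz : z ∈ Ω₁) : jacobian Φ z ≠ 0 := right_ne_zero_of_mul_eq_one (h.jacobian_mul hz)

/-- The transformation law of the Bergman kernel under a biholomorphic map. -/
theorem IsBiholomorphicOn.bergmanKernel_eq (h : IsBiholomorphicOn Φ Ψ Ω₁ Ω₂) {z : CSpace m}
    (hz : z ∈ Ω₁) : bergmanKernel Ω₁ z = ‖jacobian Φ z‖ ^ 2 * bergmanKernel Ω₂ (Φ z) := by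
  have hset : bergmanValues Ω₁ z = (‖jacobian Φ z‖ ^ 2) • bergmanValues Ω₂ (Φ z) := by
    ext t
    rw [mem_smul_set]
    constructor
    · intro ht
      rw [← h.left_inv z hz] at ht
      refine ⟨_, h.symm.smul_mem ht, ?_⟩
      rw [smul_eq_mul, ← mul_assoc, ← mul_pow, ← norm_mul, mul_comm (jacobian Φ z),
        h.jacobian_mul hz]
      simp
    · rintro ⟨t, ht, rfl⟩
      exact h.smul_mem ht
  rw [_root_.bergmanKernel_eq, _root_.bergmanKernel_eq, hset,
    Real.sSup_smul_of_nonneg (by positivity), smul_eq_mul]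

end Transformation

lemma measurable_indicator_enorm_sq {f : CSpace m → ℂ} {Ω : Set (CSpace m)} (hΩ : IsOpen Ω)
    (hf : ContinuousOn f Ω) : Measurable (Ω.indicator fun x => ‖f x‖ₑ ^ 2) := by
  classical
  rw [← piecewise_eq_indicator]
  exact ContinuousOn.measurable_piecewise ((ENNReal.continuous_pow 2).comp_continuousOn hf.enorm)
    continuousOn_const hΩ.measurableSet

lemma lintegral_comp_smul_of_norm_eq_one {c : ℂ} (hc : ‖c‖ = 1) (g : CSpace m → ENNReal) :
    ∫⁻ x, g (c • x) = ∫⁻ x, g x := by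
  have hc0 : c ≠ 0 := by
    rintro rfl
    simp at hc
  have himg : (fun x : CSpace m => c • x) '' univ = univ := by
    rw [image_univ]
    exact (MulAction.surjective₀ hc0).range_eq
  have hd : ∀ x : CSpace m, HasFDerivAt (fun x : CSpace m => c • x)
      (c • ContinuousLinearMap.id ℂ (CSpace m)) x := fun x => (hasFDerivAt_id x).const_smul c
  have hJ : ∀ x : CSpace m, ‖jacobian (fun x : CSpace m => c • x) x‖ₑ = 1 := fun x => by
    rw [jacobian, (hd x).fderiv, ContinuousLinearMap.det]
    simp [← ofReal_norm, hc]
  have := lintegral_image_eq_lintegral_jacobian isOpen_univ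
    (fun x _ => (hd x).differentiableAt.differentiableWithinAt)
    (MulAction.injective₀ hc0).injOn g
  rw [himg] at this
  simpa [hJ] using this.symm

/-- The mean value property for the square of a holomorphic function on the unit ball, over the
circle through `x` about the origin. -/
lemma enorm_sq_zero_le_lintegral {f : CSpace m → ℂ} (hf : DifferentiableOn ℂ f (unitBall m))
    {x : CSpace m} (hx : x ∈ unitBall m) :
    ENNReal.ofReal (2 * Real.pi) * ‖f 0‖ₑ ^ 2 ≤
      ∫⁻ θ in Ioc 0 (2 * Real.pi), ‖f (circleMap 0 1 θ • x)‖ₑ ^ 2 := by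
  have hmem : ∀ w : ℂ, ‖w‖ ≤ 1 → w • x ∈ unitBall m := fun w hw => by
    rw [unitBall, mem_ball_zero_iff] at hx ⊢
    rw [norm_smul]
    exact lt_of_le_of_lt (mul_le_of_le_one_left (norm_nonneg _) hw) hx
  have hdc : DiffContOnCl ℂ (fun w : ℂ => f (w • x) ^ 2) (Metric.ball 0 |(1 : ℝ)|) := by
    refine DifferentiableOn.diffContOnCl fun w hw => ?_
    have hw' : ‖w‖ ≤ 1 := by simpa using Metric.closure_ball_subset_closedBall hw
    have h1 := hf.differentiableAt (Metric.isOpen_ball.mem_nhds (hmem w hw'))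
    have h2 : DifferentiableAt ℂ (fun w : ℂ => w • x) w := by fun_prop
    exact ((h1.comp w h2).pow 2).differentiableWithinAt
  have h := hdc.circleAverage
  rw [Real.circleAverage_def, zero_smul] at h
  have h2 : ∫ θ in (0 : ℝ)..2 * Real.pi, f (circleMap 0 1 θ • x) ^ 2 =
      (2 * Real.pi) • f 0 ^ 2 := by
    rw [← h, smul_inv_smul₀ Real.two_pi_pos.ne']
  have h3 := enorm_integral_le_lintegral_enorm (μ := volume.restrict (Ioc 0 (2 * Real.pi)))
    fun θ : ℝ => f (circleMap 0 1 θ • x) ^ 2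
  rw [← intervalIntegral.integral_of_le Real.two_pi_pos.le, h2, enorm_smul,
    Real.enorm_of_nonneg Real.two_pi_pos.le] at h3
  simpa only [enorm_pow] using h3

/-- Evaluation at the centre of the ball is bounded in the `L²` norm. -/
lemma enorm_sq_zero_mul_volume_le {f : CSpace m → ℂ} (hf : DifferentiableOn ℂ f (unitBall m)) :
    ‖f 0‖ₑ ^ 2 * volume (unitBall m) ≤ ∫⁻ x in unitBall m, ‖f x‖ₑ ^ 2 := by
  have hB : IsOpen (unitBall m) := Metric.isOpen_ball
  set F : CSpace m → ENNReal := (unitBall m).indicator fun x => ‖f x‖ₑ ^ 2 with hF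
  have hFm : Measurable F := measurable_indicator_enorm_sq hB hf.continuousOn
  have hFint : ∫⁻ x, F x = ∫⁻ x in unitBall m, ‖f x‖ₑ ^ 2 := lintegral_indicator hB.measurableSet _
  have hnorm : ∀ θ : ℝ, ‖circleMap 0 1 θ‖ = 1 := fun θ => by simp
  have hmem : ∀ (θ : ℝ) (x : CSpace m), circleMap 0 1 θ • x ∈ unitBall m ↔ x ∈ unitBall m :=
    fun θ x => by simp [unitBall, norm_smul]
  set c : ENNReal := ENNReal.ofReal (2 * Real.pi) with hc
  have hc0 : c ≠ 0 := by simp [hc, Real.pi_pos]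
  have hct : c ≠ ⊤ := ENNReal.ofReal_ne_top
  have hvol : volume (Ioc 0 (2 * Real.pi)) = c := by simp [hc]
  -- The mean value property is integrated over the ball; by Tonelli and the invariance of the
  -- volume under rotations, the right-hand side becomes a multiple of the integral over the ball.
  have h1 : ∫⁻ x, (unitBall m).indicator (fun _ => c * ‖f 0‖ₑ ^ 2) x ≤
      ∫⁻ x, ∫⁻ θ in Ioc 0 (2 * Real.pi), F (circleMap 0 1 θ • x) := by
    refine lintegral_mono fun x => ?_
    by_cases hx : x ∈ unitBall m
    · rw [indicator_of_mem hx]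
      refine (enorm_sq_zero_le_lintegral hf hx).trans (le_of_eq ?_)
      refine lintegral_congr fun θ => ?_
      rw [hF, indicator_of_mem ((hmem θ x).mpr hx)]
    · rw [indicator_of_notMem hx]
      exact zero_le
  have h2 : ∫⁻ x, ∫⁻ θ in Ioc 0 (2 * Real.pi), F (circleMap 0 1 θ • x) =
      ∫⁻ θ in Ioc 0 (2 * Real.pi), ∫⁻ x, F (circleMap 0 1 θ • x) := by
    refine lintegral_lintegral_swap (Measurable.aemeasurable ?_)
    refine hFm.comp (Continuous.measurable ?_)
    exact ((continuous_circleMap 0 1).comp continuous_snd).smul continuous_fst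
  rw [h2, lintegral_indicator hB.measurableSet, setLIntegral_const] at h1
  simp only [lintegral_comp_smul_of_norm_eq_one (hnorm _)] at h1
  rw [setLIntegral_const, hvol, hFint, mul_assoc, mul_comm _ c] at h1
  exact (ENNReal.mul_le_mul_iff_right hc0 hct).mp h1

/-- The Bergman kernel of the ball does not vanish at the centre. Its defining supremum is bounded,
and hence not a junk value, by the mean value property; constants give the lower bound. -/
theorem bergmanKernel_unitBall_zero_pos : 0 < bergmanKernel (unitBall m) 0 := by
  have hB : IsOpen (unitBall m) := Metric.isOpen_ball
  have hv0 : volume (unitBall m) ≠ 0 := (hB.measure_pos volume ⟨0, by simp [unitBall]⟩).ne'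
  have hvt : volume (unitBall m) ≠ ⊤ := measure_ball_lt_top.ne
  have hbdd : BddAbove (bergmanValues (unitBall m) 0) := by
    refine ⟨((volume (unitBall m))⁻¹).toReal, ?_⟩
    rintro _ ⟨f, hf, hint, rfl⟩
    have h1 := (enorm_sq_zero_mul_volume_le hf).trans hint
    have h2 : ‖f 0‖ₑ ^ 2 ≤ (volume (unitBall m))⁻¹ := by
      rw [← one_div]
      exact (ENNReal.le_div_iff_mul_le (.inl hv0) (.inl hvt)).mpr h1
    have h3 := ENNReal.toReal_mono (ENNReal.inv_ne_top.mpr hv0) h2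
    simpa using h3
  rw [bergmanKernel_eq]
  set b : ℝ := (volume (unitBall m)).toReal with hb
  have hb0 : 0 < b := ENNReal.toReal_pos hv0 hvt
  refine lt_of_lt_of_le (inv_pos.mpr hb0) (le_csSup hbdd ?_)
  refine ⟨fun _ => ((Real.sqrt b)⁻¹ : ℝ), differentiableOn_const _, ?_, ?_⟩
  · rw [setLIntegral_const, ← ofReal_norm, Complex.norm_real, Real.norm_of_nonneg (by positivity),
      ← ENNReal.ofReal_pow (by positivity), inv_pow, Real.sq_sqrt hb0.le,
      ← ENNReal.ofReal_toReal hvt, ← hb, ← ENNReal.ofReal_mul (by positivity),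
      inv_mul_cancel₀ hb0.ne', ENNReal.ofReal_one]
  · rw [Complex.norm_real, Real.norm_of_nonneg (by positivity), inv_pow, Real.sq_sqrt hb0.le]

end BergmanKernel

/-! ### The Siegel domain -/

section Siegel

variable {n : ℕ}

/-- The splitting `ℂⁿ⁺¹ = ℂⁿ × ℂ` into the first `n` coordinates and the last one. -/
def siegelEquiv (n : ℕ) : CSpace (n + 1) ≃L[ℂ] CSpace n × ℂ :=
  LinearEquiv.toContinuousLinearEquiv
    { toFun := fun p => (WithLp.toLp 2 fun i => p i.castSucc, p (Fin.last n))
      invFun := fun q => WithLp.toLp 2 (Fin.snoc (α := fun _ => ℂ) q.1 q.2)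
      map_add' := fun _ _ => rfl
      map_smul' := fun _ _ => rfl
      left_inv := fun p => by
        ext i
        refine Fin.lastCases ?_ (fun i => ?_) i <;> simp
      right_inv := fun q => by
        ext <;> simp }

/-- The component in `ℂⁿ` of a point of `ℂⁿ⁺¹`. -/
def zPart (n : ℕ) : CSpace (n + 1) →L[ℂ] CSpace n :=
  (ContinuousLinearMap.fst ℂ (CSpace n) ℂ).comp (siegelEquiv n : CSpace (n + 1) →L[ℂ] CSpace n × ℂ)

/-- The last coordinate of a point of `ℂⁿ⁺¹`. -/
def ζPart (n : ℕ) : CSpace (n + 1) →L[ℂ] ℂ :=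
  (ContinuousLinearMap.snd ℂ (CSpace n) ℂ).comp (siegelEquiv n : CSpace (n + 1) →L[ℂ] CSpace n × ℂ)

/-- The point of `ℂⁿ⁺¹` with given components. -/
def siegelMk (z : CSpace n) (ζ : ℂ) : CSpace (n + 1) := (siegelEquiv n).symm (z, ζ)

@[simp] lemma zPart_mk (z : CSpace n) (ζ : ℂ) : zPart n (siegelMk z ζ) = z := by
  simp [zPart, siegelMk]

@[simp] lemma ζPart_mk (z : CSpace n) (ζ : ℂ) : ζPart n (siegelMk z ζ) = ζ := by
  simp [ζPart, siegelMk]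

lemma siegelMk_parts (p : CSpace (n + 1)) : siegelMk (zPart n p) (ζPart n p) = p := by
  simp [zPart, ζPart, siegelMk]

lemma siegel_ext {p q : CSpace (n + 1)} (h1 : zPart n p = zPart n q)
    (h2 : ζPart n p = ζPart n q) : p = q := by
  rw [← siegelMk_parts p, ← siegelMk_parts q, h1, h2]

lemma ζPart_apply (p : CSpace (n + 1)) : ζPart n p = p (Fin.last n) := rfl

lemma zPart_apply (p : CSpace (n + 1)) (i : Fin n) : zPart n p i = p i.castSucc := rfl

lemma norm_sq_eq_parts (p : CSpace (n + 1)) : ‖p‖ ^ 2 = ‖zPart n p‖ ^ 2 + ‖ζPart n p‖ ^ 2 := by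
  rw [EuclideanSpace.norm_sq_eq, EuclideanSpace.norm_sq_eq, Fin.sum_univ_castSucc]
  rfl

lemma differentiableAt_siegelMk {E : Type*} [NormedAddCommGroup E] [NormedSpace ℂ E]
    {f : E → CSpace n} {g : E → ℂ} {v : E} (hf : DifferentiableAt ℂ f v)
    (hg : DifferentiableAt ℂ g v) : DifferentiableAt ℂ (fun w => siegelMk (f w) (g w)) v :=
  (siegelEquiv n).symm.differentiableAt.comp v (hf.prodMk hg)

lemma continuous_siegelMk : Continuous fun q : CSpace n × ℂ => siegelMk q.1 q.2 :=
  (siegelEquiv n).symm.continuous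

/-- The defining function `-Re ζ - |z|²` of the Siegel domain. -/
def siegelHeight (p : CSpace (n + 1)) : ℝ := -(ζPart n p).re - ‖zPart n p‖ ^ 2

variable (n) in
/-- The Siegel domain `{(z, ζ) : Re ζ + |z|² < 0}`, an unbounded model of the ball. -/
def siegelDomain : Set (CSpace (n + 1)) := {p | 0 < siegelHeight p}

lemma contDiff_siegelHeight : ContDiff ℝ ∞ (siegelHeight (n := n)) := by
  unfold siegelHeight
  have h1 : ContDiff ℝ ∞ fun p : CSpace (n + 1) => (ζPart n p).re :=
    Complex.reCLM.contDiff.comp ((ζPart n).restrictScalars ℝ).contDiff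
  exact h1.neg.sub (((zPart n).restrictScalars ℝ).contDiff.norm_sq ℝ)

lemma continuous_siegelHeight : Continuous (siegelHeight (n := n)) :=
  contDiff_siegelHeight.continuous

lemma isOpen_siegelDomain : IsOpen (siegelDomain n) :=
  isOpen_lt continuous_const continuous_siegelHeight

/-- The superlevel sets of the height are convex. -/
lemma convex_siegelHeight_gt (c : ℝ) : Convex ℝ {p : CSpace (n + 1) | c < siegelHeight p} := by
  have h : ConvexOn ℝ univ fun p : CSpace (n + 1) => (ζPart n p).re + ‖zPart n p‖ ^ 2 := by
    refine ConvexOn.add ?_ ?_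
    · exact ((Complex.reLm.comp ((ζPart n).restrictScalars ℝ : CSpace (n + 1) →ₗ[ℝ] ℂ))).convexOn
        convex_univ
    · refine ConvexOn.pow ?_ (fun p _ => norm_nonneg _) 2
      exact (convexOn_norm convex_univ).comp_linearMap
        ((zPart n).restrictScalars ℝ : CSpace (n + 1) →ₗ[ℝ] CSpace n)
  have := h.convex_lt (-c)
  have hset : {p : CSpace (n + 1) | c < siegelHeight p} =
      {p | p ∈ univ ∧ (ζPart n p).re + ‖zPart n p‖ ^ 2 < -c} := by
    refine Set.ext fun p => ?_
    simp only [siegelHeight, mem_ofPred_eq, mem_univ, true_and]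
    constructor <;> intro h <;> linarith
  rwa [hset]

variable (n) in
/-- The base point `(0, -1)` of the Siegel domain. -/
def siegelBase : CSpace (n + 1) := siegelMk 0 (-1)

lemma siegelHeight_base : siegelHeight (siegelBase n) = 1 := by
  simp [siegelHeight, siegelBase]

/-- The affine automorphism
`(z, ζ) ↦ (t z + λ, t² ζ - 2 t ⟨λ, z⟩ - |λ|² + √-1 c)` of `ℂⁿ⁺¹`, composed of a dilation and
a Heisenberg translation. -/
def heis (t : ℝ) (l : CSpace n) (c : ℝ) (p : CSpace (n + 1)) : CSpace (n + 1) :=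
  siegelMk ((t : ℂ) • zPart n p + l)
    ((t : ℂ) ^ 2 * ζPart n p - 2 * t * inner ℂ l (zPart n p) - ‖l‖ ^ 2 + Complex.I * c)

@[simp] lemma zPart_heis (t : ℝ) (l : CSpace n) (c : ℝ) (p : CSpace (n + 1)) :
    zPart n (heis t l c p) = (t : ℂ) • zPart n p + l := by simp [heis]

@[simp] lemma ζPart_heis (t : ℝ) (l : CSpace n) (c : ℝ) (p : CSpace (n + 1)) :
    ζPart n (heis t l c p) =
      (t : ℂ) ^ 2 * ζPart n p - 2 * t * inner ℂ l (zPart n p) - ‖l‖ ^ 2 + Complex.I * c := by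
  simp [heis]

/-- The height is multiplied by `t²`. -/
lemma siegelHeight_heis (t : ℝ) (l : CSpace n) (c : ℝ) (p : CSpace (n + 1)) :
    siegelHeight (heis t l c p) = t ^ 2 * siegelHeight p := by
  have h1 : ‖(t : ℂ) • zPart n p + l‖ ^ 2 =
      t ^ 2 * ‖zPart n p‖ ^ 2 + 2 * (t * (inner ℂ l (zPart n p)).re) + ‖l‖ ^ 2 := by
    rw [norm_add_sq (𝕜 := ℂ), norm_smul, inner_smul_left,
      ← inner_conj_symm]
    simp [mul_pow, -inner_conj_symm]
  have h2 : ((t : ℂ) ^ 2 * ζPart n p - 2 * t * inner ℂ l (zPart n p) - ‖l‖ ^ 2 +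
      Complex.I * c).re = t ^ 2 * (ζPart n p).re - 2 * (t * (inner ℂ l (zPart n p)).re) -
        ‖l‖ ^ 2 := by
    have e1 : ((t : ℂ) ^ 2 * ζPart n p).re = t ^ 2 * (ζPart n p).re := by
      rw [← Complex.ofReal_pow, Complex.re_ofReal_mul]
    have e2 : (2 * (t : ℂ) * inner ℂ l (zPart n p)).re = 2 * (t * (inner ℂ l (zPart n p)).re) := by
      rw [mul_assoc, Complex.mul_re, Complex.re_ofReal_mul]
      simp
    have e3 : (((‖l‖ : ℝ) : ℂ) ^ 2).re = ‖l‖ ^ 2 := by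
      rw [← Complex.ofReal_pow, Complex.ofReal_re]
    rw [Complex.add_re, Complex.sub_re, Complex.sub_re, e1, e2, e3]
    simp
  rw [siegelHeight, zPart_heis, ζPart_heis, h1, h2, siegelHeight]
  ring

lemma heis_heis_inv {t : ℝ} (ht : t ≠ 0) (l : CSpace n) (c : ℝ) (p : CSpace (n + 1)) :
    heis t⁻¹ (-((t⁻¹ : ℝ) : ℂ) • l) (-c / t ^ 2) (heis t l c p) = p := by
  have ht' : (t : ℂ) ≠ 0 := by exact_mod_cast ht
  apply siegel_ext
  · simp only [zPart_heis, smul_add, smul_smul]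
    rw [← Complex.ofReal_mul, inv_mul_cancel₀ ht]
    simp
  · have h : (((‖-((t⁻¹ : ℝ) : ℂ) • l‖ : ℝ) : ℂ)) ^ 2 = (t : ℂ)⁻¹ ^ 2 * (‖l‖ : ℂ) ^ 2 := by
      rw [norm_smul, norm_neg, Complex.norm_real, Real.norm_eq_abs, Complex.ofReal_mul, mul_pow,
        ← Complex.ofReal_pow, sq_abs]
      push_cast
      rfl
    have h2 : inner ℂ l l = ((‖l‖ : ℝ) : ℂ) ^ 2 := inner_self_eq_norm_sq_to_K l
    rw [ζPart_heis, h]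
    simp only [ζPart_heis, zPart_heis, inner_smul_left, inner_add_right, inner_smul_right, h2,
      map_neg, Complex.conj_ofReal]
    push_cast
    field_simp
    ring

lemma heis_inv_heis {t : ℝ} (ht : t ≠ 0) (l : CSpace n) (c : ℝ) (p : CSpace (n + 1)) :
    heis t l c (heis t⁻¹ (-((t⁻¹ : ℝ) : ℂ) • l) (-c / t ^ 2) p) = p := by
  have h := heis_heis_inv (inv_ne_zero ht) (-((t⁻¹ : ℝ) : ℂ) • l) (-c / t ^ 2) p
  have ht' : (t : ℂ) ≠ 0 := by exact_mod_cast ht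
  rw [inv_inv] at h
  convert h using 2
  · rw [smul_smul]
    simp [ht']
  · field_simp

/-- The maps `heis` act transitively on the Siegel domain. -/
lemma heis_base {p : CSpace (n + 1)} (hp : p ∈ siegelDomain n) :
    heis (Real.sqrt (siegelHeight p)) (zPart n p) (ζPart n p).im (siegelBase n) = p := by
  have hp' : 0 < siegelHeight p := hp
  apply siegel_ext
  · simp [siegelBase]
  · rw [ζPart_heis, ← Complex.ofReal_pow, Real.sq_sqrt hp'.le]
    apply Complex.ext
    · rw [← Complex.ofReal_pow]
      simp [siegelBase, siegelHeight]
    · rw [← Complex.ofReal_pow]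
      simp [siegelBase, -Complex.ofReal_pow]

/-- The linear part of `heis`. -/
def heisLin (t : ℝ) (l : CSpace n) : CSpace (n + 1) →L[ℂ] CSpace (n + 1) :=
  ((siegelEquiv n).symm : CSpace n × ℂ →L[ℂ] CSpace (n + 1)).comp
    (((t : ℂ) • zPart n).prod ((t : ℂ) ^ 2 • ζPart n - (2 * t : ℂ) • (innerSL ℂ l).comp (zPart n)))

lemma hasFDerivAt_heis (t : ℝ) (l : CSpace n) (c : ℝ) (p : CSpace (n + 1)) :
    HasFDerivAt (heis t l c) (heisLin t l) p := by
  have h : heis t l c = fun p => heisLin t l p + siegelMk l (-‖l‖ ^ 2 + Complex.I * c) := by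
    funext p
    apply siegel_ext
    · rw [zPart_heis, map_add, zPart_mk]
      simp [heisLin, zPart]
    · rw [ζPart_heis, map_add, ζPart_mk]
      simp [heisLin, ζPart, zPart]
      ring
  rw [h]
  exact (heisLin t l).hasFDerivAt.add_const _

lemma differentiable_heis (t : ℝ) (l : CSpace n) (c : ℝ) : Differentiable ℂ (heis t l c) :=
  fun p => (hasFDerivAt_heis t l c p).differentiableAt

lemma jacobian_heis (t : ℝ) (l : CSpace n) (c : ℝ) (p : CSpace (n + 1)) :
    jacobian (heis t l c) p = (t : ℂ) ^ (n + 2) := by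
  rw [jacobian, (hasFDerivAt_heis t l c p).fderiv, ContinuousLinearMap.det,
    ← LinearMap.det_toMatrix (EuclideanSpace.basisFun (Fin (n + 1)) ℂ).toBasis]
  have hent : ∀ i j, LinearMap.toMatrix (EuclideanSpace.basisFun (Fin (n + 1)) ℂ).toBasis
      (EuclideanSpace.basisFun (Fin (n + 1)) ℂ).toBasis (heisLin t l : _ →ₗ[ℂ] _) i j =
      heisLin t l (stdVec j) i := fun i j => by
    simp [LinearMap.toMatrix_apply, stdVec]
  have hz : ∀ (x : CSpace (n + 1)) (i : Fin n), heisLin t l x i.castSucc = t * x i.castSucc :=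
    fun x i => by
      have h : zPart n (heisLin t l x) = (t : ℂ) • zPart n x := by simp [heisLin, zPart]
      rw [← zPart_apply, h]
      rfl
  have hl : heisLin t l (stdVec (Fin.last n)) (Fin.last n) = (t : ℂ) ^ 2 := by
    have h0 : zPart n (stdVec (Fin.last n)) = 0 := by
      ext i
      rw [zPart_apply]
      simp [stdVec]
    have h1 : ζPart n (stdVec (Fin.last n)) = 1 := by
      rw [ζPart_apply]
      simp [stdVec]
    have h2 : ζPart n (heisLin t l (stdVec (Fin.last n))) =
        (t : ℂ) ^ 2 * ζPart n (stdVec (Fin.last n)) -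
          2 * t * inner ℂ l (zPart n (stdVec (Fin.last n))) := by
      simp [heisLin, ζPart]
    rw [← ζPart_apply, h2, h0, h1]
    simp
  rw [Matrix.det_of_isLowerTriangular, Fin.prod_univ_castSucc]
  · simp only [hent, hz, hl]
    simp [stdVec]
    ring
  · intro i j hij
    replace hij : i < j := hij
    rw [hent]
    obtain ⟨i', rfl⟩ := Fin.exists_castSucc_eq.mpr (Fin.ne_last_of_lt hij)
    rw [hz]
    simp [stdVec, hij.ne]

lemma isBiholomorphicOn_heis {t : ℝ} (ht : t ≠ 0) (l : CSpace n) (c : ℝ) :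
    IsBiholomorphicOn (heis t l c) (heis t⁻¹ (-((t⁻¹ : ℝ) : ℂ) • l) (-c / t ^ 2))
      (siegelDomain n) (siegelDomain n) where
  isOpen_source := isOpen_siegelDomain
  isOpen_target := isOpen_siegelDomain
  differentiableOn := (differentiable_heis _ _ _).differentiableOn
  differentiableOn_symm := (differentiable_heis _ _ _).differentiableOn
  mapsTo := fun p hp => by
    have hp' : 0 < siegelHeight p := hp
    rw [siegelDomain, mem_ofPred_eq, siegelHeight_heis]
    positivity
  mapsTo_symm := fun p hp => by
    have hp' : 0 < siegelHeight p := hp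
    rw [siegelDomain, mem_ofPred_eq, siegelHeight_heis]
    positivity
  left_inv := fun p _ => heis_heis_inv ht l c p
  right_inv := fun p _ => heis_inv_heis ht l c p

/-- By homogeneity, the Bergman kernel of the Siegel domain is a power of the height. -/
lemma bergmanKernel_siegelDomain {p : CSpace (n + 1)} (hp : p ∈ siegelDomain n) :
    bergmanKernel (siegelDomain n) (siegelBase n) =
      siegelHeight p ^ (n + 2) * bergmanKernel (siegelDomain n) p := by
  have hp' : 0 < siegelHeight p := hp
  have h := (isBiholomorphicOn_heis (Real.sqrt_pos.mpr hp').ne' (zPart n p)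
    (ζPart n p).im).bergmanKernel_eq (z := siegelBase n)
    (by simp [siegelDomain, siegelHeight_base])
  rw [heis_base hp, jacobian_heis, norm_pow, Complex.norm_real,
    Real.norm_of_nonneg (Real.sqrt_nonneg _), ← pow_mul, mul_comm (n + 2), pow_mul,
    Real.sq_sqrt hp'.le] at h
  exact h

/-! ### The Cayley transform -/

/-- The Cayley transform `(a, b) ↦ (a / (1 + b), (b - 1) / (1 + b))` from the unit ball to the
Siegel domain. -/
def cayley (y : CSpace (n + 1)) : CSpace (n + 1) :=
  siegelMk ((1 + ζPart n y)⁻¹ • zPart n y) ((ζPart n y - 1) * (1 + ζPart n y)⁻¹)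

/-- The inverse `(z, ζ) ↦ (2 z / (1 - ζ), (1 + ζ) / (1 - ζ))` of the Cayley transform. -/
def cayleyInv (p : CSpace (n + 1)) : CSpace (n + 1) :=
  siegelMk ((2 * (1 - ζPart n p)⁻¹) • zPart n p) ((1 + ζPart n p) * (1 - ζPart n p)⁻¹)

lemma one_add_ζPart_ne_zero {y : CSpace (n + 1)} (hy : y ∈ unitBall (n + 1)) :
    1 + ζPart n y ≠ 0 := by
  intro h
  have h1 : ‖ζPart n y‖ = 1 := by
    rw [eq_neg_of_add_eq_zero_right h]
    simp
  have h2 : ‖y‖ < 1 := by simpa [unitBall] using hy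
  have h3 := norm_sq_eq_parts y
  rw [h1] at h3
  nlinarith [norm_nonneg y, sq_nonneg ‖zPart n y‖]

lemma one_sub_ζPart_ne_zero {p : CSpace (n + 1)} (hp : p ∈ siegelDomain n) :
    1 - ζPart n p ≠ 0 := by
  intro h
  have hp' : 0 < -(ζPart n p).re - ‖zPart n p‖ ^ 2 := hp
  rw [← sub_eq_zero.mp h] at hp'
  simp only [Complex.one_re] at hp'
  nlinarith [sq_nonneg ‖zPart n p‖]

lemma siegelHeight_cayley {y : CSpace (n + 1)} (hy : y ∈ unitBall (n + 1)) :
    siegelHeight (cayley y) = (1 - ‖y‖ ^ 2) / ‖1 + ζPart n y‖ ^ 2 := by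
  have h0 := one_add_ζPart_ne_zero hy
  have hn : ‖1 + ζPart n y‖ ^ 2 ≠ 0 := by simpa using h0
  rw [norm_sq_eq_parts, siegelHeight, cayley, zPart_mk, ζPart_mk, norm_smul, norm_inv, mul_pow,
    ← div_eq_mul_inv, Complex.div_re, Complex.normSq_eq_norm_sq]
  have h1 : ‖1 + ζPart n y‖ ^ 2 = (1 + (ζPart n y).re) ^ 2 + (ζPart n y).im ^ 2 := by
    rw [← Complex.normSq_eq_norm_sq, Complex.normSq_apply]
    simp
    ring
  have h2 : ‖ζPart n y‖ ^ 2 = (ζPart n y).re ^ 2 + (ζPart n y).im ^ 2 := by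
    rw [← Complex.normSq_eq_norm_sq, Complex.normSq_apply]
    ring
  rw [h2]
  field_simp
  simp
  ring

lemma isBiholomorphicOn_cayley :
    IsBiholomorphicOn (cayley (n := n)) cayleyInv (unitBall (n + 1)) (siegelDomain n) := by
  have hleft : ∀ y ∈ unitBall (n + 1), cayleyInv (cayley (n := n) y) = y := fun y hy => by
    have h0 := one_add_ζPart_ne_zero hy
    have h1 : 1 - (ζPart n y - 1) * (1 + ζPart n y)⁻¹ = 2 * (1 + ζPart n y)⁻¹ := by
      field_simp
      ring
    apply siegel_ext
    · rw [cayleyInv, cayley, ζPart_mk, zPart_mk, zPart_mk, h1, smul_smul]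
      have : 2 * (2 * (1 + ζPart n y)⁻¹)⁻¹ * (1 + ζPart n y)⁻¹ = 1 := by field_simp
      rw [this, one_smul]
    · rw [cayleyInv, cayley, ζPart_mk, ζPart_mk, h1]
      field_simp
      ring
  have hright : ∀ p ∈ siegelDomain n, cayley (cayleyInv (n := n) p) = p := fun p hp => by
    have h0 := one_sub_ζPart_ne_zero hp
    have h1 : 1 + (1 + ζPart n p) * (1 - ζPart n p)⁻¹ = 2 * (1 - ζPart n p)⁻¹ := by
      field_simp
      ring
    apply siegel_ext
    · rw [cayleyInv, cayley, ζPart_mk, zPart_mk, zPart_mk, h1, smul_smul]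
      have : (2 * (1 - ζPart n p)⁻¹)⁻¹ * (2 * (1 - ζPart n p)⁻¹) = 1 := by field_simp
      rw [this, one_smul]
    · rw [cayleyInv, cayley, ζPart_mk, ζPart_mk, h1]
      field_simp
      ring
  refine ⟨Metric.isOpen_ball, isOpen_siegelDomain, fun y hy => ?_, fun p hp => ?_, fun y hy => ?_,
    fun p hp => ?_, hleft, hright⟩
  · have h0 := one_add_ζPart_ne_zero hy
    have hi : DifferentiableAt ℂ (fun y => (1 + ζPart n y)⁻¹) y :=
      ((ζPart n).differentiableAt.const_add 1).inv h0
    exact (differentiableAt_siegelMk (hi.smul (zPart n).differentiableAt)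
      (((ζPart n).differentiableAt.sub_const 1).mul hi)).differentiableWithinAt
  · have h0 := one_sub_ζPart_ne_zero hp
    have hi : DifferentiableAt ℂ (fun y => (1 - ζPart n y)⁻¹) p :=
      ((ζPart n).differentiableAt.const_sub 1).inv h0
    exact (differentiableAt_siegelMk ((hi.const_mul 2).smul (zPart n).differentiableAt)
      (((ζPart n).differentiableAt.const_add 1).mul hi)).differentiableWithinAt
  · have h0 := one_add_ζPart_ne_zero hy
    have hy' : ‖y‖ < 1 := by simpa [unitBall] using hy
    rw [siegelDomain, mem_ofPred_eq, siegelHeight_cayley hy]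
    have : 0 < 1 - ‖y‖ ^ 2 := by nlinarith [norm_nonneg y]
    positivity
  · have h0 := one_sub_ζPart_ne_zero hp
    have hp' : 0 < -(ζPart n p).re - ‖zPart n p‖ ^ 2 := hp
    rw [unitBall, mem_ball_zero_iff]
    have hn : 0 < ‖1 - ζPart n p‖ ^ 2 := by positivity
    have h : ‖cayleyInv p‖ ^ 2 < 1 := by
      rw [norm_sq_eq_parts, cayleyInv, zPart_mk, ζPart_mk, norm_smul, norm_mul, norm_mul, norm_inv]
      have h1 : ‖1 - ζPart n p‖ ^ 2 = (1 - (ζPart n p).re) ^ 2 + (ζPart n p).im ^ 2 := by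
        rw [← Complex.normSq_eq_norm_sq, Complex.normSq_apply]
        simp
        ring
      have h2 : ‖1 + ζPart n p‖ ^ 2 = (1 + (ζPart n p).re) ^ 2 + (ζPart n p).im ^ 2 := by
        rw [← Complex.normSq_eq_norm_sq, Complex.normSq_apply]
        simp
        ring
      have h3 : (‖(2 : ℂ)‖ * ‖1 - ζPart n p‖⁻¹ * ‖zPart n p‖) ^ 2 +
          (‖1 + ζPart n p‖ * ‖1 - ζPart n p‖⁻¹) ^ 2 =
          (4 * ‖zPart n p‖ ^ 2 + ‖1 + ζPart n p‖ ^ 2) / ‖1 - ζPart n p‖ ^ 2 := by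
        rw [Complex.norm_ofNat]
        field_simp
        ring
      rw [h3, div_lt_one hn, h1, h2]
      nlinarith
    nlinarith [norm_nonneg (cayleyInv p)]

end Siegel

/-! ### Sesquilinear forms and uniform bounds on compact sets -/

section SesqForm

variable {m l : ℕ}

lemma sesqForm_stdVec (G : Matrix (Fin m) (Fin m) ℂ) (i j : Fin m) :
    sesqForm G (stdVec i) (stdVec j) = G i j := by
  rw [sesqForm, Finset.sum_eq_single i, Finset.sum_eq_single j]
  · simp [stdVec]
  · intro b _ hb
    simp [stdVec, hb]
  · simp
  · intro b _ hb
    simp [stdVec, hb]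
  · simp

lemma CSpace.eq_sum_smul_stdVec (x : CSpace m) : x = ∑ a, x a • stdVec a := by
  ext b
  rw [WithLp.ofLp_sum, Finset.sum_apply, Finset.sum_eq_single b]
  · simp [stdVec]
  · intro c _ hc
    simp [stdVec, hc.symm]
  · simp

variable (m) in
/-- `sesqForm G` as a bundled sesquilinear map. -/
def sesqMap (G : Matrix (Fin m) (Fin m) ℂ) : CSpace m →ₗ[ℂ] CSpace m →ₗ⋆[ℂ] ℂ :=
  LinearMap.mk₂'ₛₗ (RingHom.id ℂ) (starRingEnd ℂ) (sesqForm G)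
    (fun x x' y => by
      simp only [sesqForm, ← Finset.sum_add_distrib, PiLp.add_apply]
      exact Finset.sum_congr rfl fun _ _ => Finset.sum_congr rfl fun _ _ => by ring)
    (fun c x y => by
      simp only [sesqForm, PiLp.smul_apply, smul_eq_mul, RingHom.id_apply, Finset.mul_sum]
      exact Finset.sum_congr rfl fun _ _ => Finset.sum_congr rfl fun _ _ => by ring)
    (fun x y y' => by
      simp only [sesqForm, ← Finset.sum_add_distrib, PiLp.add_apply, map_add]
      exact Finset.sum_congr rfl fun _ _ => Finset.sum_congr rfl fun _ _ => by ring)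
    (fun c x y => by
      simp only [sesqForm, PiLp.smul_apply, smul_eq_mul, map_mul, Finset.mul_sum]
      exact Finset.sum_congr rfl fun _ _ => Finset.sum_congr rfl fun _ _ => by ring)

@[simp] lemma sesqMap_apply (G : Matrix (Fin m) (Fin m) ℂ) (x y : CSpace m) :
    sesqMap m G x y = sesqForm G x y := rfl

/-- A pullback relation between matrices extends from the standard basis to all vectors. -/
lemma sesqForm_eq_of_pullback {G : Matrix (Fin m) (Fin m) ℂ} {G' : Matrix (Fin l) (Fin l) ℂ}
    {L : CSpace m →L[ℂ] CSpace l}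
    (h : ∀ i j, G i j = sesqForm G' (L (stdVec i)) (L (stdVec j))) (x y : CSpace m) :
    sesqForm G x y = sesqForm G' (L x) (L y) := by
  have key : sesqForm G' (L x) (L y) = ∑ b, starRingEnd ℂ (y b) * ∑ a, x a * G a b := by
    conv_lhs => rw [CSpace.eq_sum_smul_stdVec x, CSpace.eq_sum_smul_stdVec y]
    simp only [map_sum, map_smul, ← sesqMap_apply G', LinearMap.map_smulₛₗ, LinearMap.sum_apply,
      LinearMap.smul_apply, smul_eq_mul]
    simp only [sesqMap_apply, ← h]
  rw [key, sesqForm, Finset.sum_comm]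
  refine Finset.sum_congr rfl fun _ _ => ?_
  rw [Finset.mul_sum]
  exact Finset.sum_congr rfl fun _ _ => by ring

lemma sesqForm_one (x y : CSpace m) : sesqForm 1 x y = inner ℂ y x := by
  rw [sesqForm, PiLp.inner_apply]
  refine Finset.sum_congr rfl fun a _ => ?_
  rw [Finset.sum_eq_single a]
  · simp
  · intro b _ hb
    simp [hb.symm]
  · simp

lemma sesqForm_sub (G G' : Matrix (Fin m) (Fin m) ℂ) (x y : CSpace m) :
    sesqForm (G - G') x y = sesqForm G x y - sesqForm G' x y := by
  simp only [sesqForm, Matrix.sub_apply, mul_sub, Finset.sum_sub_distrib]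

lemma sesqForm_smul (c : ℂ) (G : Matrix (Fin m) (Fin m) ℂ) (x y : CSpace m) :
    sesqForm (c • G) x y = c * sesqForm G x y := by
  simp only [sesqForm, Matrix.smul_apply, smul_eq_mul, Finset.mul_sum]
  exact Finset.sum_congr rfl fun _ _ => Finset.sum_congr rfl fun _ _ => by ring

lemma star_dotProduct_mulVec_eq_sesqForm (G : Matrix (Fin m) (Fin m) ℂ) (x : Fin m → ℂ) :
    star x ⬝ᵥ G.mulVec x = sesqForm G (WithLp.toLp 2 (star x)) (WithLp.toLp 2 (star x)) := by
  simp only [dotProduct, Matrix.mulVec, sesqForm, Finset.mul_sum, Pi.star_apply, RCLike.star_def,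
    Complex.conj_conj]
  exact Finset.sum_congr rfl fun _ _ => Finset.sum_congr rfl fun _ _ => by ring

lemma posDef_of_sesqForm {G : Matrix (Fin m) (Fin m) ℂ} (hG : G.IsHermitian)
    (h : ∀ x : CSpace m, x ≠ 0 → 0 < sesqForm G x x) : G.PosDef := by
  refine Matrix.PosDef.of_dotProduct_mulVec_pos hG fun x hx => ?_
  rw [star_dotProduct_mulVec_eq_sesqForm]
  refine h _ fun h0 => hx ?_
  have : star x = 0 := congrArg WithLp.ofLp h0
  exact star_eq_zero.mp this

lemma posSemidef_of_sesqForm {G : Matrix (Fin m) (Fin m) ℂ} (hG : G.IsHermitian)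
    (h : ∀ x : CSpace m, 0 ≤ sesqForm G x x) : G.PosSemidef := by
  refine Matrix.PosSemidef.of_dotProduct_mulVec_nonneg hG fun x => ?_
  rw [star_dotProduct_mulVec_eq_sesqForm]
  exact h _

lemma Matrix.PosDef.sesqForm_pos {G : Matrix (Fin m) (Fin m) ℂ} (hG : G.PosDef) {x : CSpace m}
    (hx : x ≠ 0) : 0 < sesqForm G x x := by
  have h := hG.dotProduct_mulVec_pos (x := star x.ofLp) (fun h0 => hx (by
    ext i
    have := congrFun (star_eq_zero.mp h0) i
    simpa using this))
  rw [star_dotProduct_mulVec_eq_sesqForm, star_star] at h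
  exact h

/-- A continuous field of positive definite matrices is uniformly equivalent to the identity on
a compact set. -/
lemma exists_uniform_equiv {G : CSpace m → Matrix (Fin m) (Fin m) ℂ} {K : Set (CSpace m)}
    (hK : IsCompact K) (hcont : ∀ i j, ContinuousOn (fun p => G p i j) K)
    (hpos : ∀ p ∈ K, (G p).PosDef) :
    ∃ c : ℝ, 0 < c ∧ ∀ p ∈ K,
      (G p - ((c⁻¹ : ℝ) : ℂ) • (1 : Matrix (Fin m) (Fin m) ℂ)).PosSemidef ∧
      ((c : ℂ) • (1 : Matrix (Fin m) (Fin m) ℂ) - G p).PosSemidef := by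
  -- The quadratic form is bounded on the compact set `K × S`, and homogeneous.
  set S : Set (CSpace m) := Metric.sphere 0 1
  have hS : IsCompact S := isCompact_sphere _ _
  set q : CSpace m × CSpace m → ℝ := fun v => (sesqForm (G v.1) v.2 v.2).re with hq
  have hqc : ContinuousOn q (K ×ˢ S) := by
    refine Complex.continuous_re.comp_continuousOn ?_
    refine continuousOn_finsetSum _ fun a _ => continuousOn_finsetSum _ fun b _ => ?_
    refine ContinuousOn.mul (by fun_prop) ?_
    exact (hcont a b).comp continuousOn_fst fun v hv => hv.1
  have hne : ∀ x ∈ S, x ≠ 0 := fun x hx h0 => by simp [S, h0] at hx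
  have hqpos : ∀ v ∈ K ×ˢ S, 0 < q v := fun v hv =>
    (Complex.pos_iff.mp ((hpos v.1 hv.1).sesqForm_pos (hne _ hv.2))).1
  obtain ⟨a, ha, hqa⟩ : ∃ a : ℝ, 0 < a ∧ ∀ v ∈ K ×ˢ S, a ≤ q v := by
    rcases (K ×ˢ S).eq_empty_or_nonempty with he | hn
    · exact ⟨1, one_pos, by simp [he]⟩
    · obtain ⟨v, hv, hmin⟩ := (hK.prod hS).exists_isMinOn hn hqc
      exact ⟨q v, hqpos v hv, fun w hw => hmin hw⟩
  obtain ⟨b, hqb⟩ := (hK.prod hS).exists_bound_of_continuousOn hqc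
  have him : ∀ p ∈ K, ∀ x, sesqForm (G p) x x = (sesqForm (G p) x x).re := fun p hp x => by
    rcases eq_or_ne x 0 with rfl | hx
    · simp [sesqForm]
    · have := (Complex.pos_iff.mp ((hpos p hp).sesqForm_pos hx)).2
      apply Complex.ext <;> simp [← this]
  have hscale : ∀ p, ∀ x : CSpace m, x ≠ 0 →
      sesqForm (G p) x x = ‖x‖ ^ 2 * sesqForm (G p) ((‖x‖⁻¹ : ℂ) • x) ((‖x‖⁻¹ : ℂ) • x) := by
    intro p x hx
    have hx' : (‖x‖ : ℂ) ≠ 0 := by simpa using hx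
    simp only [← sesqMap_apply, LinearMap.map_smulₛₗ, LinearMap.smul_apply, smul_eq_mul,
      RingHom.id_apply, map_inv₀, Complex.conj_ofReal]
    field_simp
  have hsph : ∀ x : CSpace m, x ≠ 0 → (‖x‖⁻¹ : ℂ) • x ∈ S := fun x hx => by
    have : ‖x‖ ≠ 0 := by simpa using hx
    simp [S, norm_smul, this]
  have hlow : ∀ p ∈ K, ∀ x, a * ‖x‖ ^ 2 ≤ (sesqForm (G p) x x).re := fun p hp x => by
    rcases eq_or_ne x 0 with rfl | hx
    · simp [sesqForm]
    · rw [hscale p x hx, ← Complex.ofReal_pow, Complex.re_ofReal_mul, mul_comm]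
      exact mul_le_mul_of_nonneg_left (hqa (p, _) ⟨hp, hsph x hx⟩) (by positivity)
  have hup : ∀ p ∈ K, ∀ x, (sesqForm (G p) x x).re ≤ b * ‖x‖ ^ 2 := fun p hp x => by
    rcases eq_or_ne x 0 with rfl | hx
    · simp [sesqForm]
    · rw [hscale p x hx, ← Complex.ofReal_pow, Complex.re_ofReal_mul, mul_comm b]
      exact mul_le_mul_of_nonneg_left ((le_abs_self _).trans (hqb (p, _) ⟨hp, hsph x hx⟩))
        (by positivity)
  set c : ℝ := max a⁻¹ (max b 1)
  have hc : 0 < c := lt_of_lt_of_le (inv_pos.mpr ha) (le_max_left _ _)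
  have hone : ∀ x : CSpace m, sesqForm 1 x x = ((‖x‖ ^ 2 : ℝ) : ℂ) := fun x => by
    rw [sesqForm_one, inner_self_eq_norm_sq_to_K]
    simp
  have hherm : ∀ d : ℝ, ((d : ℂ) • (1 : Matrix (Fin m) (Fin m) ℂ)).IsHermitian := fun d => by
    rw [Matrix.IsHermitian, Matrix.conjTranspose_smul, Matrix.conjTranspose_one]
    simp
  refine ⟨c, hc, fun p hp => ⟨?_, ?_⟩⟩
  · refine posSemidef_of_sesqForm ((hpos p hp).1.sub (hherm _)) fun x => ?_
    rw [sesqForm_sub, sesqForm_smul, hone, him p hp, ← Complex.ofReal_mul, ← Complex.ofReal_sub]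
    rw [Complex.zero_le_real, sub_nonneg]
    refine le_trans ?_ (hlow p hp x)
    refine mul_le_mul_of_nonneg_right ?_ (by positivity)
    exact inv_le_of_inv_le₀ ha (le_max_left _ _)
  · refine posSemidef_of_sesqForm ((hherm _).sub (hpos p hp).1) fun x => ?_
    rw [sesqForm_sub, sesqForm_smul, hone, him p hp, ← Complex.ofReal_mul, ← Complex.ofReal_sub]
    rw [Complex.zero_le_real, sub_nonneg]
    refine (hup p hp x).trans ?_
    refine mul_le_mul_of_nonneg_right ?_ (by positivity)
    exact (le_max_left _ _).trans (le_max_right _ _)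

lemma mixedDeriv_congr {f g : CSpace m → ℂ} {v : CSpace m} (h : f =ᶠ[𝓝 v] g)
    (p q : List (Fin m)) : mixedDeriv p q f =ᶠ[𝓝 v] mixedDeriv p q g := by
  have hq : q.foldr dAnti f =ᶠ[𝓝 v] q.foldr dAnti g := by
    induction q with
    | nil => exact h
    | cons j q ih => exact wirtinger_congr ih
  induction p with
  | nil => exact hq
  | cons i p ih =>
    simp only [mixedDeriv, List.foldr_cons, dHol_eq_wirtinger] at ih ⊢
    exact wirtinger_congr ih

lemma contDiffOn_mixedDeriv {f : CSpace m → ℂ} {s : Set (CSpace m)} (hs : IsOpen s)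
    (hf : ContDiffOn ℝ ∞ f s) (p q : List (Fin m)) : ContDiffOn ℝ ∞ (mixedDeriv p q f) s := by
  have hq : ContDiffOn ℝ ∞ (q.foldr dAnti f) s := by
    induction q with
    | nil => exact hf
    | cons j q ih => exact ContDiffOn.wirtinger hs ih
  induction p with
  | nil => exact hq
  | cons i p ih =>
    simp only [mixedDeriv, List.foldr_cons, dHol_eq_wirtinger] at ih ⊢
    exact ContDiffOn.wirtinger hs ih

/-- All derivatives of a smooth field of matrices are bounded on a compact set, uniformly for
each order. -/
lemma exists_uniform_deriv_bound {G : CSpace m → Matrix (Fin m) (Fin m) ℂ}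
    {K s : Set (CSpace m)} (hK : IsCompact K) (hs : IsOpen s) (hKs : K ⊆ s)
    (hG : ∀ i j, ContDiffOn ℝ ∞ (fun p => G p i j) s) :
    ∃ B : ℕ → ℝ, ∀ v ∈ K, ∀ (p q : List (Fin m)) (i j : Fin m),
      ‖mixedDeriv p q (fun w => G w i j) v‖ < B (p.length + q.length) := by
  have hb : ∀ x : (List (Fin m) × List (Fin m)) × Fin m × Fin m, ∃ C : ℝ, ∀ v ∈ K,
      ‖mixedDeriv x.1.1 x.1.2 (fun w => G w x.2.1 x.2.2) v‖ ≤ C := fun x =>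
    hK.exists_bound_of_continuousOn
      ((contDiffOn_mixedDeriv hs (hG _ _) _ _).continuousOn.mono hKs)
  choose C hC using hb
  -- There are only finitely many multi-indices of a given order.
  have hfin : ∀ N : ℕ, (({l : List (Fin m) | l.length ≤ N} ×ˢ {l : List (Fin m) | l.length ≤ N}) ×ˢ
      (univ : Set (Fin m × Fin m))).Finite := fun N =>
    ((List.finite_length_le _ N).prod (List.finite_length_le _ N)).prod finite_univ
  have hbdd : ∀ N, ∃ b : ℝ, ∀ x ∈ (({l : List (Fin m) | l.length ≤ N} ×ˢ
      {l : List (Fin m) | l.length ≤ N}) ×ˢ (univ : Set (Fin m × Fin m))), C x ≤ b := fun N => by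
    obtain ⟨b, hb⟩ := ((hfin N).image C).bddAbove
    exact ⟨b, fun x hx => hb (mem_image_of_mem C hx)⟩
  choose b hb using hbdd
  refine ⟨fun N => b N + 1, fun v hv p q i j => ?_⟩
  have h1 := hC ((p, q), i, j) v hv
  have h2 := hb (p.length + q.length) ((p, q), i, j)
    ⟨⟨Nat.le_add_right _ _, Nat.le_add_left _ _⟩, mem_univ _⟩
  simp only at h1
  linarith

end SesqForm

/-! ### The Bergman metric of the Siegel domain -/

section SiegelMetric

variable {n : ℕ}

/-- The Bergman metric `-(n + 2) ∂∂̄ log(-Re ζ - |z|²)` of the Siegel domain. -/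
def siegelMetric (p : CSpace (n + 1)) : Matrix (Fin (n + 1)) (Fin (n + 1)) ℂ :=
  complexHessian (fun q : CSpace (n + 1) => -(n + 2 : ℝ) * Real.log (siegelHeight q)) p

lemma contDiffAt_log_siegelHeight {p : CSpace (n + 1)} (hp : p ∈ siegelDomain n) :
    ContDiffAt ℝ ∞ (fun q : CSpace (n + 1) => Real.log (siegelHeight q)) p :=
  contDiff_siegelHeight.contDiffAt.log (ne_of_gt hp)

lemma contDiffAt_siegelPotential {p : CSpace (n + 1)} (hp : p ∈ siegelDomain n) :
    ContDiffAt ℝ ∞ (fun q : CSpace (n + 1) => -(n + 2 : ℝ) * Real.log (siegelHeight q)) p :=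
  contDiffAt_const.mul (contDiffAt_log_siegelHeight hp)

lemma contDiffOn_siegelMetric (i j : Fin (n + 1)) :
    ContDiffOn ℝ ∞ (fun p : CSpace (n + 1) => siegelMetric p i j) (siegelDomain n) := by
  intro p hp
  refine ContDiffAt.contDiffWithinAt ?_
  have h : ContDiffAt ℝ ∞ (dHol i (dAnti j fun w : CSpace (n + 1) =>
      ((-(n + 2 : ℝ) * Real.log (siegelHeight w) : ℝ) : ℂ))) p := by
    rw [dHol_eq_wirtinger]
    exact ContDiffAt.wirtinger (ContDiffAt.wirtinger (contDiffAt_siegelPotential hp).ofReal)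
  exact h

/-- The Bergman metric of the ball is the pullback of the metric of the Siegel domain. -/
lemma bergmanMetric_unitBall {y : CSpace (n + 1)} (hy : y ∈ unitBall (n + 1))
    (i j : Fin (n + 1)) :
    bergmanMetric (unitBall (n + 1)) y i j = sesqForm (siegelMetric (cayley y))
      (fderiv ℂ cayley y (stdVec i)) (fderiv ℂ cayley y (stdVec j)) := by
  have hbi := isBiholomorphicOn_cayley (n := n)
  have hball : unitBall (n + 1) ∈ 𝓝 y := hbi.isOpen_source.mem_nhds hy
  have hev : ∀ᶠ w in 𝓝 y, DifferentiableAt ℂ (cayley (n := n)) w := by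
    filter_upwards [hball] with w hw
    exact hbi.differentiableOn.differentiableAt (hbi.isOpen_source.mem_nhds hw)
  have hevJ : ∀ᶠ w in 𝓝 y, DifferentiableAt ℂ (jacobian (cayley (n := n))) w := by
    filter_upwards [hev.eventually_nhds] with w hw
    exact differentiableAt_jacobian hw
  set C : ℝ := bergmanKernel (siegelDomain n) (siegelBase n) with hC
  have hbase0 : (0 : CSpace (n + 1)) ∈ unitBall (n + 1) := by simp [unitBall]
  have hcay0 : cayley (0 : CSpace (n + 1)) = siegelBase n := by
    simp [cayley, siegelBase]
  have hCpos : 0 < C := by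
    have h1 := hbi.bergmanKernel_eq hbase0
    have h2 := bergmanKernel_unitBall_zero_pos (m := n + 1)
    rw [h1, hcay0, ← hC] at h2
    exact pos_of_mul_pos_right h2 (by positivity)
  -- The kernel of the Siegel domain is `C r ^ (-(n + 2))`, and the Jacobian factor in the
  -- transformation law has a pluriharmonic logarithm.
  have hlog : (fun w => Real.log (bergmanKernel (unitBall (n + 1)) w)) =ᶠ[𝓝 y] fun w =>
      Real.log (‖jacobian cayley w‖ ^ 2) +
        (Real.log C + -(n + 2 : ℝ) * Real.log (siegelHeight (cayley w))) := by
    filter_upwards [hball] with w hw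
    have hr : 0 < siegelHeight (cayley w) := hbi.mapsTo hw
    have hJ : ‖jacobian (cayley (n := n)) w‖ ^ 2 ≠ 0 := by
      simpa using hbi.jacobian_ne_zero hw
    have hK : bergmanKernel (siegelDomain n) (cayley w) = C / siegelHeight (cayley w) ^ (n + 2) := by
      rw [eq_div_iff (by positivity), hC, bergmanKernel_siegelDomain (hbi.mapsTo hw), mul_comm]
    rw [hbi.bergmanKernel_eq hw, hK, Real.log_mul hJ (by positivity),
      Real.log_div hCpos.ne' (by positivity), Real.log_pow (siegelHeight (cayley w)) (n + 2)]
    push_cast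
    ring
  have hsmooth := contDiffAt_siegelPotential (hbi.mapsTo hy)
  have hcs : ContDiffAt ℝ ∞ (cayley (n := n)) y :=
    (contDiffAt_of_eventually_differentiableAt hev).restrict_scalars ℝ
  have hcomp : ContDiffAt ℝ ∞
      (fun w => -(n + 2 : ℝ) * Real.log (siegelHeight (cayley (n := n) w))) y :=
    hsmooth.comp y hcs
  have h1 := contDiffAt_log_norm_sq hevJ (hbi.jacobian_ne_zero hy)
  rw [bergmanMetric, complexHessian_congr hlog, complexHessian_add h1
    (contDiffAt_const.add hcomp), complexHessian_log_norm_sq hevJ (hbi.jacobian_ne_zero hy),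
    zero_add, complexHessian_const_add _ hcomp]
  exact complexHessian_comp hsmooth hev i j

/-- The maps `heis` are isometries of the metric. -/
lemma siegelMetric_heis {t : ℝ} (ht : t ≠ 0) (l : CSpace n) (c : ℝ) {p : CSpace (n + 1)}
    (hp : p ∈ siegelDomain n) (x y : CSpace (n + 1)) :
    sesqForm (siegelMetric p) x y =
      sesqForm (siegelMetric (heis t l c p)) (heisLin t l x) (heisLin t l y) := by
  refine sesqForm_eq_of_pullback (fun i j => ?_) x y
  have hmem : heis t l c p ∈ siegelDomain n := (isBiholomorphicOn_heis ht l c).mapsTo hp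
  have h := complexHessian_comp (Φ := heis t l c) (contDiffAt_siegelPotential hmem)
    (Filter.Eventually.of_forall fun w => differentiable_heis t l c w) i j
  rw [(hasFDerivAt_heis t l c p).fderiv] at h
  rw [siegelMetric, siegelMetric, ← h]
  have hlog : (fun w => -(n + 2 : ℝ) * Real.log (siegelHeight (heis t l c w))) =ᶠ[𝓝 p] fun w =>
      -(n + 2 : ℝ) * Real.log (t ^ 2) + -(n + 2 : ℝ) * Real.log (siegelHeight w) := by
    filter_upwards [isOpen_siegelDomain.mem_nhds hp] with w hw
    have hw' : siegelHeight w ≠ 0 := ne_of_gt hw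
    rw [siegelHeight_heis, Real.log_mul (by positivity) hw']
    ring
  rw [complexHessian_congr hlog, complexHessian_const_add _ (contDiffAt_siegelPotential hp)]

lemma dAnti_ofReal {m : ℕ} (u : CSpace m → ℝ) (i : Fin m) (v : CSpace m) :
    dAnti i (fun w => (u w : ℂ)) v = starRingEnd ℂ (dHol i (fun w => (u w : ℂ)) v) := by
  rw [← dAnti_conj]
  simp

lemma complexHessian_log {m : ℕ} {u : CSpace m → ℝ} {v : CSpace m} (hu : ContDiffAt ℝ ∞ u v)
    (h0 : u v ≠ 0) (i j : Fin m) :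
    complexHessian (fun w => Real.log (u w)) v i j = complexHessian u v i j / u v -
      dHol i (fun w => (u w : ℂ)) v * starRingEnd ℂ (dHol j (fun w => (u w : ℂ)) v) / u v ^ 2 := by
  have hne : ∀ᶠ w in 𝓝 v, u w ≠ 0 := hu.continuousAt.eventually_ne h0
  have hud : ∀ᶠ w in 𝓝 v, DifferentiableAt ℝ u w := hu.eventually_differentiableAt
  have hinv : ∀ᶠ w in 𝓝 v, ∀ x, fderiv ℝ (fun w => ((Real.log (u w) : ℝ) : ℂ)) w x =
      (u w : ℂ)⁻¹ * fderiv ℝ (fun w => (u w : ℂ)) w x := by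
    filter_upwards [hne, hud] with w hw hd x
    have h1 := (Complex.ofRealCLM.hasFDerivAt.comp w (hd.hasFDerivAt.log hw)).fderiv
    have h2 := (Complex.ofRealCLM.hasFDerivAt.comp w hd.hasFDerivAt).fderiv
    have h1' := congrArg (fun L => L x) h1
    have h2' := congrArg (fun L => L x) h2
    refine h1'.trans ?_
    rw [show fderiv ℝ (fun w => (u w : ℂ)) w x = _ from h2']
    simp
  have h1 : dAnti j (fun w => ((Real.log (u w) : ℝ) : ℂ)) =ᶠ[𝓝 v] fun w =>
      (u w : ℂ)⁻¹ * dAnti j (fun w => (u w : ℂ)) w := by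
    filter_upwards [hinv] with w hw
    rw [dAnti, dAnti, hw, hw]
    ring
  have hinvd : DifferentiableAt ℝ (fun w => (u w : ℂ)⁻¹) v :=
    ((hu.ofReal.inv (by exact_mod_cast h0)).differentiableAt (by simp))
  have hi : dHol i (fun w => (u w : ℂ)⁻¹) v = -dHol i (fun w => (u w : ℂ)) v / u v ^ 2 := by
    have hd := hu.ofReal.differentiableAt (by simp)
    have h3 : fderiv ℝ (fun w => (u w : ℂ)⁻¹) v =
        -((u v : ℂ) ^ 2)⁻¹ • fderiv ℝ (fun w => (u w : ℂ)) v := by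
      have := ((hasDerivAt_inv (x := (u v : ℂ)) (by exact_mod_cast h0)).hasFDerivAt.restrictScalars
        ℝ).comp v hd.hasFDerivAt
      rw [show (fun w => (u w : ℂ)⁻¹) = (fun z : ℂ => z⁻¹) ∘ fun w => (u w : ℂ) from rfl,
        this.fderiv]
      ext x
      simp [mul_comm]
    simp only [dHol, h3, smul_apply, smul_eq_mul]
    ring
  have hd2 : DifferentiableAt ℝ (dAnti j fun w => (u w : ℂ)) v :=
    (ContDiffAt.wirtinger hu.ofReal).differentiableAt (by simp)
  rw [complexHessian, Matrix.of_apply, dHol_eq_wirtinger, (wirtinger_congr h1).self_of_nhds,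
    wirtinger_mul hinvd hd2, ← dHol_eq_wirtinger, hi,
    dAnti_ofReal, complexHessian, Matrix.of_apply]
  ring

lemma dHol_siegelHeight (p : CSpace (n + 1)) (i : Fin (n + 1)) :
    dHol i (fun w : CSpace (n + 1) => (siegelHeight w : ℂ)) p =
      -(ζPart n (stdVec i)) / 2 - inner ℂ (zPart n p) (zPart n (stdVec i)) := by
  have hD : ∀ x, fderiv ℝ (fun w : CSpace (n + 1) => (siegelHeight w : ℂ)) p x =
      ((-(ζPart n x).re - 2 * (inner ℂ (zPart n p) (zPart n x)).re : ℝ) : ℂ) := fun x => by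
    have h1 : HasFDerivAt (fun w : CSpace (n + 1) => (ζPart n w).re) _ p :=
      Complex.reCLM.hasFDerivAt.comp p ((ζPart n).hasFDerivAt.restrictScalars ℝ)
    have h2 : HasFDerivAt (fun w : CSpace (n + 1) => ‖zPart n w‖ ^ 2) _ p :=
      ((zPart n).hasFDerivAt.restrictScalars ℝ).norm_sq
    have h3 := (Complex.ofRealCLM.hasFDerivAt.comp p (h1.neg.sub h2)).fderiv
    refine (congrArg (fun L => L x) h3).trans ?_
    simp [two_mul, PiLp.inner_apply]
  rw [dHol, hD, hD, map_smul, map_smul, inner_smul_right]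
  apply Complex.ext <;> simp <;> ring

lemma complexHessian_siegelHeight (p : CSpace (n + 1)) (i j : Fin (n + 1)) :
    complexHessian (siegelHeight (n := n)) p i j =
      -inner ℂ (zPart n (stdVec j)) (zPart n (stdVec i)) := by
  have hre : (fun q : CSpace (n + 1) => (ζPart n q).re) =
      fun q => Real.log (‖Complex.exp (ζPart n q / 2)‖ ^ 2) := by
    funext q
    rw [Complex.norm_exp, ← Real.exp_nat_mul, Real.log_exp]
    simp
    ring
  have hexp : ∀ q, DifferentiableAt ℂ (fun q : CSpace (n + 1) => Complex.exp (ζPart n q / 2)) q :=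
    fun q => by fun_prop
  have h1 : complexHessian (fun q : CSpace (n + 1) => (ζPart n q).re) p = 0 := by
    rw [hre]
    exact complexHessian_log_norm_sq (Filter.Eventually.of_forall hexp) (Complex.exp_ne_zero _)
  have hs1 : ContDiffAt ℝ ∞ (fun q : CSpace (n + 1) => (ζPart n q).re) p :=
    (Complex.reCLM.contDiff.comp ((ζPart n).restrictScalars ℝ).contDiff).contDiffAt
  have hs2 : ContDiffAt ℝ ∞ (fun q : CSpace (n + 1) => ‖zPart n q‖ ^ 2) p :=
    (((zPart n).restrictScalars ℝ).contDiff.norm_sq ℝ).contDiffAt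
  have h2 := complexHessian_comp (Φ := zPart n) (u := fun z : CSpace n => ‖z‖ ^ 2) (v := p)
    (contDiff_norm_sq ℝ).contDiffAt (Filter.Eventually.of_forall fun w =>
      (zPart n).differentiableAt) i j
  rw [complexHessian_norm_sq, sesqForm_one, (zPart n).fderiv] at h2
  have h3 : (siegelHeight (n := n)) = fun q =>
      -1 * (ζPart n q).re + -1 * ‖zPart n q‖ ^ 2 := by
    funext q
    rw [siegelHeight]
    ring
  rw [h3, complexHessian_add (contDiffAt_const.mul hs1) (contDiffAt_const.mul hs2),
    complexHessian_const_mul _ hs1, complexHessian_const_mul _ hs2, h1, Matrix.add_apply,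
    Matrix.smul_apply, Matrix.smul_apply, h2]
  simp

lemma siegelMetric_apply {p : CSpace (n + 1)} (hp : p ∈ siegelDomain n) (i j : Fin (n + 1)) :
    siegelMetric p i j = (n + 2 : ℝ) *
      (inner ℂ (zPart n (stdVec j)) (zPart n (stdVec i)) / siegelHeight p +
        (ζPart n (stdVec i) / 2 + inner ℂ (zPart n p) (zPart n (stdVec i))) *
          starRingEnd ℂ (ζPart n (stdVec j) / 2 + inner ℂ (zPart n p) (zPart n (stdVec j))) /
            siegelHeight p ^ 2) := by
  rw [siegelMetric, complexHessian_const_mul _ (contDiffAt_log_siegelHeight hp),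
    Matrix.smul_apply, complexHessian_log contDiff_siegelHeight.contDiffAt (ne_of_gt hp),
    complexHessian_siegelHeight, dHol_siegelHeight, dHol_siegelHeight, smul_eq_mul]
  simp only [map_sub, map_neg, map_div₀, map_add, map_ofNat]
  push_cast
  ring

/-- The Bergman metric of the Siegel domain as a sum of two squares. -/
lemma sesqForm_siegelMetric {p : CSpace (n + 1)} (hp : p ∈ siegelDomain n)
    (x : CSpace (n + 1)) :
    sesqForm (siegelMetric p) x x = ((n + 2 : ℝ) * (‖zPart n x‖ ^ 2 / siegelHeight p +
      ‖ζPart n x / 2 + inner ℂ (zPart n p) (zPart n x)‖ ^ 2 / siegelHeight p ^ 2) : ℝ) := by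
  have hx := CSpace.eq_sum_smul_stdVec x
  have hz : zPart n x = ∑ a, x a • zPart n (stdVec a) := by
    conv_lhs => rw [hx]
    simp
  have hF : ζPart n x / 2 + inner ℂ (zPart n p) (zPart n x) =
      ∑ a, x a * (ζPart n (stdVec a) / 2 + inner ℂ (zPart n p) (zPart n (stdVec a))) := by
    conv_lhs => rw [hx]
    simp only [map_sum, map_smul, Finset.sum_div, inner_sum, inner_smul_right, smul_eq_mul,
      ← Finset.sum_add_distrib]
    exact Finset.sum_congr rfl fun _ _ => by ring
  have h1 : ((‖zPart n x‖ ^ 2 : ℝ) : ℂ) = ∑ a, ∑ b, x a * starRingEnd ℂ (x b) *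
      inner ℂ (zPart n (stdVec b)) (zPart n (stdVec a)) := by
    have h := inner_self_eq_norm_sq_to_K (𝕜 := ℂ) (zPart n x)
    have h' : ((‖zPart n x‖ ^ 2 : ℝ) : ℂ) = inner ℂ (zPart n x) (zPart n x) := by
      rw [h]
      simp
    rw [h', hz, inner_sum]
    refine Finset.sum_congr rfl fun a _ => ?_
    rw [sum_inner]
    refine Finset.sum_congr rfl fun b _ => ?_
    rw [inner_smul_left, inner_smul_right]
    ring
  have h2 : ((‖ζPart n x / 2 + inner ℂ (zPart n p) (zPart n x)‖ ^ 2 : ℝ) : ℂ) =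
      ∑ a, ∑ b, x a * starRingEnd ℂ (x b) *
        ((ζPart n (stdVec a) / 2 + inner ℂ (zPart n p) (zPart n (stdVec a))) *
          starRingEnd ℂ (ζPart n (stdVec b) / 2 + inner ℂ (zPart n p) (zPart n (stdVec b)))) := by
    rw [← Complex.normSq_eq_norm_sq, ← Complex.mul_conj, hF, map_sum, Finset.sum_mul_sum]
    refine Finset.sum_congr rfl fun a _ => Finset.sum_congr rfl fun b _ => ?_
    rw [map_mul]
    ring
  have h3 : ∀ a A B h : ℝ, ((a * (A / h + B / h ^ 2) : ℝ) : ℂ) =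
      (a : ℂ) * ((A : ℂ) / h + (B : ℂ) / h ^ 2) := fun a A B h => by push_cast; rfl
  rw [h3, h1, h2, sesqForm, Finset.sum_div, Finset.sum_div, ← Finset.sum_add_distrib, Finset.mul_sum]
  refine Finset.sum_congr rfl fun a _ => ?_
  rw [Finset.sum_div, Finset.sum_div, ← Finset.sum_add_distrib, Finset.mul_sum]
  refine Finset.sum_congr rfl fun b _ => ?_
  rw [siegelMetric_apply hp]
  push_cast
  ring

/-- The metric is positive definite. -/
lemma posDef_siegelMetric {p : CSpace (n + 1)} (hp : p ∈ siegelDomain n) :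
    (siegelMetric p).PosDef := by
  have hp' : 0 < siegelHeight p := hp
  refine posDef_of_sesqForm ?_ fun x hx => ?_
  · ext i j
    rw [Matrix.conjTranspose_apply, siegelMetric_apply hp, siegelMetric_apply hp, RCLike.star_def]
    simp only [map_mul, map_add, map_div₀, map_pow, Complex.conj_ofReal, Complex.conj_conj,
      inner_conj_symm]
    ring
  · rw [sesqForm_siegelMetric hp]
    rw [Complex.zero_lt_real]
    by_cases hz : zPart n x = 0
    · have hζ : ζPart n x ≠ 0 := fun h => hx (siegel_ext (by simpa using hz) (by simpa using h))
      have : 0 < ‖ζPart n x / 2‖ ^ 2 :=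
        pow_pos (norm_pos_iff.mpr (div_ne_zero hζ two_ne_zero)) 2
      simp only [hz, norm_zero, inner_zero_right, add_zero]
      exact mul_pos (by positivity) (add_pos_of_nonneg_of_pos (by simp)
        (div_pos this (pow_pos hp' 2)))
    · have h1 : 0 < ‖zPart n x‖ ^ 2 := by
        have : 0 < ‖zPart n x‖ := norm_pos_iff.mpr hz
        positivity
      exact mul_pos (by positivity) (add_pos_of_pos_of_nonneg (div_pos h1 hp') (by positivity))

end SiegelMetric

/-! ### Covering maps from transitive deck transformations -/

section Deck

variable {X Y : Type*} [TopologicalSpace X] [TopologicalSpace Y]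

/-- An open, locally injective map out of a connected Hausdorff space is a covering map as soon as
its deck transformations act transitively on the fibres. -/
theorem isCoveringMap_of_deck_transitive [PreconnectedSpace X] [T2Space X] {f : X → Y}
    (hc : Continuous f) (ho : IsOpenMap f) (hs : Function.Surjective f)
    (hi : IsLocallyInjective f)
    (ht : ∀ x x', f x = f x' → ∃ h : X ≃ₜ X, h x = x' ∧ ∀ w, f (h w) = f w) :
    IsCoveringMap f := by
  let G : Subgroup (X ≃ₜ X) :=
    { carrier := {h | ∀ w, f (h w) = f w}
      mul_mem' := fun {a b} ha hb w => (ha (b w)).trans (hb w)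
      one_mem' := fun _ => rfl
      inv_mem' := fun {a} ha w => by
        have := ha (a.symm w)
        rw [Homeomorph.apply_symm_apply] at this
        exact this.symm }
  let act : MulAction G X :=
    { smul := fun g x => g.1 x
      one_smul := fun _ => rfl
      mul_smul := fun _ _ _ => rfl }
  have hsmul : ∀ (g : G) (x : X), g • x = g.1 x := fun _ _ => rfl
  have hq : IsQuotientCoveringMap f G :=
    { toIsQuotientMap := ho.isQuotientMap hc hs
      continuous_const_smul := fun g => g.1.continuous
      apply_eq_iff_mem_orbit := fun {x x'} => by
        constructor
        · intro h
          obtain ⟨g, hg, hg'⟩ := ht x' x h.symm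
          exact ⟨⟨g, hg'⟩, hg⟩
        · rintro ⟨g, rfl⟩
          exact g.2 x'
      disjoint := fun x => by
        obtain ⟨U, hU, hxU, hinj⟩ := hi x
        refine ⟨U, hU.mem_nhds hxU, fun g hg => ?_⟩
        obtain ⟨_, ⟨w, hw, rfl⟩, hgw⟩ := hg
        -- A deck transformation moving a point within an injectivity neighbourhood fixes it.
        have hfix : g.1 w = w := hinj hgw hw (g.2 w)
        have hid : (g.1 : X → X) = id :=
          (T2Space.isSeparatedMap f).eq_of_comp_eq hi g.1.continuous continuous_id
            (funext g.2) w hfix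
        apply Subtype.ext
        apply Homeomorph.ext
        exact congrFun hid }
  exact hq.isCoveringMap

end Deck

/-! ### Cusps uniformized by the Siegel domain -/

section Cusp

variable {n : ℕ} {E : Type*} [NormedAddCommGroup E] [NormedSpace ℂ E]
  {H : Type*} [TopologicalSpace H] (I : ModelWithCorners ℂ E H)
  {M : Type*} [TopologicalSpace M] [ChartedSpace H M]

/-- A holomorphic map `P : ℂⁿ⁺¹ → M` whose image is the set where `ρ > 0`, which relates `ρ` to
the height by `ρ ∘ P = exp (-2 r)`, and whose fibres are orbits of Heisenberg translations that
leave `P` invariant. The field `cocompact` says that these translations form a lattice. -/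
structure IsCuspUniformization (P : CSpace (n + 1) → M) (ρ : M → ℝ) : Prop where
  holomorphic : MDifferentiable 𝓘(ℂ, CSpace (n + 1)) I P
  bijective_mfderiv : ∀ p, Function.Bijective (mfderiv 𝓘(ℂ, CSpace (n + 1)) I P p)
  isLocallyInjective : IsLocallyInjective P
  isOpenMap : IsOpenMap P
  continuous_rho : Continuous ρ
  rho_nonneg : ∀ x, 0 ≤ ρ x
  rho_apply : ∀ p, ρ (P p) = Real.exp (-(2 * siegelHeight p))
  exists_eq : ∀ x, 0 < ρ x → ∃ p, P p = x
  fiber : ∀ p q, P p = P q → ∃ (l : CSpace n) (c : ℝ), heis 1 l c p = q ∧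
    ∀ w, P (heis 1 l c w) = P w
  cocompact : ∃ K : Set (CSpace n), IsCompact K ∧ ∀ p, ∃ q, P q = P p ∧ zPart n q ∈ K ∧
    (ζPart n q).im ∈ Icc 0 (2 * Real.pi)

variable {I} {P : CSpace (n + 1) → M} {ρ : M → ℝ}

lemma heisLin_bijective {t : ℝ} (ht : t ≠ 0) (l : CSpace n) :
    Function.Bijective (heisLin t l) := by
  have hinj : Function.Injective (heisLin t l) := by
    refine (injective_iff_map_eq_zero _).mpr fun x hx => ?_
    have ht' : (t : ℂ) ≠ 0 := by exact_mod_cast ht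
    have h1 : zPart n (heisLin t l x) = (t : ℂ) • zPart n x := by simp [heisLin, zPart]
    have h2 : ζPart n (heisLin t l x) =
        (t : ℂ) ^ 2 * ζPart n x - 2 * t * inner ℂ l (zPart n x) := by simp [heisLin, ζPart]
    have hz : zPart n x = 0 := by
      rw [hx, map_zero] at h1
      exact (smul_eq_zero.mp h1.symm).resolve_left ht'
    have hζ : ζPart n x = 0 := by
      rw [hx, map_zero, hz, inner_zero_right, mul_zero, sub_zero] at h2
      exact (mul_eq_zero.mp h2.symm).resolve_left (pow_ne_zero 2 ht')
    exact siegel_ext (by simpa using hz) (by simpa using hζ)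
  exact ⟨hinj, (LinearMap.injective_iff_surjective
    (f := (heisLin t l : CSpace (n + 1) →ₗ[ℂ] CSpace (n + 1)))).mp hinj⟩

lemma heis_mem_siegelDomain {t : ℝ} (ht : t ≠ 0) (l : CSpace n) (c : ℝ) {p : CSpace (n + 1)}
    (hp : p ∈ siegelDomain n) : heis t l c p ∈ siegelDomain n :=
  (isBiholomorphicOn_heis ht l c).mapsTo hp

lemma isCompact_slab {K : Set (CSpace n)} (hK : IsCompact K) (a b : ℝ) :
    IsCompact {q : CSpace (n + 1) | zPart n q ∈ K ∧ (ζPart n q).im ∈ Icc 0 (2 * Real.pi) ∧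
      siegelHeight q ∈ Icc a b} := by
  set f : CSpace n × ℝ × ℝ → CSpace (n + 1) := fun x =>
    siegelMk x.1 (-((x.2.2 + ‖x.1‖ ^ 2 : ℝ) : ℂ) + x.2.1 * Complex.I) with hf
  have hfc : Continuous f := by
    refine continuous_siegelMk.comp (Continuous.prodMk continuous_fst ?_)
    fun_prop
  refine (((hK.prod ((isCompact_Icc (a := 0) (b := 2 * Real.pi)).prod
    (isCompact_Icc (a := a) (b := b)))).image hfc).of_isClosed_subset ?_ ?_ :
    IsCompact {q : CSpace (n + 1) | zPart n q ∈ K ∧ (ζPart n q).im ∈ Icc 0 (2 * Real.pi) ∧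
      siegelHeight q ∈ Icc a b})
  · refine (hK.isClosed.preimage (zPart n).continuous).inter (IsClosed.inter ?_ ?_)
    · exact isClosed_Icc.preimage (Complex.continuous_im.comp (ζPart n).continuous)
    · exact isClosed_Icc.preimage continuous_siegelHeight
  · rintro q ⟨h1, h2, h3⟩
    refine ⟨(zPart n q, (ζPart n q).im, siegelHeight q), ⟨h1, h2, h3⟩, ?_⟩
    apply siegel_ext
    · rw [hf, zPart_mk]
    · rw [hf, ζPart_mk]
      apply Complex.ext <;> simp [siegelHeight, -Complex.ofReal_pow]

namespace IsCuspUniformization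

variable (hP : IsCuspUniformization I P ρ)
include hP

lemma continuous : Continuous P := hP.holomorphic.continuous

lemma mem_disc_iff (k : ℝ) (p : CSpace (n + 1)) :
    (0 < ρ (P p) ∧ ρ (P p) < Real.exp (-k)) ↔ k / 2 < siegelHeight p := by
  rw [hP.rho_apply, Real.exp_lt_exp]
  constructor
  · rintro ⟨-, h⟩
    linarith
  · intro h
    exact ⟨Real.exp_pos _, by linarith⟩

lemma image_siegelDomain :
    P '' siegelDomain n = {x | 0 < ρ x ∧ ρ x < Real.exp (-0)} := by
  refine Subset.antisymm ?_ fun x hx => ?_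
  · rintro _ ⟨p, hp, rfl⟩
    have hp' : 0 < siegelHeight p := hp
    exact (hP.mem_disc_iff 0 p).mpr (by simpa using hp')
  · obtain ⟨p, rfl⟩ := hP.exists_eq x hx.1
    have := (hP.mem_disc_iff 0 p).mp hx
    exact ⟨p, by simpa [siegelDomain] using this, rfl⟩

lemma isOpen_disc (k : ℝ) : IsOpen {x | 0 < ρ x ∧ ρ x < Real.exp (-k)} :=
  (isOpen_lt continuous_const hP.continuous_rho).inter
    (isOpen_lt hP.continuous_rho continuous_const)

/-- The composition of `P` with the Cayley transform is a covering map from the ball. -/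
theorem isBallUniformization :
    IsBallUniformization I {x | 0 < ρ x ∧ ρ x < Real.exp (-0)} (P ∘ cayley (n := n)) := by
  have hbi := isBiholomorphicOn_cayley (n := n)
  have himg : (P ∘ cayley) '' unitBall (n + 1) = {x | 0 < ρ x ∧ ρ x < Real.exp (-0)} := by
    rw [image_comp, hbi.image_eq, hP.image_siegelDomain]
  refine ⟨fun y hy => ?_, himg, ?_⟩
  · have h1 := (hbi.differentiableOn.differentiableAt (hbi.isOpen_source.mem_nhds hy))
    exact (MDifferentiableAt.comp y (hP.holomorphic (cayley y))
      h1.mdifferentiableAt).mdifferentiableWithinAt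
  · set D : Set M := {x | 0 < ρ x ∧ ρ x < Real.exp (-0)} with hD
    have hmem : ∀ p : siegelDomain n, P p ∈ D := fun p => by
      rw [hD, ← hP.image_siegelDomain]
      exact mem_image_of_mem P p.2
    set f : siegelDomain n → D := fun p => ⟨P p, hmem p⟩ with hf
    have hconn : PreconnectedSpace (siegelDomain n) :=
      isPreconnected_iff_preconnectedSpace.mp (convex_siegelHeight_gt 0).isPreconnected
    -- The deck transformations of `P` on the Siegel domain are Heisenberg translations.
    have hcov : IsCoveringMap f := by
      refine isCoveringMap_of_deck_transitive ?_ ?_ ?_ ?_ ?_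
      · exact (hP.continuous.comp continuous_subtype_val).subtype_mk _
      · exact (hP.isOpenMap.comp isOpen_siegelDomain.isOpenMap_subtype_val).subtype_mk _
      · rintro ⟨x, hx⟩
        rw [hD, ← hP.image_siegelDomain] at hx
        obtain ⟨p, hp, rfl⟩ := hx
        exact ⟨⟨p, hp⟩, rfl⟩
      · rintro ⟨p, hp⟩
        obtain ⟨U, hU, hpU, hinj⟩ := hP.isLocallyInjective p
        refine ⟨Subtype.val ⁻¹' U, hU.preimage continuous_subtype_val, hpU, ?_⟩
        intro a ha b hb hab
        exact Subtype.ext (hinj ha hb (congrArg Subtype.val hab))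
      · rintro ⟨p, hp⟩ ⟨q, hq⟩ hpq
        obtain ⟨l, c, hlc, hinv⟩ := hP.fiber p q (congrArg Subtype.val hpq)
        have h1 : (1 : ℝ) ≠ 0 := one_ne_zero
        have hcont : ∀ (t : ℝ) (l : CSpace n) (c : ℝ), Continuous (heis t l c) := fun t l c =>
          (differentiable_heis t l c).continuous
        refine ⟨{ toFun := fun w => ⟨heis 1 l c w, heis_mem_siegelDomain h1 l c w.2⟩
                  invFun := fun w => ⟨_, (isBiholomorphicOn_heis h1 l c).mapsTo_symm w.2⟩
                  left_inv := fun w => Subtype.ext (heis_heis_inv h1 l c w)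
                  right_inv := fun w => Subtype.ext (heis_inv_heis h1 l c w)
                  continuous_toFun := by
                    exact ((hcont _ _ _).comp continuous_subtype_val).subtype_mk _
                  continuous_invFun := by
                    exact ((hcont _ _ _).comp continuous_subtype_val).subtype_mk _ }, ?_, ?_⟩
        · exact Subtype.ext hlc
        · exact fun w => Subtype.ext (hinv w)
    let e : unitBall (n + 1) ≃ₜ siegelDomain n :=
      { toFun := fun y => ⟨cayley y, hbi.mapsTo y.2⟩
        invFun := fun p => ⟨cayleyInv p, hbi.mapsTo_symm p.2⟩
        left_inv := fun y => Subtype.ext (hbi.left_inv y y.2)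
        right_inv := fun p => Subtype.ext (hbi.right_inv p p.2)
        continuous_toFun := by
          exact (continuousOn_iff_continuous_domRestrict.mp
            hbi.differentiableOn.continuousOn).subtype_mk _
        continuous_invFun := by
          exact (continuousOn_iff_continuous_domRestrict.mp
            hbi.differentiableOn_symm.continuousOn).subtype_mk _ }
    exact IsCoveringMapOn.of_isCoveringMap_subtype (hP.isOpen_disc 0)
      (fun y => hmem (e y)) (hcov.comp_homeomorph e)

/-! ### The metric induced by the Bergman metric -/

lemma mfderiv_comp_heis (t : ℝ) (l : CSpace n) (c : ℝ) (p x : CSpace (n + 1)) :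
    mfderiv 𝓘(ℂ, CSpace (n + 1)) I (P ∘ heis t l c) p x =
      mfderiv 𝓘(ℂ, CSpace (n + 1)) I P (heis t l c p) (heisLin t l x) := by
  rw [mfderiv_comp p (hP.holomorphic _) (differentiable_heis t l c p).mdifferentiableAt,
    mfderiv_eq_fderiv, (hasFDerivAt_heis t l c p).fderiv]
  rfl

/-- The differential of `P`, as an isomorphism onto the model space. -/
def tangentEquiv (p : CSpace (n + 1)) : CSpace (n + 1) ≃ₗ[ℂ] E :=
  let L : CSpace (n + 1) →L[ℂ] E := mfderiv 𝓘(ℂ, CSpace (n + 1)) I P p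
  LinearEquiv.ofBijective (L : CSpace (n + 1) →ₗ[ℂ] E) (hP.bijective_mfderiv p)

open Classical in
/-- The metric on the image of the Siegel domain induced by the Bergman metric, as a form on the
model space: at a point `x`, the push-forward of the latter by the differential of `P` at a chosen
preimage. -/
def inducedForm (x : M) : E →ₗ[ℂ] E →ₗ⋆[ℂ] ℂ :=
  if h : ∃ p ∈ siegelDomain n, P p = x then
    ((sesqMap (n + 1) (siegelMetric h.choose)).comp
      (hP.tangentEquiv h.choose).symm.toLinearMap).compl₂ (hP.tangentEquiv h.choose).symm.toLinearMap
  else 0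

/-- The induced metric does not depend on the choice of the preimage, by the invariance of the
Bergman metric under Heisenberg translations. -/
lemma inducedForm_apply {p : CSpace (n + 1)} (hp : p ∈ siegelDomain n)
    (x y : CSpace (n + 1)) :
    hP.inducedForm (P p) (hP.tangentEquiv p x) (hP.tangentEquiv p y) =
      sesqForm (siegelMetric p) x y := by
  have h : ∃ q ∈ siegelDomain n, P q = P p := ⟨p, hp, rfl⟩
  obtain ⟨l, c, hlc, hinv⟩ := hP.fiber p h.choose h.choose_spec.2.symm
  have hmf : ∀ x, hP.tangentEquiv p x = hP.tangentEquiv h.choose (heisLin 1 l x) := fun x => by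
    have h1 := hP.mfderiv_comp_heis 1 l c p x
    have h2 : P ∘ heis 1 l c = P := funext hinv
    rw [h2, hlc] at h1
    exact h1
  have hL : ∀ x, (hP.tangentEquiv h.choose).symm (hP.tangentEquiv p x) = heisLin 1 l x :=
    fun x => by rw [LinearEquiv.symm_apply_eq, hmf]
  rw [inducedForm, dif_pos h]
  refine Eq.trans ?_ (siegelMetric_heis one_ne_zero l c hp x y).symm
  rw [hlc, ← hL x, ← hL y]
  rfl

/-- The metric on the image of the Siegel domain induced by the Bergman metric. -/
def inducedMetric : SesquilinearField I M := fun x => hP.inducedForm x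

lemma inducedMetric_apply {p : CSpace (n + 1)} (hp : p ∈ siegelDomain n)
    (x y : CSpace (n + 1)) :
    hP.inducedMetric (P p) (mfderiv 𝓘(ℂ, CSpace (n + 1)) I P p x)
      (mfderiv 𝓘(ℂ, CSpace (n + 1)) I P p y) = sesqForm (siegelMetric p) x y :=
  hP.inducedForm_apply hp x y

lemma metricTensor_comp {m : ℕ} {θ : CSpace m → CSpace (n + 1)} {v : CSpace m}
    (hθ : DifferentiableAt ℂ θ v) (hv : θ v ∈ siegelDomain n) (i j : Fin m) :
    metricTensor I hP.inducedMetric (P ∘ θ) v i j =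
      sesqForm (siegelMetric (θ v)) (fderiv ℂ θ v (stdVec i)) (fderiv ℂ θ v (stdVec j)) := by
  rw [← hP.inducedMetric_apply hv, metricTensor, Matrix.of_apply,
    mfderiv_comp v (hP.holomorphic _) hθ.mdifferentiableAt, mfderiv_eq_fderiv]
  rfl

lemma isInducedBergmanMetric :
    IsInducedBergmanMetric I (P ∘ cayley (n := n)) hP.inducedMetric := by
  intro y hy
  have hbi := isBiholomorphicOn_cayley (n := n)
  ext i j
  rw [bergmanMetric_unitBall hy, hP.metricTensor_comp
    (hbi.differentiableOn.differentiableAt (hbi.isOpen_source.mem_nhds hy)) (hbi.mapsTo hy)]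

lemma metricTensor_heis {t : ℝ} (ht : t ≠ 0) (l : CSpace n) (c : ℝ) {v : CSpace (n + 1)}
    (hv : v ∈ siegelDomain n) :
    metricTensor I hP.inducedMetric (P ∘ heis t l c) v = siegelMetric v := by
  ext i j
  rw [hP.metricTensor_comp (differentiable_heis t l c v) (heis_mem_siegelDomain ht l c hv),
    (hasFDerivAt_heis t l c v).fderiv, ← siegelMetric_heis ht l c hv, sesqForm_stdVec]

/-! ### Quasi-coordinates near a cusp -/

/-- The quasi-coordinate obtained by restricting `P ∘ heis t l c` to a convex open set. -/
def chart {k t : ℝ} (ht : 0 < t) (l : CSpace n) (c : ℝ) (V : Set (CSpace (n + 1)))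
    (hVo : IsOpen V) (hVc : Convex ℝ V) (hVn : V.Nonempty)
    (hV : ∀ v ∈ V, k / 2 < t ^ 2 * siegelHeight v) :
    QuasiCoordinate I (n + 1) {x : M | 0 < ρ x ∧ ρ x < Real.exp (-k)} where
  domain := V
  map := P ∘ heis t l c
  isOpen_domain := hVo
  isConnected_domain := ⟨hVn, hVc.isPreconnected⟩
  mapsTo := fun v hv => (hP.mem_disc_iff k _).mpr (by
    rw [siegelHeight_heis]
    exact hV v hv)
  holomorphic := fun v _ => (MDifferentiableAt.comp v (hP.holomorphic _)
    (differentiable_heis t l c v).mdifferentiableAt).mdifferentiableWithinAt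
  maxRank := fun v _ => by
    have h : (mfderiv 𝓘(ℂ, CSpace (n + 1)) I (P ∘ heis t l c) v : CSpace (n + 1) → E) =
        (mfderiv 𝓘(ℂ, CSpace (n + 1)) I P (heis t l c v) : CSpace (n + 1) → E) ∘
          heisLin t l := funext fun x => hP.mfderiv_comp_heis t l c v x
    have hb : Function.Bijective
        ((mfderiv 𝓘(ℂ, CSpace (n + 1)) I P (heis t l c v) : CSpace (n + 1) → E) ∘
          heisLin t l) := (hP.bijective_mfderiv _).comp (heisLin_bijective ht.ne' l)
    rw [← h] at hb
    exact hb

/-- The quasi-coordinates that factor through a map `heis t l c` and have their domain in `T`. -/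
def charts (_ : IsCuspUniformization I P ρ) (k : ℝ) (T : Set (CSpace (n + 1))) :
    Set (QuasiCoordinate I (n + 1) {x : M | 0 < ρ x ∧ ρ x < Real.exp (-k)}) :=
  {α | α.domain ⊆ T ∧ ∃ (t : ℝ) (l : CSpace n) (c : ℝ), t ≠ 0 ∧ α.map = P ∘ heis t l c}

/-- A point whose height exceeds `k / 2` is the image of the base point under a chart defined on
a given convex neighbourhood of it, cut off at the height that corresponds to `k / 2`. -/
lemma exists_chart {k : ℝ} {T V : Set (CSpace (n + 1))} (hVT : V ⊆ T) (hVo : IsOpen V)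
    (hVc : Convex ℝ V) {q : CSpace (n + 1)} (hq : q ∈ siegelDomain n)
    (hn : (V ∩ {v | k / 2 < siegelHeight q * siegelHeight v}).Nonempty) :
    ∃ α ∈ hP.charts k T, α.domain = V ∩ {v | k / 2 < siegelHeight q * siegelHeight v} ∧
      α.map = P ∘ heis (Real.sqrt (siegelHeight q)) (zPart n q) (ζPart n q).im := by
  have hq' : 0 < siegelHeight q := hq
  have ht := Real.sqrt_pos.mpr hq'
  have hset : {v : CSpace (n + 1) | k / 2 < siegelHeight q * siegelHeight v} =
      {v | k / 2 / siegelHeight q < siegelHeight v} := by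
    refine Set.ext fun v => ?_
    rw [mem_ofPred_eq, mem_ofPred_eq, div_lt_iff₀' hq']
  refine ⟨hP.chart ht (zPart n q) (ζPart n q).im
    (V ∩ {v | k / 2 < siegelHeight q * siegelHeight v}) ?_ ?_ hn ?_, ⟨?_, _, _, _, ht.ne', rfl⟩,
    rfl, rfl⟩
  · exact hVo.inter (isOpen_lt continuous_const (continuous_const.mul continuous_siegelHeight))
  · rw [hset]
    exact hVc.inter (convex_siegelHeight_gt _)
  · intro v hv
    rw [Real.sq_sqrt hq'.le]
    exact hv.2
  · exact inter_subset_left.trans hVT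

/-- The part of the cusp between two heights is covered by finitely many injective charts. -/
lemma exists_finite_charts {k : ℝ} {T : Set (CSpace (n + 1))} (hT : T ∈ 𝓝 (siegelBase n))
    {K' : Set (CSpace (n + 1))} (hK' : IsCompact K') (hK'S : K' ⊆ siegelDomain n) :
    ∃ F ⊆ hP.charts k T, F.Finite ∧ (∀ α ∈ F, InjOn α.map α.domain) ∧
      ∀ q ∈ K', k / 2 < siegelHeight q → P q ∈ ⋃ α ∈ F, α.map '' α.domain := by
  refine hK'.induction_on (p := fun s => ∃ F ⊆ hP.charts k T, F.Finite ∧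
    (∀ α ∈ F, InjOn α.map α.domain) ∧
      ∀ q ∈ s, k / 2 < siegelHeight q → P q ∈ ⋃ α ∈ F, α.map '' α.domain) ?_ ?_ ?_ ?_
  · exact ⟨∅, empty_subset _, finite_empty, by simp, by simp⟩
  · rintro s t hst ⟨F, h1, h2, h3, h4⟩
    exact ⟨F, h1, h2, h3, fun q hq => h4 q (hst hq)⟩
  · rintro s t ⟨F, h1, h2, h3, h4⟩ ⟨F', h1', h2', h3', h4'⟩
    refine ⟨F ∪ F', union_subset h1 h1', h2.union h2', ?_, ?_⟩
    · rintro α (hα | hα)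
      exacts [h3 α hα, h3' α hα]
    · rintro q (hq | hq) hk
      · exact biUnion_mono subset_union_left (fun _ _ => Subset.rfl) (h4 q hq hk)
      · exact biUnion_mono subset_union_right (fun _ _ => Subset.rfl) (h4' q hq hk)
  · intro q hq
    have hqS : q ∈ siegelDomain n := hK'S hq
    have hq' : 0 < siegelHeight q := hqS
    have ht := (Real.sqrt_pos.mpr hq').ne'
    set θ := heis (Real.sqrt (siegelHeight q)) (zPart n q) (ζPart n q).im with hθ
    set θ' := heis (Real.sqrt (siegelHeight q))⁻¹
      (-(((Real.sqrt (siegelHeight q))⁻¹ : ℝ) : ℂ) • zPart n q)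
      (-(ζPart n q).im / (Real.sqrt (siegelHeight q)) ^ 2) with hθ'
    have hl : ∀ p, θ' (θ p) = p := heis_heis_inv ht _ _
    have hr : ∀ p, θ (θ' p) = p := heis_inv_heis ht _ _
    have hb : θ (siegelBase n) = q := heis_base hqS
    have hθ'c : Continuous θ' := (differentiable_heis _ _ _).continuous
    have hθc : Continuous θ := (differentiable_heis _ _ _).continuous
    obtain ⟨U, hU, hqU, hinj⟩ := hP.isLocallyInjective q
    have hnhds : T ∩ θ ⁻¹' U ∈ 𝓝 (siegelBase n) := by
      refine Filter.inter_mem hT (hθc.continuousAt.preimage_mem_nhds ?_)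
      rw [hb]
      exact hU.mem_nhds hqU
    -- Near `q` it suffices to take one chart, on a ball so small that `P ∘ θ` is injective there.
    obtain ⟨δ, hδ, hball⟩ := Metric.mem_nhds_iff.mp hnhds
    set V := Metric.ball (siegelBase n) δ with hV
    have hqV : θ' ⁻¹' V ∈ 𝓝 q := by
      refine hθ'c.continuousAt.preimage_mem_nhds (Metric.isOpen_ball.mem_nhds ?_)
      rw [← hb, hl]
      exact Metric.mem_ball_self hδ
    refine ⟨θ' ⁻¹' V, mem_nhdsWithin_of_mem_nhds hqV, ?_⟩
    by_cases hn : (V ∩ {v | k / 2 < siegelHeight q * siegelHeight v}).Nonempty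
    · obtain ⟨α, hα, hdom, hmap⟩ := hP.exists_chart
        (T := T) (fun v hv => (hball hv).1) Metric.isOpen_ball (convex_ball _ _) hqS hn
      refine ⟨{α}, by simpa using hα, finite_singleton α, ?_, ?_⟩
      · rintro _ rfl
        rw [hdom, hmap]
        intro a ha b hb hab
        have := hinj (hball ha.1).2 (hball hb.1).2 hab
        rw [← hl a, this, hl b]
      · intro w hw hk
        rw [biUnion_singleton, hdom, hmap]
        refine ⟨θ' w, ⟨hw, ?_⟩, congrArg P (hr w)⟩
        have h2 := siegelHeight_heis (Real.sqrt (siegelHeight q)) (zPart n q) (ζPart n q).im (θ' w)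
        rw [Real.sq_sqrt hq'.le] at h2
        rw [mem_ofPred_eq, ← h2, ← hθ, hr w]
        exact hk
    · refine ⟨∅, empty_subset _, finite_empty, by simp, ?_⟩
      intro w hw hk
      refine absurd ⟨θ' w, hw, ?_⟩ hn
      have h2 := siegelHeight_heis (Real.sqrt (siegelHeight q)) (zPart n q) (ζPart n q).im (θ' w)
      rw [Real.sq_sqrt hq'.le] at h2
      rw [mem_ofPred_eq, ← h2, ← hθ, hr w]
      exact hk

/-- A cusp uniformized by the Siegel domain has a system of quasi-coordinates: the dilations and
Heisenberg translations move every point to the base point by an isometry, so that a fixed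
neighbourhood of the base point serves at all points near the cusp. -/
theorem exists_quasiCoordinateSystem {k : ℝ} (hk : 0 < k) :
    ∃ (U : Set M) (Γ : Set (QuasiCoordinate I (n + 1)
        {x : M | 0 < ρ x ∧ ρ x < Real.exp (-k)})),
      IsQuasiCoordinateSystem I {x | ρ x = 0} {x | 0 < ρ x ∧ ρ x < Real.exp (-k)} U
        hP.inducedMetric Γ ∧
      ∃ (T : Set (CSpace (n + 1))) (ε : ℝ), Bornology.IsBounded T ∧ 0 < ε ∧
        ∀ x ∈ U, ∃ β ∈ Γ, β.domain = T ∧ ∃ y ∈ T, β.map y = x ∧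
          ENNReal.ofReal ε ≤ Metric.infEDist y (frontier T) := by
  set b := siegelBase n with hb
  -- On the chosen neighbourhood of the base point the height exceeds `1 / 2`.
  obtain ⟨δ, hδ, hball⟩ : ∃ δ > 0, Metric.closedBall b δ ⊆ {v | 1 / 2 < siegelHeight v} := by
    refine Metric.nhds_basis_closedBall.mem_iff.mp ?_
    refine (isOpen_lt continuous_const continuous_siegelHeight).mem_nhds ?_
    rw [mem_ofPred_eq, hb, siegelHeight_base]
    norm_num
  set T := Metric.ball b δ with hT
  have hTS : Metric.closedBall b δ ⊆ siegelDomain n := fun v hv => by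
    have h : 1 / 2 < siegelHeight v := hball hv
    exact lt_trans (by norm_num) h
  have hTS' : T ⊆ siegelDomain n := Metric.ball_subset_closedBall.trans hTS
  have hbT : b ∈ T := Metric.mem_ball_self hδ
  have hdist : ENNReal.ofReal δ ≤ Metric.infEDist b (frontier T) := by
    refine Metric.le_infEDist.mpr fun z hz => ?_
    have hz' : dist z b = δ := Metric.frontier_ball_subset_sphere hz
    rw [edist_comm, edist_dist, hz']
  set U : Set M := {x | 0 < ρ x ∧ ρ x < Real.exp (-(2 * k))} with hU
  set Γ := hP.charts k T with hΓ
  -- The dilations and translations are isometries, so all charts see the metric of the Siegel domain.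
  have hmetric : ∀ α ∈ Γ, ∀ v ∈ siegelDomain n,
      metricTensor I hP.inducedMetric α.map v = siegelMetric v := by
    rintro α ⟨-, t, l, c, ht, hmap⟩ v hv
    rw [hmap, hP.metricTensor_heis ht l c hv]
  -- A point of `U` has height `r > k`, and the dilation by `√r` moves `T` to heights above `k / 2`.
  have hbase : ∀ x ∈ U, ∃ β ∈ Γ, β.domain = T ∧ β.map b = x := by
    intro x hx
    obtain ⟨p, rfl⟩ := hP.exists_eq x hx.1
    have hp : k < siegelHeight p := by
      have := (hP.mem_disc_iff _ p).mp hx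
      linarith
    have hpS : p ∈ siegelDomain n := hk.trans hp
    have hsub : T ⊆ {v | k / 2 < siegelHeight p * siegelHeight v} := fun v hv => by
      have h : 1 / 2 < siegelHeight v := hball (Metric.ball_subset_closedBall hv)
      rw [mem_ofPred_eq]
      nlinarith
    have hinter := inter_eq_left.mpr hsub
    obtain ⟨α, hα, hdom, hmap⟩ := hP.exists_chart (k := k) (Subset.refl T) Metric.isOpen_ball
      (convex_ball _ _) hpS (by
        rw [hinter]
        exact ⟨b, hbT⟩)
    refine ⟨α, hα, hdom.trans hinter, ?_⟩
    rw [hmap, Function.comp_apply, hb, heis_base hpS]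
  have hclosed := isCompact_closedBall b δ
  refine ⟨U, Γ, ?_, T, δ, Metric.isBounded_ball, hδ, fun x hx => ?_⟩
  swap
  · obtain ⟨β, hβ, hdom, hmap⟩ := hbase x hx
    exact ⟨β, hβ, hdom, b, hbT, hmap, hdist⟩
  refine ⟨?_, ?_, ?_, ?_, ?_, ?_, ?_, ?_⟩
  · refine Subset.antisymm (fun x hx => ?_) (iUnion₂_subset fun α _ => α.mapsTo.image_subset)
    obtain ⟨p, rfl⟩ := hP.exists_eq x hx.1
    have hp : k / 2 < siegelHeight p := (hP.mem_disc_iff _ p).mp hx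
    have hpS : p ∈ siegelDomain n := lt_trans (by linarith) hp
    have hbV : b ∈ T ∩ {v | k / 2 < siegelHeight p * siegelHeight v} := ⟨hbT, by
      rw [mem_ofPred_eq, hb, siegelHeight_base, mul_one]
      exact hp⟩
    obtain ⟨α, hα, hdom, hmap⟩ := hP.exists_chart (k := k) (Subset.refl T) Metric.isOpen_ball
      (convex_ball _ _) hpS ⟨b, hbV⟩
    refine mem_iUnion₂.mpr ⟨α, hα, b, hdom ▸ hbV, ?_⟩
    rw [hmap, Function.comp_apply, hb, heis_base hpS]
  · refine ⟨hP.isOpen_disc _, ?_, ?_⟩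
    · rw [disjoint_left]
      rintro x ⟨hx, -⟩ h0
      exact hx.ne' h0
    · have hunion : U ∪ {x | ρ x = 0} = {x | ρ x < Real.exp (-(2 * k))} := by
        refine Subset.antisymm ?_ fun x hx => ?_
        · rintro x (hx | hx)
          · exact hx.2
          · rw [mem_ofPred_eq] at hx ⊢
            rw [hx]
            exact Real.exp_pos _
        · rcases (hP.rho_nonneg x).eq_or_lt with h | h
          · exact Or.inr h.symm
          · exact Or.inl ⟨h, hx⟩
      rw [hunion]
      exact isOpen_lt hP.continuous_rho continuous_const
  · rintro x ⟨h1, h2⟩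
    exact ⟨h1, h2.trans (Real.exp_lt_exp.mpr (by linarith))⟩
  -- The rest of the disc bundle is the image of a compact part of the slab `k / 2 ≤ r ≤ k`.
  · obtain ⟨K, hK, hcov⟩ := hP.cocompact
    have hK' := isCompact_slab hK (k / 2) k
    obtain ⟨F, h1, h2, h3, h4⟩ := hP.exists_finite_charts (k := k)
      (Metric.isOpen_ball.mem_nhds hbT : T ∈ 𝓝 b) hK' fun q hq =>
        show 0 < siegelHeight q from lt_of_lt_of_le (by linarith) hq.2.2.1
    refine ⟨F, h1, h2, h3, ?_⟩
    rintro x ⟨hx, hxU⟩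
    obtain ⟨p, rfl⟩ := hP.exists_eq x hx.1
    obtain ⟨q, hqp, hqK, hqI⟩ := hcov p
    rw [← hqp] at hx hxU ⊢
    have hq1 := (hP.mem_disc_iff k q).mp hx
    have hq2 : siegelHeight q ≤ k := by
      by_contra! h
      exact hxU ((hP.mem_disc_iff (2 * k) q).mpr (by linarith))
    exact h4 q ⟨hqK, hqI, hq1.le, hq2⟩ hq1
  · refine ⟨δ, hδ, fun x hx => ?_⟩
    obtain ⟨β, hβ, hdom, hmap⟩ := hbase x hx
    exact ⟨β, hβ, b, hdom ▸ hbT, hmap, hdom ▸ hdist⟩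
  · intro α hα i j
    refine ((contDiffOn_siegelMetric i j).mono (hα.1.trans hTS')).congr fun v hv => ?_
    rw [hmetric α hα v (hTS' (hα.1 hv))]
  · obtain ⟨c, hc, h⟩ := exists_uniform_equiv hclosed (G := siegelMetric)
      (fun i j => (contDiffOn_siegelMetric i j).continuousOn.mono hTS)
      fun p hp => posDef_siegelMetric (hTS hp)
    refine ⟨c, hc, fun α hα v hv => ?_⟩
    rw [hmetric α hα v (hTS' (hα.1 hv))]
    exact h v (Metric.ball_subset_closedBall (hα.1 hv))
  · obtain ⟨B, hB⟩ := exists_uniform_deriv_bound hclosed isOpen_siegelDomain hTS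
      (G := siegelMetric) contDiffOn_siegelMetric
    refine ⟨B, fun α hα v hv p q i j => ?_⟩
    have hev : (fun w => metricTensor I hP.inducedMetric α.map w i j) =ᶠ[𝓝 v]
        fun w => siegelMetric w i j := by
      filter_upwards [isOpen_siegelDomain.mem_nhds (hTS' (hα.1 hv))] with w hw
      rw [hmetric α hα w hw]
    rw [(mixedDeriv_congr hev p q).self_of_nhds]
    exact hB v (Metric.ball_subset_closedBall (hα.1 hv)) p q i j

end IsCuspUniformization

end Cusp

/-! ### Holomorphic maps from `ℂᵐ` to a complex manifold -/

section LocalBiholomorphism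

variable {m : ℕ} {E : Type*} [NormedAddCommGroup E] [NormedSpace ℂ E]
  {H : Type*} [TopologicalSpace H] {I : ModelWithCorners ℂ E H} [I.Boundaryless]
  {M : Type*} [TopologicalSpace M] [ChartedSpace H M] [IsManifold I 1 M]
  {f : CSpace m → M} {x : CSpace m}

lemma eventually_differentiableAt_extChartAt_comp
    (hf : ∀ᶠ w in 𝓝 x, MDifferentiableAt 𝓘(ℂ, CSpace m) I f w) :
    ∀ᶠ w in 𝓝 x, DifferentiableAt ℂ (extChartAt I (f x) ∘ f) w := by
  have h1 : ∀ᶠ w in 𝓝 x, f w ∈ (chartAt H (f x)).source :=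
    hf.self_of_nhds.continuousAt.eventually ((chartAt H (f x)).open_source.mem_nhds
      (mem_chart_source H (f x)))
  filter_upwards [hf, h1] with w hw hw'
  exact ((mdifferentiableAt_iff_target_of_mem_source hw').mp hw).2.differentiableAt

lemma fderiv_extChartAt_comp (hf : MDifferentiableAt 𝓘(ℂ, CSpace m) I f x) :
    fderiv ℂ (extChartAt I (f x) ∘ f) x = mfderiv 𝓘(ℂ, CSpace m) I f x := by
  rw [hf.mfderiv]
  simp only [ModelWithCorners.range_eq_univ, fderivWithin_univ]
  rfl

/-- In a chart, a holomorphic map with bijective differential coincides with a local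
diffeomorphism. -/
lemma exists_local_inverse [CompleteSpace E]
    (hf : ∀ᶠ w in 𝓝 x, MDifferentiableAt 𝓘(ℂ, CSpace m) I f w)
    (hb : Function.Bijective (mfderiv 𝓘(ℂ, CSpace m) I f x)) :
    ∃ Θ : OpenPartialHomeomorph (CSpace m) E, x ∈ Θ.source ∧ (Θ : CSpace m → E) =
      extChartAt I (f x) ∘ f ∧ ContDiffAt ℂ ∞ Θ.symm (Θ x) := by
  set g := extChartAt I (f x) ∘ f with hg
  have hd := eventually_differentiableAt_extChartAt_comp hf
  have hc : ContDiffAt ℂ ∞ g x := contDiffAt_of_eventually_differentiableAt hd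
  have hb' : Function.Bijective (fderiv ℂ g x) := by
    rw [hg, fderiv_extChartAt_comp hf.self_of_nhds]
    exact hb
  let L : CSpace m ≃L[ℂ] E := ContinuousLinearEquiv.ofBijective (fderiv ℂ g x)
    (LinearMap.ker_eq_bot.mpr hb'.1) (LinearMap.range_eq_top.mpr hb'.2)
  have hL : HasFDerivAt g (L : CSpace m →L[ℂ] E) x := hd.self_of_nhds.hasFDerivAt
  exact ⟨hc.toOpenPartialHomeomorph g hL (by simp),
    hc.mem_toOpenPartialHomeomorph_source hL (by simp), rfl, hc.to_localInverse hL (by simp)⟩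

lemma isLocallyInjective_of_bijective_mfderiv [CompleteSpace E]
    (hf : MDifferentiable 𝓘(ℂ, CSpace m) I f)
    (hb : ∀ x, Function.Bijective (mfderiv 𝓘(ℂ, CSpace m) I f x)) : IsLocallyInjective f := by
  intro x
  obtain ⟨Θ, hx, hΘ, -⟩ := exists_local_inverse (Filter.Eventually.of_forall hf) (hb x)
  refine ⟨Θ.source, Θ.open_source, hx, fun a ha b hb hab => Θ.injOn ha hb ?_⟩
  rw [hΘ, Function.comp_apply, Function.comp_apply, hab]

lemma isOpenMap_of_bijective_mfderiv [CompleteSpace E]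
    (hf : MDifferentiable 𝓘(ℂ, CSpace m) I f)
    (hb : ∀ x, Function.Bijective (mfderiv 𝓘(ℂ, CSpace m) I f x)) : IsOpenMap f := by
  refine isOpenMap_iff_nhds_le.mpr fun x => ?_
  obtain ⟨Θ, hx, hΘ, -⟩ := exists_local_inverse (Filter.Eventually.of_forall hf) (hb x)
  have h1 : Filter.map (extChartAt I (f x) ∘ f) (𝓝 x) = 𝓝 (extChartAt I (f x) (f x)) := by
    rw [← hΘ, Θ.map_nhds_eq hx, hΘ]
    rfl
  have h2 : Filter.map (extChartAt I (f x)) (𝓝 (f x)) = 𝓝 (extChartAt I (f x) (f x)) :=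
    map_extChartAt_nhds_of_boundaryless (f x)
  have h3 : (extChartAt I (f x)).symm ∘ (extChartAt I (f x) ∘ f) =ᶠ[𝓝 x] f := by
    filter_upwards [(hf x).continuousAt.eventually (extChartAt_source_mem_nhds (I := I) (f x))]
      with w hw
    exact (extChartAt I (f x)).left_inv hw
  have h4 : (extChartAt I (f x)).symm ∘ extChartAt I (f x) =ᶠ[𝓝 (f x)] id := by
    filter_upwards [extChartAt_source_mem_nhds (I := I) (f x)] with w hw
    exact (extChartAt I (f x)).left_inv hw
  rw [← Filter.map_congr h3, ← Filter.map_map, h1, ← h2, Filter.map_map, Filter.map_congr h4,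
    Filter.map_id]

variable {IR : ModelWithCorners ℝ E H} [IR.Boundaryless] {u : M → ℝ}

lemma contDiffAt_comp_of_contMDiffAt [CompleteSpace E]
    (hIR : ∀ y : M, extChartAt IR y = extChartAt I y)
    (hu : ContMDiffAt IR 𝓘(ℝ, ℝ) ∞ u (f x))
    (hf : ∀ᶠ w in 𝓝 x, MDifferentiableAt 𝓘(ℂ, CSpace m) I f w) :
    ContDiffAt ℝ ∞ (u ∘ f) x := by
  have h1 := (contMDiffAt_iff.mp hu).2
  rw [hIR, ModelWithCorners.range_eq_univ, contDiffWithinAt_univ] at h1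
  have h2 : ContDiffAt ℝ ∞ (extChartAt I (f x) ∘ f) x :=
    (contDiffAt_of_eventually_differentiableAt
      (eventually_differentiableAt_extChartAt_comp hf)).restrict_scalars ℝ
  refine (h1.comp x h2).congr_of_eventuallyEq ?_
  filter_upwards [hf.self_of_nhds.continuousAt.eventually
    (extChartAt_source_mem_nhds (I := I) (f x))] with w hw
  simp only [Function.comp_apply, (extChartAt I (f x)).left_inv hw]
  rfl

/-- A function on `M` is smooth as soon as its pullback by a local biholomorphism is. -/
lemma contMDiffAt_of_contDiffAt_comp [CompleteSpace E]
    (hIR : ∀ y : M, extChartAt IR y = extChartAt I y)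
    (hf : ∀ᶠ w in 𝓝 x, MDifferentiableAt 𝓘(ℂ, CSpace m) I f w)
    (hb : Function.Bijective (mfderiv 𝓘(ℂ, CSpace m) I f x))
    (hu : ContDiffAt ℝ ∞ (u ∘ f) x) (huc : ContinuousAt u (f x)) :
    ContMDiffAt IR 𝓘(ℝ, ℝ) ∞ u (f x) := by
  refine contMDiffAt_iff.mpr ⟨huc, ?_⟩
  rw [hIR, ModelWithCorners.range_eq_univ, contDiffWithinAt_univ]
  obtain ⟨Θ, hx, hΘ, hs⟩ := exists_local_inverse hf hb
  have hΘx : extChartAt I (f x) (f x) = Θ x := by rw [hΘ]; rfl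
  rw [hΘx]
  have h1 : ContDiffAt ℝ ∞ (u ∘ f) (Θ.symm (Θ x)) := by rwa [Θ.left_inv hx]
  refine (h1.comp _ (hs.restrict_scalars ℝ)).congr_of_eventuallyEq ?_
  have hc : ContinuousAt Θ.symm (Θ x) := Θ.continuousAt_symm (Θ.map_source hx)
  have hc' : Filter.Tendsto Θ.symm (𝓝 (Θ x)) (𝓝 x) := by
    have := hc.tendsto
    rwa [Θ.left_inv hx] at this
  filter_upwards [Θ.open_target.mem_nhds (Θ.map_source hx), hc'.eventually
    (hf.self_of_nhds.continuousAt.eventually (extChartAt_source_mem_nhds (I := I) (f x)))]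
    with w hw hw'
  have h2 : extChartAt I (f x) (f (Θ.symm w)) = w := by
    have := Θ.right_inv hw
    rwa [hΘ] at this
  simp only [Function.comp_apply]
  conv_lhs => rw [← h2, (extChartAt I (f x)).left_inv hw']
  rfl

end LocalBiholomorphism

/-! ### Holomorphic sections of the pull-back of a line bundle -/

section Sections

variable {n : ℕ} {A : Type*} [TopologicalSpace A] [ChartedSpace (CSpace n) A]
  {N : A → Type*} [TopologicalSpace (TotalSpace ℂ N)] [∀ x, TopologicalSpace (N x)]
  [∀ x, AddCommGroup (N x)] [∀ x, Module ℂ (N x)]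

/-- Multiplication by scalars in the fibres, as an operation on the total space. -/
def fiberSMul (c : ℂ) (v : TotalSpace ℂ N) : TotalSpace ℂ N := ⟨v.proj, c • v.2⟩

@[simp] lemma fiberSMul_one (v : TotalSpace ℂ N) : fiberSMul 1 v = v := by
  simp [fiberSMul]

lemma fiberSMul_fiberSMul (a b : ℂ) (v : TotalSpace ℂ N) :
    fiberSMul a (fiberSMul b v) = fiberSMul (a * b) v := by
  exact congrArg (TotalSpace.mk v.proj) (smul_smul a b v.2)

lemma fiberSMul_ne_zero {c : ℂ} {v : TotalSpace ℂ N} (hc : c ≠ 0) (hv : v.2 ≠ 0) :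
    (fiberSMul c v).2 ≠ 0 := smul_ne_zero hc hv

variable [FiberBundle ℂ N]

/-- The fibre coordinate in the preferred trivialization at `b`. -/
def fiberCoord (b : A) (v : TotalSpace ℂ N) : ℂ := (trivializationAt ℂ N b v).2

variable [VectorBundle ℂ ℂ N]

lemma fiberCoord_eq {b : A} {v : TotalSpace ℂ N} (hv : v.proj ∈ (trivializationAt ℂ N b).baseSet) :
    fiberCoord b v = (trivializationAt ℂ N b).continuousLinearEquivAt ℂ v.proj hv v.2 := rfl

lemma fiberCoord_fiberSMul {b : A} {v : TotalSpace ℂ N}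
    (hv : v.proj ∈ (trivializationAt ℂ N b).baseSet) (c : ℂ) :
    fiberCoord b (fiberSMul c v) = c * fiberCoord b v := by
  rw [fiberCoord_eq hv, ← smul_eq_mul, ← map_smul]
  rfl

lemma fiberCoord_ne_zero_iff {b : A} {v : TotalSpace ℂ N}
    (hv : v.proj ∈ (trivializationAt ℂ N b).baseSet) : fiberCoord b v ≠ 0 ↔ v.2 ≠ 0 := by
  rw [fiberCoord_eq hv, Ne, EmbeddingLike.map_eq_zero_iff]

lemma eq_fiberSMul {b : A} {v w : TotalSpace ℂ N}
    (hv : v.proj ∈ (trivializationAt ℂ N b).baseSet) (hp : w.proj = v.proj) (h0 : v.2 ≠ 0) :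
    w = fiberSMul (fiberCoord b w / fiberCoord b v) v := by
  obtain ⟨x, v⟩ := v
  obtain ⟨y, w⟩ := w
  obtain rfl : y = x := hp
  have h1 : fiberCoord b (⟨y, w⟩ : TotalSpace ℂ N) =
      fiberCoord b (fiberSMul (fiberCoord b (⟨y, w⟩ : TotalSpace ℂ N) / fiberCoord b ⟨y, v⟩)
        ⟨y, v⟩) := by
    rw [fiberCoord_fiberSMul hv, div_mul_cancel₀ _ ((fiberCoord_ne_zero_iff hv).mpr h0)]
  have h2 := ((trivializationAt ℂ N b).continuousLinearEquivAt ℂ y hv).injective h1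
  exact congrArg (TotalSpace.mk y) h2

lemma fiberSMul_injective {v : TotalSpace ℂ N} (h0 : v.2 ≠ 0) {a b : ℂ}
    (h : fiberSMul a v = fiberSMul b v) : a = b := by
  have hv := FiberBundle.mem_baseSet_trivializationAt' (F := ℂ) (E := N) v.proj
  have h1 := congrArg (fiberCoord v.proj) h
  rw [fiberCoord_fiberSMul hv, fiberCoord_fiberSMul hv] at h1
  exact mul_right_cancel₀ ((fiberCoord_ne_zero_iff hv).mpr h0) h1

/-- Two nonzero vectors of the same fibre are proportional. -/
lemma exists_fiberSMul_eq {v w : TotalSpace ℂ N} (hp : w.proj = v.proj) (h0 : v.2 ≠ 0)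
    (hw : w.2 ≠ 0) : ∃ c : ℂ, c ≠ 0 ∧ w = fiberSMul c v := by
  have hv := FiberBundle.mem_baseSet_trivializationAt' (F := ℂ) (E := N) v.proj
  refine ⟨_, div_ne_zero ?_ ?_, eq_fiberSMul hv hp h0⟩
  · exact (fiberCoord_ne_zero_iff (hp ▸ hv)).mpr hw
  · exact (fiberCoord_ne_zero_iff hv).mpr h0

lemma mdifferentiableAt_iff_fiberCoord [IsManifold 𝓘(ℂ, CSpace n) ω A]
    [ContMDiffVectorBundle ω ℂ N 𝓘(ℂ, CSpace n)] {l : ℕ} {s : CSpace l → TotalSpace ℂ N}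
    {z : CSpace l} {b : A} (hb : (s z).proj ∈ (trivializationAt ℂ N b).baseSet) :
    MDifferentiableAt 𝓘(ℂ, CSpace l) (𝓘(ℂ, CSpace n).prod 𝓘(ℂ, ℂ)) s z ↔
      MDifferentiableAt 𝓘(ℂ, CSpace l) 𝓘(ℂ, CSpace n) (fun w => (s w).proj) z ∧
      DifferentiableAt ℂ (fun w => fiberCoord b (s w)) z := by
  have : IsManifold 𝓘(ℂ, CSpace n) 1 A := IsManifold.of_le (n := ω) le_top
  have : ContMDiffVectorBundle 1 ℂ N 𝓘(ℂ, CSpace n) := ContMDiffVectorBundle.of_le (n := ω) le_top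
  rw [(trivializationAt ℂ N b).mdifferentiableAt_totalSpace_iff 𝓘(ℂ, CSpace n) s
    ((trivializationAt ℂ N b).mem_source.mpr hb), mdifferentiableAt_iff_differentiableAt]
  rfl

variable [IsManifold 𝓘(ℂ, CSpace n) ω A] [ContMDiffVectorBundle ω ℂ N 𝓘(ℂ, CSpace n)]

lemma MDifferentiableAt.fiberSMul {l : ℕ} {s : CSpace l → TotalSpace ℂ N} {z : CSpace l}
    {h : CSpace l → ℂ}
    (hs : MDifferentiableAt 𝓘(ℂ, CSpace l) (𝓘(ℂ, CSpace n).prod 𝓘(ℂ, ℂ)) s z)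
    (hh : DifferentiableAt ℂ h z) :
    MDifferentiableAt 𝓘(ℂ, CSpace l) (𝓘(ℂ, CSpace n).prod 𝓘(ℂ, ℂ))
      (fun w => fiberSMul (h w) (s w)) z := by
  have hb := FiberBundle.mem_baseSet_trivializationAt' (F := ℂ) (E := N) (s z).proj
  have h1 := (mdifferentiableAt_iff_fiberCoord hb).mp hs
  refine (mdifferentiableAt_iff_fiberCoord (s := fun w => _root_.fiberSMul (h w) (s w)) hb).mpr
    ⟨h1.1, ?_⟩
  refine (hh.fun_mul h1.2).congr_of_eventuallyEq ?_
  filter_upwards [h1.1.continuousAt.eventually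
    ((trivializationAt ℂ N (s z).proj).open_baseSet.mem_nhds hb)] with w hw
  exact fiberCoord_fiberSMul hw _

/-- The quotient of two holomorphic sections is holomorphic. -/
lemma differentiableAt_of_eq_fiberSMul {l : ℕ} {s s' : CSpace l → TotalSpace ℂ N} {z : CSpace l}
    {h : CSpace l → ℂ}
    (hs : MDifferentiableAt 𝓘(ℂ, CSpace l) (𝓘(ℂ, CSpace n).prod 𝓘(ℂ, ℂ)) s z)
    (hs' : MDifferentiableAt 𝓘(ℂ, CSpace l) (𝓘(ℂ, CSpace n).prod 𝓘(ℂ, ℂ)) s' z)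
    (h0 : (s z).2 ≠ 0) (hh : ∀ᶠ w in 𝓝 z, s' w = fiberSMul (h w) (s w)) :
    DifferentiableAt ℂ h z := by
  have hb := FiberBundle.mem_baseSet_trivializationAt' (F := ℂ) (E := N) (s z).proj
  have h1 := (mdifferentiableAt_iff_fiberCoord hb).mp hs
  have hb' : (s' z).proj ∈ (trivializationAt ℂ N (s z).proj).baseSet := by
    rw [hh.self_of_nhds]
    exact hb
  have h2 := (mdifferentiableAt_iff_fiberCoord hb').mp hs'
  have h0' := (fiberCoord_ne_zero_iff hb).mpr h0
  refine (h2.2.fun_mul (h1.2.fun_inv h0')).congr_of_eventuallyEq ?_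
  filter_upwards [h1.1.continuousAt.eventually
    ((trivializationAt ℂ N (s z).proj).open_baseSet.mem_nhds hb), hh,
    h1.2.continuousAt.eventually_ne h0'] with w hw hw' hw0
  rw [hw', fiberCoord_fiberSMul hw, mul_inv_cancel_right₀ hw0]

lemma IsLocalFrame.mdifferentiableAt {pr : CSpace n → A} {O : Set (CSpace n)}
    {s : CSpace n → TotalSpace ℂ N} (hs : IsLocalFrame pr O s) {z : CSpace n} (hz : z ∈ O) :
    MDifferentiableAt 𝓘(ℂ, CSpace n) (𝓘(ℂ, CSpace n).prod 𝓘(ℂ, ℂ)) s z :=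
  (hs.holomorphic z hz).mdifferentiableAt (hs.isOpen.mem_nhds hz)

/-- Around every point there is a frame of the pull-back of a line bundle. -/
lemma exists_isLocalFrame {pr : CSpace n → A}
    (hpr : MDifferentiable 𝓘(ℂ, CSpace n) 𝓘(ℂ, CSpace n) pr) (z : CSpace n) :
    ∃ (O : Set (CSpace n)) (s : CSpace n → TotalSpace ℂ N), z ∈ O ∧ IsLocalFrame pr O s := by
  set e := trivializationAt ℂ N (pr z) with he
  have h1 : ∀ w ∈ pr ⁻¹' e.baseSet,
      fiberCoord (pr z) (⟨pr w, e.symm (pr w) 1⟩ : TotalSpace ℂ N) = 1 := fun w hw => by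
    rw [fiberCoord, ← he, e.apply_mk_symm hw]
  have hO : IsOpen (pr ⁻¹' e.baseSet) := e.open_baseSet.preimage hpr.continuous
  refine ⟨pr ⁻¹' e.baseSet, fun w => ⟨pr w, e.symm (pr w) 1⟩,
    FiberBundle.mem_baseSet_trivializationAt' _, hO, fun w hw => ?_, fun _ _ => rfl,
    fun w hw => ?_⟩
  · refine MDifferentiableAt.mdifferentiableWithinAt ?_
    refine (mdifferentiableAt_iff_fiberCoord (b := pr z)
      (s := fun w => (⟨pr w, e.symm (pr w) 1⟩ : TotalSpace ℂ N)) hw).mpr ⟨hpr w, ?_⟩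
    refine (differentiableAt_const (1 : ℂ)).congr_of_eventuallyEq ?_
    filter_upwards [hO.mem_nhds hw] with w' hw'
    exact h1 w' hw'
  · refine (fiberCoord_ne_zero_iff (b := pr z)
      (v := (⟨pr w, e.symm (pr w) 1⟩ : TotalSpace ℂ N)) hw).mp ?_
    rw [h1 w hw]
    exact one_ne_zero

/-- The transition function between two frames. -/
lemma IsLocalFrame.exists_ratio {pr : CSpace n → A} {O O' : Set (CSpace n)}
    {s s' : CSpace n → TotalSpace ℂ N} (hs : IsLocalFrame pr O s) (hs' : IsLocalFrame pr O' s') :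
    ∃ h : CSpace n → ℂ, DifferentiableOn ℂ h (O ∩ O') ∧
      ∀ z ∈ O ∩ O', h z ≠ 0 ∧ s' z = fiberSMul (h z) (s z) := by
  have key : ∀ z, ∃ c : ℂ, z ∈ O ∩ O' → c ≠ 0 ∧ s' z = fiberSMul c (s z) := fun z => by
    by_cases hz : z ∈ O ∩ O'
    · obtain ⟨c, hc⟩ := exists_fiberSMul_eq
        ((hs'.proj_eq z hz.2).trans (hs.proj_eq z hz.1).symm) (hs.ne_zero z hz.1)
        (hs'.ne_zero z hz.2)
      exact ⟨c, fun _ => hc⟩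
    · exact ⟨0, fun h => absurd h hz⟩
  choose h hh using key
  refine ⟨h, fun z hz => DifferentiableAt.differentiableWithinAt ?_, hh⟩
  refine differentiableAt_of_eq_fiberSMul (hs.mdifferentiableAt hz.1) (hs'.mdifferentiableAt hz.2)
    (hs.ne_zero z hz.1) ?_
  filter_upwards [(hs.isOpen.inter hs'.isOpen).mem_nhds hz] with w hw
  exact (hh w hw).2

/-! ### Hermitian metrics on line bundles -/

variable {ρ : TotalSpace ℂ N → ℝ}


/-- A smooth function on the total space is smooth along holomorphic maps. -/
lemma contDiffAt_comp_holomorphic {l : ℕ}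
    (hρ : ContMDiff (𝓘(ℝ, CSpace n).prod 𝓘(ℝ, ℂ)) 𝓘(ℝ, ℝ) ∞ ρ) {s : CSpace l → TotalSpace ℂ N}
    {z : CSpace l} (hs : ∀ᶠ w in 𝓝 z,
      MDifferentiableAt 𝓘(ℂ, CSpace l) (𝓘(ℂ, CSpace n).prod 𝓘(ℂ, ℂ)) s w) :
    ContDiffAt ℝ ∞ (ρ ∘ s) z := by
  have : IsManifold 𝓘(ℂ, CSpace n) 1 A := IsManifold.of_le (n := ω) le_top
  have : ContMDiffVectorBundle 1 ℂ N 𝓘(ℂ, CSpace n) := ContMDiffVectorBundle.of_le (n := ω) le_top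
  exact contDiffAt_comp_of_contMDiffAt (I := 𝓘(ℂ, CSpace n).prod 𝓘(ℂ, ℂ))
    (fun _ => rfl) (hρ (s z)) hs

namespace IsHermitianMetric

variable (hρ : IsHermitianMetric n ρ)
include hρ

lemma apply_fiberSMul (c : ℂ) (v : TotalSpace ℂ N) : ρ (fiberSMul c v) = ‖c‖ ^ 2 * ρ v :=
  hρ.smul v.proj c v.2

lemma apply_pos {v : TotalSpace ℂ N} (hv : v.2 ≠ 0) : 0 < ρ v := hρ.pos v.proj v.2 hv

lemma apply_zero {v : TotalSpace ℂ N} (hv : v.2 = 0) : ρ v = 0 := by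
  have h := hρ.apply_fiberSMul 0 v
  have h1 : fiberSMul 0 v = v := by
    refine congrArg (TotalSpace.mk v.proj) ?_
    rw [zero_smul, hv]
  rw [h1] at h
  simpa using h

lemma apply_nonneg (v : TotalSpace ℂ N) : 0 ≤ ρ v := by
  by_cases hv : v.2 = 0
  · rw [hρ.apply_zero hv]
  · exact (hρ.apply_pos hv).le

lemma zeroSectionSet_eq : zeroSectionSet N = {v | ρ v = 0} := by
  refine Set.ext fun v => ⟨hρ.apply_zero, fun h => ?_⟩
  by_contra hv
  exact (hρ.apply_pos hv).ne' h

lemma contDiffAt_log {pr : CSpace n → A} {O : Set (CSpace n)} {s : CSpace n → TotalSpace ℂ N}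
    (hs : IsLocalFrame pr O s) {z : CSpace n} (hz : z ∈ O) :
    ContDiffAt ℝ ∞ (fun w => Real.log (ρ (s w))) z := by
  refine (contDiffAt_comp_holomorphic hρ.smooth ?_).log
    (hρ.apply_pos (hs.ne_zero z hz)).ne'
  filter_upwards [hs.isOpen.mem_nhds hz] with w hw
  exact hs.mdifferentiableAt hw

/-- The curvature does not depend on the frame. -/
lemma complexHessian_log_eq {pr : CSpace n → A} {O O' : Set (CSpace n)}
    {s s' : CSpace n → TotalSpace ℂ N} (hs : IsLocalFrame pr O s) (hs' : IsLocalFrame pr O' s')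
    {z : CSpace n} (hz : z ∈ O) (hz' : z ∈ O') :
    complexHessian (fun w => Real.log (ρ (s' w))) z =
      complexHessian (fun w => Real.log (ρ (s w))) z := by
  obtain ⟨h, hd, hh⟩ := hs.exists_ratio hs'
  have hO := (hs.isOpen.inter hs'.isOpen)
  have hd' : ∀ᶠ w in 𝓝 z, DifferentiableAt ℂ h w := by
    filter_upwards [hO.mem_nhds ⟨hz, hz'⟩] with w hw
    exact hd.differentiableAt (hO.mem_nhds hw)
  have h0 := (hh z ⟨hz, hz'⟩).1
  have h1 : (fun w => Real.log (ρ (s' w))) =ᶠ[𝓝 z]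
      fun w => Real.log (‖h w‖ ^ 2) + Real.log (ρ (s w)) := by
    filter_upwards [hO.mem_nhds ⟨hz, hz'⟩] with w hw
    rw [(hh w hw).2, hρ.apply_fiberSMul, Real.log_mul
      (pow_ne_zero 2 (norm_ne_zero_iff.mpr (hh w hw).1)) (hρ.apply_pos (hs.ne_zero w hw.1)).ne']
  rw [complexHessian_congr h1, complexHessian_add (contDiffAt_log_norm_sq hd' h0)
    (hρ.contDiffAt_log hs hz), complexHessian_log_norm_sq hd' h0, zero_add]

end IsHermitianMetric

end Sections

/-! ### Pluriharmonic functions -/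

section Pluriharmonic

variable {m : ℕ}

/-- A real-differentiable function that satisfies the Cauchy-Riemann equations is holomorphic. -/
lemma hasFDerivAt_of_dAnti_eq_zero {f : CSpace m → ℂ} {v : CSpace m}
    (hf : DifferentiableAt ℝ f v) (h : ∀ i, dAnti i f v = 0) :
    HasFDerivAt f (∑ i, dHol i f v • (EuclideanSpace.proj i : CSpace m →L[ℂ] ℂ)) v := by
  refine hasFDerivAt_of_restrictScalars ℝ hf.hasFDerivAt ?_
  ext x
  rw [fderiv_eq_sum_wirtinger]
  simp [h, mul_comm]

/-- On a convex open set, a pluriharmonic function is the real part of a holomorphic one, namely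
of a primitive of the closed form `2 ∂u`. -/
theorem exists_re_eq_of_complexHessian_eq_zero {s : Set (CSpace m)} (hs : IsOpen s)
    (hc : Convex ℝ s) {u : CSpace m → ℝ} (hu : ∀ v ∈ s, ContDiffAt ℝ ∞ u v)
    (h0 : ∀ v ∈ s, complexHessian u v = 0) :
    ∃ f : CSpace m → ℂ, DifferentiableOn ℂ f s ∧ ∀ v ∈ s, (f v).re = u v := by
  set U : CSpace m → ℂ := fun w => (u w : ℂ) with hU
  have hU' : ∀ v ∈ s, ContDiffAt ℝ ∞ U v := fun v hv => (hu v hv).ofReal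
  have hdh : ∀ v ∈ s, ∀ i, ContDiffAt ℝ ∞ (dHol i U) v := fun v hv i => by
    rw [dHol_eq_wirtinger]
    exact ContDiffAt.wirtinger (hU' v hv)
  -- By hypothesis the coefficients of `2 ∂u` are holomorphic, and the form is closed.
  have hanti : ∀ v ∈ s, ∀ i j, dAnti j (dHol i U) v = 0 := fun v hv i j => by
    rw [dAnti_eq_wirtinger, dHol_eq_wirtinger, wirtinger_comm (hU' v hv), ← dAnti_eq_wirtinger,
      ← dHol_eq_wirtinger]
    exact congrFun (congrFun (h0 v hv) i) j
  set η : CSpace m → CSpace m →L[ℂ] ℂ := fun v =>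
    ∑ i, (2 * dHol i U v) • (EuclideanSpace.proj i : CSpace m →L[ℂ] ℂ) with hη
  have hη' : ∀ v ∈ s, HasFDerivAt η (∑ i, ((2 : ℂ) • ∑ j, dHol j (dHol i U) v •
      (EuclideanSpace.proj j : CSpace m →L[ℂ] ℂ)).smulRight
        (EuclideanSpace.proj i : CSpace m →L[ℂ] ℂ)) v := fun v hv => by
    refine HasFDerivAt.fun_sum fun i _ => ?_
    have h := (hasFDerivAt_of_dAnti_eq_zero ((hdh v hv i).differentiableAt (by simp))
      (hanti v hv i)).const_mul 2
    exact h.smul_const (EuclideanSpace.proj i : CSpace m →L[ℂ] ℂ)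
  obtain ⟨f, hf⟩ := hc.exists_forall_hasFDerivAt_of_fderiv_symmetric hs
    (fun v hv => ((hη' v hv).restrictScalars ℝ).differentiableAt.differentiableWithinAt)
    (fun v hv x y => by
      rw [((hη' v hv).restrictScalars ℝ).fderiv]
      simp only [ContinuousLinearMap.coe_restrictScalars', sum_apply,
        ContinuousLinearMap.smulRight_apply, smul_apply, smul_eq_mul, PiLp.proj_apply,
        Finset.mul_sum, Finset.sum_mul]
      rw [Finset.sum_comm]
      refine Finset.sum_congr rfl fun i _ => Finset.sum_congr rfl fun j _ => ?_
      rw [dHol_eq_wirtinger, dHol_eq_wirtinger, wirtinger_comm (hU' v hv)]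
      ring)
  rcases s.eq_empty_or_nonempty with rfl | ⟨z, hz⟩
  · exact ⟨0, by simp, by simp⟩
  -- The functions `Re f` and `u` have the same differential.
  have hre : ∀ v ∈ s, HasFDerivAt (fun w => (f w).re - u w) (0 : CSpace m →L[ℝ] ℝ) v := by
    intro v hv
    have h1 : HasFDerivAt (fun w => (f w).re) _ v :=
      (Complex.reCLM.hasFDerivAt (x := f v)).comp v ((hf v hv).restrictScalars ℝ)
    have h2 := ((hu v hv).differentiableAt (by simp)).hasFDerivAt
    have h3 : HasFDerivAt U (Complex.ofRealCLM.comp (fderiv ℝ u v)) v :=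
      (Complex.ofRealCLM.hasFDerivAt (x := u v)).comp v h2
    refine (h1.sub h2).congr_fderiv ?_
    ext x
    have h4 : ((fderiv ℝ u v x : ℝ) : ℂ) = fderiv ℝ U v x := by
      rw [h3.fderiv]
      rfl
    have h5 : fderiv ℝ u v x = (η v x).re := by
      rw [← Complex.ofReal_re (fderiv ℝ u v x), h4, fderiv_eq_sum_wirtinger, hη, Complex.re_sum]
      simp only [sum_apply, smul_apply, PiLp.proj_apply, smul_eq_mul, Complex.re_sum]
      refine Finset.sum_congr rfl fun i _ => ?_
      rw [dAnti_ofReal, ← map_mul, Complex.add_re, Complex.conj_re, mul_assoc, mul_comm (x i)]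
      simp only [Complex.mul_re, Complex.re_ofNat, Complex.im_ofNat]
      ring
    simp [h5]
  refine ⟨fun v => f v - (((f z).re - u z : ℝ) : ℂ), fun v hv =>
    ((hf v hv).differentiableAt.sub_const _).differentiableWithinAt, fun v hv => ?_⟩
  have h := hc.is_const_of_fderivWithin_eq_zero (𝕜 := ℝ)
    (f := fun w => (f w).re - u w)
    (fun w hw => (hre w hw).differentiableAt.differentiableWithinAt)
    (fun w hw => (hre w hw).hasFDerivWithinAt.fderivWithin (hs.uniqueDiffWithinAt hw)) hv hz
  simp only [Complex.sub_re, Complex.ofReal_re]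
  linarith

end Pluriharmonic

/-! ### Locally constant cocycles on simply connected spaces -/

/-- On a simply connected space, a locally constant cocycle is a coboundary: the associated bundle
with discrete fibre is a covering, and hence has a section. -/
theorem exists_locally_constant_splitting {X G ι : Type*} [TopologicalSpace X]
    [SimplyConnectedSpace X] [LocallyPathConnectedSpace X] [Group G] {O : ι → Set X}
    (hO : ∀ i, IsOpen (O i)) (hcov : ∀ x, ∃ i, x ∈ O i) {c : ι → ι → X → G}
    (hc : ∀ i j, ∀ x ∈ O i ∩ O j, ∀ᶠ y in 𝓝 x, c i j y = c i j x)
    (hself : ∀ i, ∀ x ∈ O i, c i i x = 1)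
    (hcomp : ∀ i j k, ∀ x ∈ O i ∩ O j ∩ O k, c j k x * c i j x = c i k x) :
    ∃ a : ι → X → G, (∀ i, ∀ x ∈ O i, ∀ᶠ y in 𝓝 x, a i y = a i x) ∧
      ∀ i j, ∀ x ∈ O i ∩ O j, a j x = c i j x * a i x := by
  let _ : TopologicalSpace G := ⊥
  have : DiscreteTopology G := ⟨rfl⟩
  choose idx hidx using hcov
  let Z : FiberBundleCore ι X G :=
    { baseSet := O
      isOpen_baseSet := hO
      indexAt := idx
      mem_baseSet_at := hidx
      coordChange := fun i j x v => c i j x * v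
      coordChange_self := fun i x hx v => by rw [hself i x hx, one_mul]
      continuousOn_coordChange := fun i j => by
        rintro ⟨x, v⟩ ⟨hx, -⟩
        refine ContinuousAt.continuousWithinAt ?_
        have h1 : ContinuousAt (c i j) x :=
          continuousAt_const.congr (Filter.EventuallyEq.symm (hc i j x hx))
        exact (continuous_of_discreteTopology (f := fun p : G × G => p.1 * p.2)).continuousAt.comp
          ((h1.comp continuousAt_fst).prodMk continuousAt_snd)
      coordChange_comp := fun i j k x hx v => by rw [← mul_assoc, hcomp i j k x hx] }
  -- A section is a lift of the identity map to the covering.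
  have hcovering : IsCoveringMap Z.proj := FiberBundle.isCoveringMap (F := G) (E := Z.Fiber)
  obtain ⟨x₀⟩ : Nonempty X := inferInstance
  obtain ⟨F, ⟨-, hF⟩, -⟩ := hcovering.existsUnique_continuousMap_lifts (ContinuousMap.id X) x₀
    (⟨x₀, (1 : G)⟩ : Z.TotalSpace) rfl
  have hF' : ∀ x, (F x).1 = x := fun x => congrFun hF x
  refine ⟨fun i x => (Z.localTriv i (F x)).2, fun i x hx => ?_, fun i j x hx => ?_⟩
  · have h1 : ContinuousAt (fun y => (Z.localTriv i (F y)).2) x := by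
      refine continuousAt_snd.comp (ContinuousAt.comp (g := Z.localTriv i) ?_ (F.continuousAt x))
      refine (Z.localTriv i).continuousAt ?_
      rw [(Z.localTriv i).mem_source]
      show (F x).1 ∈ O i
      rwa [hF' x]
    exact h1.eventually (IsOpen.mem_nhds (isOpen_discrete {(Z.localTriv i (F x)).2}) rfl)
  · have h := Z.coordChange_comp (Z.indexAt (F x).1) i j (F x).1
      ⟨⟨Z.mem_baseSet_at _, by rw [hF' x]; exact hx.1⟩, by rw [hF' x]; exact hx.2⟩ (F x).2
    have h2 : Z.coordChange i j (F x).1 (Z.localTriv i (F x)).2 = c i j x * (Z.localTriv i (F x)).2 := by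
      rw [hF' x]
    rw [← h2]
    exact h.symm

/-! ### Global frames with prescribed norm -/

section GlobalFrame

variable {n : ℕ} {A : Type*} [TopologicalSpace A] [ChartedSpace (CSpace n) A]
  {N : A → Type*} [TopologicalSpace (TotalSpace ℂ N)] [∀ x, TopologicalSpace (N x)]
  [∀ x, AddCommGroup (N x)] [∀ x, Module ℂ (N x)] [FiberBundle ℂ N] [VectorBundle ℂ ℂ N]
  [IsManifold 𝓘(ℂ, CSpace n) ω A] [ContMDiffVectorBundle ω ℂ N 𝓘(ℂ, CSpace n)]
  {ρ : TotalSpace ℂ N → ℝ} {pr : CSpace n → A} {q : CSpace n → ℝ}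

/-- If `q` is a potential of the curvature, then there are local frames of squared norm `exp q`:
the difference between `q` and any other local potential is the real part of a holomorphic
function. -/
lemma IsHermitianMetric.exists_local_frame_eq_exp (hρ : IsHermitianMetric n ρ)
    (hpr : MDifferentiable 𝓘(ℂ, CSpace n) 𝓘(ℂ, CSpace n) pr) (hq : ∀ z, ContDiffAt ℝ ∞ q z)
    (hW : ∀ (O : Set (CSpace n)) (s : CSpace n → TotalSpace ℂ N), IsLocalFrame pr O s →
      ∀ z ∈ O, complexHessian (fun w => Real.log (ρ (s w))) z = complexHessian q z)
    (z : CSpace n) :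
    ∃ (O : Set (CSpace n)) (s : CSpace n → TotalSpace ℂ N), z ∈ O ∧ IsLocalFrame pr O s ∧
      ∀ w ∈ O, ρ (s w) = Real.exp (q w) := by
  obtain ⟨O, s, hz, hs⟩ := exists_isLocalFrame (N := N) hpr z
  obtain ⟨r, hr, hrO⟩ := Metric.isOpen_iff.mp hs.isOpen z hz
  set B := Metric.ball z r with hB
  have hneg : ∀ w, ContDiffAt ℝ ∞ (fun w => -1 * q w) w := fun w => contDiffAt_const.mul (hq w)
  obtain ⟨f, hf, hfu⟩ := exists_re_eq_of_complexHessian_eq_zero (s := B)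
    (u := fun w => Real.log (ρ (s w)) + -1 * q w) Metric.isOpen_ball (convex_ball z r)
    (fun w hw => (hρ.contDiffAt_log hs (hrO hw)).add (hneg w))
    (fun w hw => by
      rw [complexHessian_add (hρ.contDiffAt_log hs (hrO hw)) (hneg w), hW O s hs w (hrO hw),
        complexHessian_const_mul _ (hq w)]
      simp)
  refine ⟨B, fun w => fiberSMul (Complex.exp (-(f w) / 2)) (s w), Metric.mem_ball_self hr,
    ⟨Metric.isOpen_ball, fun w hw => ?_, fun w hw => hs.proj_eq w (hrO hw), fun w hw => ?_⟩,
    fun w hw => ?_⟩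
  · refine MDifferentiableAt.mdifferentiableWithinAt ?_
    exact (hs.mdifferentiableAt (hrO hw)).fiberSMul
      (DifferentiableAt.cexp (DifferentiableAt.mul_const (𝔸 := ℂ)
        (hf.differentiableAt (Metric.isOpen_ball.mem_nhds hw)).neg (2⁻¹ : ℂ)))
  · exact fiberSMul_ne_zero (Complex.exp_ne_zero _) (hs.ne_zero w (hrO hw))
  · have h1 : (f w).re = Real.log (ρ (s w)) + -1 * q w := hfu w hw
    have h2 : ((-(f w) / 2).re) = -((f w).re) / 2 := by simp
    rw [hρ.apply_fiberSMul, Complex.norm_exp, h2, h1,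
      ← Real.exp_log (hρ.apply_pos (hs.ne_zero w (hrO hw))), ← Real.exp_nat_mul,
      ← Real.exp_add, Real.exp_log (hρ.apply_pos (hs.ne_zero w (hrO hw)))]
    congr 1
    push_cast
    ring

/-- A potential of the curvature on all of `ℂⁿ` gives rise to a global frame of squared norm
`exp q`: the local frames differ by locally constant factors of modulus one. -/
theorem IsHermitianMetric.exists_global_frame_eq_exp (hρ : IsHermitianMetric n ρ)
    (hpr : MDifferentiable 𝓘(ℂ, CSpace n) 𝓘(ℂ, CSpace n) pr) (hq : ∀ z, ContDiffAt ℝ ∞ q z)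
    (hW : ∀ (O : Set (CSpace n)) (s : CSpace n → TotalSpace ℂ N), IsLocalFrame pr O s →
      ∀ z ∈ O, complexHessian (fun w => Real.log (ρ (s w))) z = complexHessian q z) :
    ∃ s : CSpace n → TotalSpace ℂ N, IsLocalFrame pr univ s ∧ ∀ w, ρ (s w) = Real.exp (q w) := by
  choose O s hzO hs hsq using hρ.exists_local_frame_eq_exp hpr hq hW
  have key : ∀ i j x, ∃ c : Circle, x ∈ O i ∩ O j → s i x = fiberSMul (c : ℂ) (s j x) := by
    intro i j x
    by_cases hx : x ∈ O i ∩ O j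
    · obtain ⟨c, -, hc⟩ := exists_fiberSMul_eq
        (((hs i).proj_eq x hx.1).trans ((hs j).proj_eq x hx.2).symm) ((hs j).ne_zero x hx.2)
        ((hs i).ne_zero x hx.1)
      have h1 : ‖c‖ ^ 2 = 1 := by
        have h2 := hsq i x hx.1
        rw [hc, hρ.apply_fiberSMul, hsq j x hx.2] at h2
        exact mul_eq_right₀ (Real.exp_pos _).ne' |>.mp h2
      have h2 : ‖c‖ = 1 := (pow_eq_one_iff_of_nonneg (norm_nonneg c) two_ne_zero).mp h1
      exact ⟨⟨c, mem_sphere_zero_iff_norm.mpr h2⟩, fun _ => hc⟩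
    · exact ⟨1, fun h => absurd h hx⟩
  choose c hc using key
  have hconst : ∀ i j, ∀ x ∈ O i ∩ O j, ∀ᶠ y in 𝓝 x, c i j y = c i j x := by
    intro i j x hx
    have hO := ((hs i).isOpen.inter (hs j).isOpen)
    have hd : ∀ᶠ y in 𝓝 x, DifferentiableAt ℂ (fun y => (c i j y : ℂ)) y := by
      filter_upwards [hO.mem_nhds hx] with y hy
      refine differentiableAt_of_eq_fiberSMul ((hs j).mdifferentiableAt hy.2)
        ((hs i).mdifferentiableAt hy.1) ((hs j).ne_zero y hy.2) ?_
      filter_upwards [hO.mem_nhds hy] with w hw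
      exact hc i j w hw
    -- The ratio of two frames is holomorphic and of modulus one.
    have hmax : IsLocalMax (norm ∘ fun y => (c i j y : ℂ)) x :=
      Filter.Eventually.of_forall fun y => by
        simp only [Function.comp_apply, Circle.norm_coe, le_refl]
    filter_upwards [Complex.eventually_eq_of_isLocalMax_norm hd hmax] with y hy
    exact Subtype.ext hy
  obtain ⟨a, ha, hac⟩ := exists_locally_constant_splitting (fun i => (hs i).isOpen)
    (fun x => ⟨x, hzO x⟩) hconst
    (fun i x hx => by
      have h := hc i i x ⟨hx, hx⟩
      rw [← fiberSMul_one (s i x)] at h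
      rw [fiberSMul_fiberSMul] at h
      have h' := fiberSMul_injective ((hs i).ne_zero x hx) h
      rw [mul_one] at h'
      exact Subtype.ext h'.symm)
    (fun i j k x hx => by
      have h1 := hc i j x hx.1
      rw [hc j k x ⟨hx.1.2, hx.2⟩, hc i k x ⟨hx.1.1, hx.2⟩, fiberSMul_fiberSMul] at h1
      have h2 := fiberSMul_injective ((hs k).ne_zero x hx.2) h1
      refine Subtype.ext ?_
      rw [mul_comm]
      exact h2.symm)
  have hloc : ∀ x, (fun y => fiberSMul (a y y : ℂ) (s y y)) =ᶠ[𝓝 x]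
      fun y => fiberSMul (a x x : ℂ) (s x y) := by
    intro x
    filter_upwards [ha x x (hzO x), (hs x).isOpen.mem_nhds (hzO x)] with y hy hyO
    rw [hac x y y ⟨hyO, hzO y⟩, hc x y y ⟨hyO, hzO y⟩, fiberSMul_fiberSMul, hy, Circle.coe_mul,
      mul_comm]
  refine ⟨fun y => fiberSMul (a y y : ℂ) (s y y), ⟨isOpen_univ, fun x _ => ?_,
    fun x _ => (hs x).proj_eq x (hzO x), fun x _ => ?_⟩, fun x => ?_⟩
  · refine MDifferentiableAt.mdifferentiableWithinAt ?_
    exact (((hs x).mdifferentiableAt (hzO x)).fiberSMul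
      (differentiableAt_const _)).congr_of_eventuallyEq (hloc x)
  · exact fiberSMul_ne_zero (Circle.coe_ne_zero _) ((hs x).ne_zero x (hzO x))
  · rw [hρ.apply_fiberSMul, Circle.norm_coe, one_pow, one_mul, hsq x x (hzO x)]

end GlobalFrame

/-! ### Potentials of constant curvature forms -/

open scoped MatrixOrder in
/-- Every positive definite matrix is the complex Hessian of `2 ‖C z‖²` for a linear
isomorphism `C`. -/
lemma Matrix.PosDef.exists_complexHessian_eq {n : ℕ} {W : Matrix (Fin n) (Fin n) ℂ}
    (hW : W.PosDef) : ∃ C : CSpace n ≃L[ℂ] CSpace n,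
      ∀ z, complexHessian (fun w => 2 * ‖C w‖ ^ 2) z = W := by
  have hT : W.transpose.PosDef := hW.transpose
  -- If `Wᵀ = Bᴴ B`, one may take `C = B / √2`.
  obtain ⟨B, hB⟩ := CStarAlgebra.nonneg_iff_eq_star_mul_self.mp hT.posSemidef.nonneg
  have hunit : IsUnit B.det := by
    have h1 := hT.det_pos.ne'
    rw [hB, Matrix.det_mul] at h1
    exact (right_ne_zero_of_mul h1).isUnit
  set r : ℂ := (((Real.sqrt 2)⁻¹ : ℝ) : ℂ) with hr
  have hr0 : r ≠ 0 := by simp [hr]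
  have hrr : 2 * (r * r) = 1 := by
    rw [hr, ← Complex.ofReal_mul, ← mul_inv, Real.mul_self_sqrt zero_le_two]
    norm_num
  set L : CSpace n →ₗ[ℂ] CSpace n := r • Matrix.toEuclideanLin B with hL
  have hinj : Function.Injective L := by
    refine (injective_iff_map_eq_zero _).mpr fun x hx => ?_
    have h1 : Matrix.toEuclideanLin B x = 0 := (smul_eq_zero.mp hx).resolve_left hr0
    have h2 : B.mulVec x.ofLp = 0 := congrArg WithLp.ofLp h1
    have h3 := Matrix.mulVec_injective_iff_isUnit.mpr ((Matrix.isUnit_iff_isUnit_det B).mpr hunit)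
      (h2.trans (Matrix.mulVec_zero B).symm)
    ext i
    exact congrFun h3 i
  let C : CSpace n ≃L[ℂ] CSpace n := (LinearEquiv.ofInjectiveEndo L hinj).toContinuousLinearEquiv
  have hC : ∀ x, C x = r • Matrix.toEuclideanLin B x := fun x => rfl
  have hCs : ∀ i k, C (stdVec i) k = r * B k i := fun i k => by
    rw [hC, PiLp.smul_apply, smul_eq_mul]
    congr 1
    have : Matrix.toEuclideanLin B (stdVec i) k = (B.mulVec (Pi.single i 1)) k := rfl
    rw [this, Matrix.mulVec_single_one]
    rfl
  refine ⟨C, fun z => ?_⟩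
  have hsq : ∀ v : CSpace n, ContDiffAt ℝ ∞ (fun w : CSpace n => ‖w‖ ^ 2) v := fun v =>
    contDiffAt_id.norm_sq ℝ
  have hCsm : ContDiffAt ℝ ∞ (fun w => ‖C w‖ ^ 2) z :=
    ((C.contDiff (n := ∞)).restrict_scalars ℝ).contDiffAt.norm_sq ℝ
  rw [complexHessian_const_mul 2 hCsm]
  ext i j
  rw [Matrix.smul_apply, complexHessian_comp (hsq _)
    (Filter.Eventually.of_forall fun w => C.differentiableAt), complexHessian_norm_sq,
    sesqForm_one, C.fderiv, PiLp.inner_apply]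
  have hWij : W i j = ∑ k, starRingEnd ℂ (B k j) * B k i := by
    have := congrFun (congrFun hB j) i
    rw [Matrix.transpose_apply, Matrix.mul_apply] at this
    rw [this]
    rfl
  rw [hWij, smul_eq_mul, Finset.mul_sum]
  refine Finset.sum_congr rfl fun k _ => ?_
  have h1 : (inner ℂ ((C : CSpace n →L[ℂ] CSpace n) (stdVec j) k)
      ((C : CSpace n →L[ℂ] CSpace n) (stdVec i) k) : ℂ) =
      C (stdVec i) k * starRingEnd ℂ (C (stdVec j) k) := rfl
  rw [h1, hCs, hCs, map_mul, hr, Complex.conj_ofReal, ← hr, Complex.ofReal_ofNat]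
  linear_combination (starRingEnd ℂ (B k j) * B k i) * hrr

/-! ### The total space of a negative line bundle as a quotient of the Siegel domain -/

section Uniformization

variable {n : ℕ} {A : Type*} [TopologicalSpace A] [ChartedSpace (CSpace n) A]
  {N : A → Type*} [TopologicalSpace (TotalSpace ℂ N)] [∀ x, TopologicalSpace (N x)]
  [∀ x, AddCommGroup (N x)] [∀ x, Module ℂ (N x)] [FiberBundle ℂ N] [VectorBundle ℂ ℂ N]
  [IsManifold 𝓘(ℂ, CSpace n) ω A] [ContMDiffVectorBundle ω ℂ N 𝓘(ℂ, CSpace n)]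
  {ρ : TotalSpace ℂ N → ℝ} {pr : CSpace n → A} {s : CSpace n → TotalSpace ℂ N}

/-- The map `(z, ζ) ↦ e^ζ s(z)` defined by a global frame of the pull-back. -/
def expFrame (s : CSpace n → TotalSpace ℂ N) (p : CSpace (n + 1)) : TotalSpace ℂ N :=
  fiberSMul (Complex.exp (ζPart n p)) (s (zPart n p))

lemma mdifferentiable_expFrame (hs : IsLocalFrame pr univ s) :
    MDifferentiable 𝓘(ℂ, CSpace (n + 1)) (𝓘(ℂ, CSpace n).prod 𝓘(ℂ, ℂ)) (expFrame s) := by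
  intro p
  have h1 : MDifferentiableAt 𝓘(ℂ, CSpace (n + 1)) (𝓘(ℂ, CSpace n).prod 𝓘(ℂ, ℂ))
      (s ∘ zPart n) p :=
    MDifferentiableAt.comp p (hs.mdifferentiableAt (mem_univ _))
      (zPart n).differentiableAt.mdifferentiableAt
  exact h1.fiberSMul (ζPart n).differentiableAt.cexp

/-- The differential of `expFrame s` has trivial kernel: its component along the base is that of
the projection `pr`, and on the kernel of the latter the component along the fibre is the
logarithmic differential. -/
lemma bijective_mfderiv_expFrame (hs : IsLocalFrame pr univ s)
    (hpr : MDifferentiable 𝓘(ℂ, CSpace n) 𝓘(ℂ, CSpace n) pr)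
    (hb : ∀ z, Function.Bijective (mfderiv 𝓘(ℂ, CSpace n) 𝓘(ℂ, CSpace n) pr z))
    (p : CSpace (n + 1)) :
    Function.Bijective (mfderiv 𝓘(ℂ, CSpace (n + 1)) (𝓘(ℂ, CSpace n).prod 𝓘(ℂ, ℂ))
      (expFrame s) p) := by
  have : IsManifold 𝓘(ℂ, CSpace n) 1 A := IsManifold.of_le (n := ω) le_top
  have : ContMDiffVectorBundle 1 ℂ N 𝓘(ℂ, CSpace n) := ContMDiffVectorBundle.of_le (n := ω) le_top
  have hP := mdifferentiable_expFrame hs p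
  set b := (expFrame s p).proj with hbdef
  have hmem : b ∈ (trivializationAt ℂ N b).baseSet :=
    FiberBundle.mem_baseSet_trivializationAt' (F := ℂ) (E := N) b
  let L : CSpace (n + 1) →L[ℂ] CSpace n × ℂ :=
    mfderiv 𝓘(ℂ, CSpace (n + 1)) (𝓘(ℂ, CSpace n).prod 𝓘(ℂ, ℂ)) (expFrame s) p
  have hinj : Function.Injective L := by
    refine (injective_iff_map_eq_zero _).mpr fun x hx => ?_
    -- The component along the base.
    have h1 : mfderiv 𝓘(ℂ, CSpace (n + 1)) 𝓘(ℂ, CSpace n) (pr ∘ zPart n) p x =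
        (0 : CSpace n) := by
      have hcomp : pr ∘ zPart n = TotalSpace.proj ∘ expFrame s :=
        funext fun w => (hs.proj_eq (zPart n w) (mem_univ _)).symm
      rw [hcomp, mfderiv_comp p (mdifferentiableAt_proj (IB := 𝓘(ℂ, CSpace n)) N) hP]
      have h2 := map_zero (mfderiv (𝓘(ℂ, CSpace n).prod 𝓘(ℂ, ℂ)) 𝓘(ℂ, CSpace n)
        (TotalSpace.proj : TotalSpace ℂ N → A) (expFrame s p))
      exact (congrArg _ hx).trans h2
    have hz : zPart n x = 0 := by
      rw [mfderiv_comp p (hpr _) (zPart n).differentiableAt.mdifferentiableAt, mfderiv_eq_fderiv,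
        (zPart n).fderiv] at h1
      refine (hb (zPart n p)).1 ?_
      exact h1.trans (map_zero (mfderiv 𝓘(ℂ, CSpace n) 𝓘(ℂ, CSpace n) pr (zPart n p))).symm
    -- The component along the fibre.
    have hk : MDifferentiableAt (𝓘(ℂ, CSpace n).prod 𝓘(ℂ, ℂ)) 𝓘(ℂ, ℂ)
        (fiberCoord (N := N) b) (expFrame s p) :=
      ((mdifferentiableAt_totalSpace 𝓘(ℂ, CSpace n) (id : TotalSpace ℂ N → TotalSpace ℂ N)).mp
        mdifferentiableAt_id).2
    have h3 : fderiv ℂ (fiberCoord b ∘ expFrame s) p x = 0 := by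
      rw [← mfderiv_eq_fderiv, mfderiv_comp p hk hP]
      have h2 := map_zero (mfderiv (𝓘(ℂ, CSpace n).prod 𝓘(ℂ, ℂ)) 𝓘(ℂ, ℂ)
        (fiberCoord (N := N) b) (expFrame s p))
      exact (congrArg _ hx).trans h2
    have hsz : (s (zPart n p)).proj ∈ (trivializationAt ℂ N b).baseSet := hmem
    have hsd := ((mdifferentiableAt_iff_fiberCoord hsz).mp
      (hs.mdifferentiableAt (mem_univ (zPart n p)))).2
    have hsd0 : fiberCoord b (s (zPart n p)) ≠ 0 :=
      (fiberCoord_ne_zero_iff hsz).mpr (hs.ne_zero _ (mem_univ _))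
    have h4 : fiberCoord b ∘ expFrame s =ᶠ[𝓝 p]
        fun w => Complex.exp (ζPart n w) * fiberCoord b (s (zPart n w)) := by
      have hc : ContinuousAt (fun w => (expFrame s w).proj) p :=
        ((mdifferentiableAt_iff_fiberCoord hmem).mp hP).1.continuousAt
      filter_upwards [hc.eventually ((trivializationAt ℂ N b).open_baseSet.mem_nhds hmem)]
        with w hw
      exact fiberCoord_fiberSMul (v := s (zPart n w)) hw _
    have h5 : HasFDerivAt (fun w => fiberCoord b (s (zPart n w)))
        ((fderiv ℂ (fun z => fiberCoord b (s z)) (zPart n p)).comp (zPart n)) p :=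
      hsd.hasFDerivAt.comp p (zPart n).hasFDerivAt
    have h6 := ((ζPart n).hasFDerivAt (x := p)).cexp.fun_mul h5
    rw [h4.fderiv_eq, h6.fderiv] at h3
    have hζ : ζPart n x = 0 := by
      simpa [hz, hsd0, Complex.exp_ne_zero] using h3
    exact siegel_ext (by simpa using hz) (by simpa using hζ)
  have hrank : Module.finrank ℂ (CSpace (n + 1)) = Module.finrank ℂ (CSpace n × ℂ) := by
    simp
  exact ⟨hinj, (LinearMap.injective_iff_surjective_of_finrank_eq_finrank
    (f := (L : CSpace (n + 1) →ₗ[ℂ] CSpace n × ℂ)) hrank).mp hinj⟩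

/-- A frame of squared norm `exp (2 ‖z‖²)` is multiplied under a translation by a period by
the automorphy factor `exp (2 ⟨l, z⟩ + ‖l‖²)`, up to a constant of modulus one. -/
lemma exists_automorphy_factor (hρ : IsHermitianMetric n ρ) (hs : IsLocalFrame pr univ s)
    (hsq : ∀ z, ρ (s z) = Real.exp (2 * ‖z‖ ^ 2)) {l : CSpace n} (hl : ∀ w, pr (w + l) = pr w) :
    ∃ β : ℂ, ‖β‖ = 1 ∧ ∀ w, s (w + l) =
      fiberSMul (β * Complex.exp (2 * inner ℂ l w + ‖l‖ ^ 2)) (s w) := by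
  have hs' : IsLocalFrame pr univ fun w => s (w + l) :=
    ⟨isOpen_univ, fun w _ => by
      have h1 : DifferentiableAt ℂ (fun w : CSpace n => w + l) w :=
        differentiableAt_id.add_const l
      exact (MDifferentiableAt.comp (g := s) (f := fun w => w + l) w
        (hs.mdifferentiableAt (mem_univ _)) h1.mdifferentiableAt).mdifferentiableWithinAt,
      fun w _ => (hs.proj_eq _ (mem_univ _)).trans (hl w), fun w _ => hs.ne_zero _ (mem_univ _)⟩
  obtain ⟨a, had, ha⟩ := hs.exists_ratio hs'
  have ha' : ∀ w, s (w + l) = fiberSMul (a w) (s w) := fun w => (ha w ⟨mem_univ _, mem_univ _⟩).2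
  have hanorm : ∀ w, ‖a w‖ = Real.exp (2 * (inner ℂ l w).re + ‖l‖ ^ 2) := fun w => by
    have h1 := hsq (w + l)
    rw [ha', hρ.apply_fiberSMul, hsq w] at h1
    have h2 : ‖w + l‖ ^ 2 = ‖w‖ ^ 2 + 2 * (inner ℂ l w).re + ‖l‖ ^ 2 := by
      rw [add_comm w l, @norm_add_sq ℂ]
      simp only [RCLike.re_to_complex]
      ring
    have h3 : ‖a w‖ ^ 2 = Real.exp (2 * (inner ℂ l w).re + ‖l‖ ^ 2) ^ 2 := by
      refine mul_right_cancel₀ (Real.exp_pos (2 * ‖w‖ ^ 2)).ne' ?_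
      rw [h1, h2, ← Real.exp_nat_mul, ← Real.exp_add]
      congr 1
      push_cast
      ring
    exact (pow_left_inj₀ (norm_nonneg _) (Real.exp_pos _).le two_ne_zero).mp h3
  set f : CSpace n → ℂ := fun w => a w * Complex.exp (-(2 * inner ℂ l w + ‖l‖ ^ 2)) with hf
  have hin : Differentiable ℂ fun w : CSpace n => (inner ℂ l w : ℂ) :=
    (innerSL ℂ l).differentiable
  have hfd : Differentiable ℂ f := fun w =>
    ((had w ⟨mem_univ _, mem_univ _⟩).differentiableAt (by simp)).mul
      (((hin w).const_mul 2).add_const _).neg.cexp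
  -- The ratio of the frames, divided by the expected factor, is entire and of modulus one.
  have hfn : ∀ w, ‖f w‖ = 1 := fun w => by
    have h1 : (-(2 * inner ℂ l w + (‖l‖ : ℂ) ^ 2)).re = -(2 * (inner ℂ l w).re + ‖l‖ ^ 2) := by
      rw [← Complex.ofReal_pow]
      simp only [Complex.neg_re, Complex.add_re, Complex.mul_re, Complex.re_ofNat,
        Complex.im_ofNat, Complex.ofReal_re]
      ring
    rw [hf, norm_mul, hanorm, Complex.norm_exp, h1, ← Real.exp_add]
    simp
  have hconst : ∀ w, f w = f 0 := fun w => hfd.apply_eq_apply_of_bounded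
    ((Metric.isBounded_closedBall (x := (0 : ℂ)) (r := 1)).subset (by
      rintro _ ⟨w, rfl⟩
      rw [mem_closedBall_zero_iff, hfn])) w 0
  refine ⟨f 0, hfn 0, fun w => ?_⟩
  rw [ha', ← hconst w, hf, mul_assoc, ← Complex.exp_add]
  simp

/-- The pull-back frame of squared norm `exp (2 ‖z‖²)` exhibits the complement of the zero section
as a quotient of `ℂⁿ⁺¹` by Heisenberg translations. -/
theorem isCuspUniformization_expFrame (hρ : IsHermitianMetric n ρ)
    (hpr : MDifferentiable 𝓘(ℂ, CSpace n) 𝓘(ℂ, CSpace n) pr)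
    (hb : ∀ z, Function.Bijective (mfderiv 𝓘(ℂ, CSpace n) 𝓘(ℂ, CSpace n) pr z))
    (hper : ∀ z z', pr z = pr z' → ∀ w, pr (w + (z' - z)) = pr w)
    {K : Set (CSpace n)} (hK : IsCompact K) (hKs : ∀ x, ∃ z ∈ K, pr z = x)
    (hs : IsLocalFrame pr univ s) (hsq : ∀ z, ρ (s z) = Real.exp (2 * ‖z‖ ^ 2)) :
    IsCuspUniformization (𝓘(ℂ, CSpace n).prod 𝓘(ℂ, ℂ)) (expFrame s) ρ := by
  have : IsManifold 𝓘(ℂ, CSpace n) 1 A := IsManifold.of_le (n := ω) le_top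
  have : ContMDiffVectorBundle 1 ℂ N 𝓘(ℂ, CSpace n) := ContMDiffVectorBundle.of_le (n := ω) le_top
  have hhol := mdifferentiable_expFrame hs
  have hbij := bijective_mfderiv_expFrame hs hpr hb
  have hlift : ∀ v : TotalSpace ℂ N, v.2 ≠ 0 → ∀ z, pr z = v.proj →
      ∃ c : ℂ, c ≠ 0 ∧ v = fiberSMul c (s z) := fun v hv z hz =>
    exists_fiberSMul_eq (hz.symm.trans (hs.proj_eq z (mem_univ _)).symm)
      (hs.ne_zero z (mem_univ _)) hv
  refine ⟨hhol, hbij, isLocallyInjective_of_bijective_mfderiv hhol hbij,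
    isOpenMap_of_bijective_mfderiv hhol hbij, hρ.smooth.continuous, hρ.apply_nonneg,
    fun p => ?_, fun v hv => ?_, fun p q hpq => ?_, K, hK, fun p => ?_⟩
  · rw [expFrame, hρ.apply_fiberSMul, hsq, Complex.norm_exp, ← Real.exp_nat_mul, ← Real.exp_add,
      siegelHeight]
    congr 1
    push_cast
    ring
  · have hv2 : v.2 ≠ 0 := fun h0 => hv.ne' (hρ.apply_zero h0)
    obtain ⟨z, -, hz⟩ := hKs v.proj
    obtain ⟨c, hc, hvc⟩ := hlift v hv2 z hz
    refine ⟨siegelMk z (Complex.log c), ?_⟩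
    rw [expFrame, zPart_mk, ζPart_mk, Complex.exp_log hc, hvc]
  · set l := zPart n q - zPart n p with hl
    have hpr' : pr (zPart n p) = pr (zPart n q) := by
      rw [← hs.proj_eq _ (mem_univ (zPart n p)), ← hs.proj_eq _ (mem_univ (zPart n q))]
      have h1 : (expFrame s p).proj = (expFrame s q).proj := by rw [hpq]
      exact h1
    obtain ⟨β, hβ, hfac⟩ := exists_automorphy_factor hρ hs hsq (hper _ _ hpr')
    rw [← hl] at hfac
    have hq : zPart n q = zPart n p + l := by rw [hl]; abel
    -- The number `d` will be the imaginary translation; it is imaginary because `|β| = 1`.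
    set d := ζPart n q + (2 * inner ℂ l (zPart n p) + ‖l‖ ^ 2) - ζPart n p with hd
    have hdβ : Complex.exp d * β = 1 := by
      have h1 := hpq
      rw [expFrame, expFrame, hq, hfac, fiberSMul_fiberSMul] at h1
      have h2 := fiberSMul_injective (hs.ne_zero _ (mem_univ (zPart n p))) h1
      rw [hd, Complex.exp_sub, Complex.exp_add, div_mul_eq_mul_div,
        div_eq_one_iff_eq (Complex.exp_ne_zero _), h2]
      ring
    have hdre : d.re = 0 := by
      have h1 := congrArg norm hdβ
      rw [norm_mul, hβ, mul_one, norm_one, Complex.norm_exp] at h1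
      exact Real.exp_eq_one_iff _ |>.mp h1
    have hdI : d = Complex.I * d.im := by
      apply Complex.ext <;> simp [hdre]
    refine ⟨l, d.im, ?_, fun w => ?_⟩
    · apply siegel_ext
      · rw [zPart_heis, hq]
        simp
      · rw [ζPart_heis, ← hdI, hd]
        push_cast
        ring
    · rw [expFrame, zPart_heis, ζPart_heis, ← hdI]
      simp only [Complex.ofReal_one, one_smul, one_pow, one_mul, mul_one]
      rw [hfac, fiberSMul_fiberSMul, expFrame]
      congr 1
      calc Complex.exp (ζPart n w - 2 * inner ℂ l (zPart n w) - ‖l‖ ^ 2 + d) *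
            (β * Complex.exp (2 * inner ℂ l (zPart n w) + ‖l‖ ^ 2))
          = (Complex.exp d * β) * (Complex.exp (ζPart n w - 2 * inner ℂ l (zPart n w) - ‖l‖ ^ 2) *
              Complex.exp (2 * inner ℂ l (zPart n w) + ‖l‖ ^ 2)) := by
            rw [Complex.exp_add (ζPart n w - 2 * inner ℂ l (zPart n w) - ‖l‖ ^ 2) d]
            ring
        _ = Complex.exp (ζPart n w) := by
            rw [hdβ, one_mul, ← Complex.exp_add]
            congr 1
            ring
  -- Shifting the principal branch of the logarithm by `π` moves the imaginary part to `[0, 2π]`.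
  · obtain ⟨z, hz, hzp⟩ := hKs (expFrame s p).proj
    obtain ⟨c, hc, hvc⟩ := hlift (expFrame s p)
      (fiberSMul_ne_zero (Complex.exp_ne_zero _) (hs.ne_zero _ (mem_univ _))) z hzp
    refine ⟨siegelMk z (Complex.log (-c) + Real.pi * Complex.I), ?_, ?_, ?_⟩
    · rw [hvc, expFrame, zPart_mk, ζPart_mk, Complex.exp_add, Complex.exp_pi_mul_I,
        Complex.exp_log (neg_ne_zero.mpr hc)]
      simp
    · rwa [zPart_mk]
    · rw [ζPart_mk]
      have h1 := Complex.neg_pi_lt_log_im (-c)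
      have h2 := Complex.log_im_le_pi (-c)
      simp only [Complex.add_im, Complex.mul_im, Complex.ofReal_re, Complex.I_im, mul_one,
        Complex.ofReal_im, Complex.I_re, mul_zero, add_zero]
      constructor <;> linarith

end Uniformization

/-! ### Bundles of constant negative curvature -/

section InvariantCurvature

variable {n : ℕ} {A : Type*} [TopologicalSpace A] [ChartedSpace (CSpace n) A]
  {Λ : Submodule ℤ (CSpace n)} {pr : CSpace n → A}

lemma IsTorusProjection.add_eq (hpr : IsTorusProjection Λ pr) {l : CSpace n} (hl : l ∈ Λ)
    (w : CSpace n) : pr (w + l) = pr w :=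
  ((hpr.eq_iff w (w + l)).mpr (by simpa using hl)).symm

/-- A torus is the image of a compact set, the closure of a fundamental domain. -/
lemma IsTorusProjection.exists_isCompact [DiscreteTopology Λ] [IsZLattice ℝ Λ]
    (hpr : IsTorusProjection Λ pr) :
    ∃ K : Set (CSpace n), IsCompact K ∧ ∀ x, ∃ z ∈ K, pr z = x := by
  have : Module.Free ℤ Λ := ZLattice.module_free ℝ Λ
  have : Module.Finite ℤ Λ := ZLattice.module_finite ℝ Λ
  let b := (Module.Free.chooseBasis ℤ Λ).ofZLatticeBasis ℝ Λ
  refine ⟨closure (ZSpan.fundamentalDomain b),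
    (ZSpan.fundamentalDomain_isBounded b).isCompact_closure, fun x => ?_⟩
  obtain ⟨z, rfl⟩ := hpr.surjective x
  refine ⟨ZSpan.fract b z, subset_closure (ZSpan.fract_mem_fundamentalDomain b z), ?_⟩
  refine (hpr.eq_iff _ _).mpr ?_
  have h1 : z - ZSpan.fract b z = ZSpan.floor b z := by
    rw [ZSpan.fract_apply]
    abel
  have h2 : Submodule.span ℤ (range b) = Λ :=
    (Module.Free.chooseBasis ℤ Λ).ofZLatticeBasis_span ℝ
  rw [h1]
  exact h2.le (ZSpan.floor b z).2

variable {N : A → Type*} [TopologicalSpace (TotalSpace ℂ N)] [∀ x, TopologicalSpace (N x)]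
  [∀ x, AddCommGroup (N x)] [∀ x, Module ℂ (N x)] [FiberBundle ℂ N] [VectorBundle ℂ ℂ N]
  [IsManifold 𝓘(ℂ, CSpace n) ω A] [ContMDiffVectorBundle ω ℂ N 𝓘(ℂ, CSpace n)]
  {ρ : TotalSpace ℂ N → ℝ}

/-- A line bundle with a metric of negative translation invariant curvature is uniformized by the
Siegel domain: in suitable linear coordinates on `ℂⁿ` the curvature has the potential
`2 ‖z‖²`. -/
theorem IsHermitianMetric.exists_isCuspUniformization [DiscreteTopology Λ] [IsZLattice ℝ Λ]
    (hpr : IsTorusProjection Λ pr) (hρ : IsHermitianMetric n ρ) (hneg : IsNegativelyCurved pr ρ)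
    (hinv : HasInvariantCurvature pr ρ) :
    ∃ P : CSpace (n + 1) → TotalSpace ℂ N,
      IsCuspUniformization (𝓘(ℂ, CSpace n).prod 𝓘(ℂ, ℂ)) P ρ := by
  obtain ⟨W, hW⟩ := hinv
  have hWpos : W.PosDef := by
    obtain ⟨O, s, h0, hs⟩ := exists_isLocalFrame (N := N) hpr.holomorphic 0
    rw [← hW O s hs 0 h0]
    exact hneg O s hs 0 h0
  obtain ⟨C, hC⟩ := hWpos.exists_complexHessian_eq
  have hq : ∀ z, ContDiffAt ℝ ∞ (fun w => 2 * ‖C w‖ ^ 2) z := fun z =>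
    contDiffAt_const.mul (((C.contDiff (n := ∞)).restrict_scalars ℝ).contDiffAt.norm_sq ℝ)
  obtain ⟨s, hs, hsq⟩ := hρ.exists_global_frame_eq_exp hpr.holomorphic hq
    fun O s hs z hz => by rw [hW O s hs z hz, hC z]
  have hCd : ∀ z, MDifferentiableAt 𝓘(ℂ, CSpace n) 𝓘(ℂ, CSpace n) C.symm z := fun z =>
    C.symm.differentiableAt.mdifferentiableAt
  have hpr' : MDifferentiable 𝓘(ℂ, CSpace n) 𝓘(ℂ, CSpace n) (pr ∘ C.symm) := fun z =>
    MDifferentiableAt.comp z (hpr.holomorphic _) (hCd z)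
  obtain ⟨K, hK, hKs⟩ := hpr.exists_isCompact
  refine ⟨expFrame (s ∘ C.symm), isCuspUniformization_expFrame (pr := pr ∘ C.symm) hρ hpr'
    (fun z => ?_) (fun z z' hzz' w => ?_) (hK.image C.continuous) (fun x => ?_)
    ⟨isOpen_univ, fun z _ => ?_, fun z _ => hs.proj_eq _ (mem_univ _),
      fun z _ => hs.ne_zero _ (mem_univ _)⟩ fun z => ?_⟩
  · rw [mfderiv_comp z (hpr.holomorphic _) (hCd z), mfderiv_eq_fderiv, C.symm.fderiv]
    exact (hpr.bijective_mfderiv (C.symm z)).comp C.symm.bijective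
  · simp only [Function.comp_apply, map_add, map_sub]
    exact hpr.add_eq ((hpr.eq_iff _ _).mp hzz') _
  · obtain ⟨z, hz, rfl⟩ := hKs x
    exact ⟨C z, mem_image_of_mem C hz, by simp⟩
  · exact (MDifferentiableAt.comp z (hs.mdifferentiableAt (mem_univ _))
      (hCd z)).mdifferentiableWithinAt
  · rw [Function.comp_apply, hsq]
    simp

end InvariantCurvature

/-! ### Fourier series of functions that are periodic under a lattice -/

section LatticeFourier

variable {ι E : Type*} [Fintype ι] [NormedAddCommGroup E] [NormedSpace ℝ E]
  [FiniteDimensional ℝ E]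

/-- The function `f` is periodic under the lattice that the basis `b` generates. -/
def IsLatticePeriodic (b : Module.Basis ι ℝ E) {F : Type*} (f : E → F) : Prop :=
  ∀ i v, f (v + b i) = f v

/-- The projection of `E` onto the torus `E / ℤb`, written in the coordinates of `b`. -/
def torusProj (b : Module.Basis ι ℝ E) (v : E) : UnitAddTorus ι :=
  fun i => (b.repr v i : UnitAddCircle)

/-- A (discontinuous) section of `torusProj`. -/
def torusSection (b : Module.Basis ι ℝ E) (t : UnitAddTorus ι) : E :=
  b.equivFun.symm fun i => Function.surjInv QuotientAddGroup.mk_surjective (t i)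

/-- The Haar probability measure of the torus. -/
def torusMeasure (ι : Type*) [Fintype ι] : Measure (UnitAddTorus ι) :=
  Measure.pi fun _ => AddCircle.haarAddCircle

instance : IsProbabilityMeasure (torusMeasure ι) := by
  unfold torusMeasure; infer_instance

instance : (torusMeasure ι).IsAddLeftInvariant := by
  unfold torusMeasure; infer_instance

/-- The mean of a periodic function over the torus. -/
def torusMean (b : Module.Basis ι ℝ E) (f : E → ℂ) : ℂ :=
  ∫ t, f (torusSection b t) ∂torusMeasure ι

variable {b : Module.Basis ι ℝ E}

lemma torusProj_section (t : UnitAddTorus ι) : torusProj b (torusSection b t) = t := by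
  funext i
  simp only [torusProj, torusSection]
  rw [← Module.Basis.equivFun_apply, LinearEquiv.apply_symm_apply]
  exact Function.surjInv_eq QuotientAddGroup.mk_surjective (t i)

lemma torusProj_add (v w : E) : torusProj b (v + w) = torusProj b v + torusProj b w := by
  funext i
  simp [torusProj]

lemma isOpenQuotientMap_torusProj : IsOpenQuotientMap (torusProj b) := by
  have h1 : IsOpenQuotientMap (fun (x : ι → ℝ) (i : ι) => (x i : UnitAddCircle)) :=
    IsOpenQuotientMap.piMap fun _ => QuotientAddGroup.isOpenQuotientMap_mk
  have h2 := h1.comp b.equivFunL.toHomeomorph.isOpenQuotientMap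
  exact h2

lemma IsLatticePeriodic.apply_add {F : Type*} {f : E → F} (hf : IsLatticePeriodic b f) {u : E}
    (hu : u ∈ Submodule.span ℤ (range b)) (v : E) : f (v + u) = f v := by
  induction hu using Submodule.span_induction generalizing v with
  | mem u hu => obtain ⟨i, rfl⟩ := hu; exact hf i v
  | zero => simp
  | add u u' _ _ h h' => rw [← add_assoc, h', h]
  | smul a u _ h =>
    have key : ∀ (m : ℕ) x, f (x + m • u) = f x := by
      intro m
      induction m with
      | zero => simp
      | succ m ih => intro x; rw [succ_nsmul, ← add_assoc, h, ih]
    obtain ⟨m, rfl | rfl⟩ := a.eq_nat_or_neg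
    · simpa using key m v
    · have := key m (v + (-(m : ℤ)) • u)
      rw [← this]
      simp

lemma IsLatticePeriodic.eq_of_torusProj_eq {F : Type*} {f : E → F} (hf : IsLatticePeriodic b f)
    {v w : E} (h : torusProj b v = torusProj b w) : f v = f w := by
  have h2 : v - w ∈ Submodule.span ℤ (range b) := by
    rw [b.mem_span_iff_repr_mem ℤ]
    intro i
    have h3 := congrFun h i
    simp only [torusProj] at h3
    rw [QuotientAddGroup.eq_iff_sub_mem] at h3
    obtain ⟨a, ha⟩ := AddSubgroup.mem_zmultiples_iff.mp h3
    exact ⟨a, by simpa using ha⟩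
  have := hf.apply_add h2 w
  rwa [add_sub_cancel] at this

lemma IsLatticePeriodic.apply_section {F : Type*} {f : E → F} (hf : IsLatticePeriodic b f)
    (v : E) : f (torusSection b (torusProj b v)) = f v :=
  hf.eq_of_torusProj_eq (torusProj_section _)

lemma IsLatticePeriodic.continuous_comp_section {F : Type*} [TopologicalSpace F] {f : E → F}
    (hf : IsLatticePeriodic b f) (hc : Continuous f) : Continuous (f ∘ torusSection b) := by
  rw [← isOpenQuotientMap_torusProj.continuous_comp_iff (f := torusProj b)]
  exact hc.congr fun v => (hf.apply_section v).symm

lemma IsLatticePeriodic.exists_bound {F : Type*} [NormedAddCommGroup F] {f : E → F}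
    (hf : IsLatticePeriodic b f) (hc : Continuous f) : ∃ C, ∀ v, ‖f v‖ ≤ C := by
  obtain ⟨C, hC⟩ := isCompact_univ.exists_bound_of_continuousOn
    (hf.continuous_comp_section hc).continuousOn
  exact ⟨C, fun v => by simpa [hf.apply_section] using hC (torusProj b v) (mem_univ _)⟩

lemma IsLatticePeriodic.integrable {F : Type*} [NormedAddCommGroup F] {f : E → F}
    (hf : IsLatticePeriodic b f) (hc : Continuous f) :
    Integrable (f ∘ torusSection b) (torusMeasure ι) :=
  (hf.continuous_comp_section hc).integrable_of_hasCompactSupport (HasCompactSupport.of_compactSpace _)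

lemma IsLatticePeriodic.comp_add {F : Type*} {f : E → F} (hf : IsLatticePeriodic b f) (w : E) :
    IsLatticePeriodic b fun v => f (v + w) := by
  intro i v
  change f (v + b i + w) = f (v + w)
  rw [add_right_comm, hf]

lemma IsLatticePeriodic.fderiv_apply {F : Type*} [NormedAddCommGroup F] [NormedSpace ℝ F]
    {f : E → F} (hf : IsLatticePeriodic b f) (w : E) :
    IsLatticePeriodic b fun v => fderiv ℝ f v w := fun i v => by
  change fderiv ℝ f (v + b i) w = fderiv ℝ f v w
  rw [← fderiv_comp_add_right (f := f) (b i)]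
  have h : (fun v => f (v + b i)) = f := funext (hf i)
  rw [h]

lemma torusMean_comp_add {f : E → ℂ} (hf : IsLatticePeriodic b f) (w : E) :
    torusMean b (fun v => f (v + w)) = torusMean b f := by
  have h : ∀ t, f (torusSection b t + w) = f (torusSection b (torusProj b w + t)) := by
    intro t
    rw [← hf.apply_section, torusProj_add, torusProj_section, add_comm]
  simp only [torusMean, h]
  exact integral_add_left_eq_self (fun t => f (torusSection b t)) _

/-- By translation invariance of the mean, derivatives of periodic functions have mean zero. -/
lemma torusMean_fderiv {f : E → ℂ} (hf : IsLatticePeriodic b f) (hs : ContDiff ℝ 1 f) (w : E) :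
    torusMean b (fun v => fderiv ℝ f v w) = 0 := by
  have hc : Continuous fun v => fderiv ℝ f v w :=
    (hs.continuous_fderiv one_ne_zero).clm_apply continuous_const
  obtain ⟨C, hC⟩ := (hf.fderiv_apply w).exists_bound hc
  have h1 : ∀ v (x : ℝ), HasDerivAt (fun x : ℝ => f (v + x • w)) (fderiv ℝ f (v + x • w) w) x := by
    intro v x
    have h2 : HasDerivAt (fun x : ℝ => v + x • w) w x := by
      simpa using ((hasDerivAt_id x).smul_const w).const_add v
    exact ((hs.differentiable one_ne_zero).differentiableAt.hasFDerivAt).comp_hasDerivAt x h2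
  have h3 := (hasDerivAt_integral_of_dominated_loc_of_deriv_le (μ := torusMeasure ι)
    (F := fun (x : ℝ) t => f (torusSection b t + x • w))
    (F' := fun (x : ℝ) t => fderiv ℝ f (torusSection b t + x • w) w) (x₀ := 0)
    (bound := fun _ => C) (s := univ) Filter.univ_mem
    (Filter.Eventually.of_forall fun x => ((hf.comp_add (x • w)).integrable
      (hs.continuous.comp (continuous_id.add continuous_const))).aestronglyMeasurable)
    ((hf.comp_add ((0 : ℝ) • w)).integrable
      (hs.continuous.comp (continuous_id.add continuous_const)))
    (((hf.fderiv_apply w).comp_add ((0 : ℝ) • w)).integrable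
      (hc.comp (continuous_id.add continuous_const))).aestronglyMeasurable
    (Filter.Eventually.of_forall fun t x _ => hC _) (integrable_const C)
    (Filter.Eventually.of_forall fun t x _ => h1 _ _)).2
  have h4 : (fun x : ℝ => ∫ t, f (torusSection b t + x • w) ∂torusMeasure ι) =
      fun _ => torusMean b f := by
    funext x
    exact torusMean_comp_add hf (x • w)
  rw [h4] at h3
  have h5 := h3.unique (hasDerivAt_const _ _)
  simpa [torusMean] using h5

/-- The frequency of the character with index `k`, a real linear form on `E`. -/
def latticeFreq (b : Module.Basis ι ℝ E) (k : ι → ℤ) : E →L[ℝ] ℝ :=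
  (2 * Real.pi) • ∑ i, (k i : ℝ) • LinearMap.toContinuousLinearMap (b.coord i)

/-- The character with index `k` of the torus, as a function on `E`. -/
def latticeChar (b : Module.Basis ι ℝ E) (k : ι → ℤ) (v : E) : ℂ :=
  Complex.exp (latticeFreq b k v * Complex.I)

lemma latticeFreq_apply (k : ι → ℤ) (v : E) :
    latticeFreq b k v = 2 * Real.pi * ∑ i, k i * b.repr v i := by
  simp [latticeFreq]

lemma latticeFreq_basis (k : ι → ℤ) (i : ι) : latticeFreq b k (b i) = 2 * Real.pi * k i := by
  classical
  simp [latticeFreq_apply, Finsupp.single_apply]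

lemma latticeFreq_neg (k : ι → ℤ) : latticeFreq b (-k) = - latticeFreq b k := by
  ext v
  simp [latticeFreq_apply]

lemma norm_latticeChar (k : ι → ℤ) (v : E) : ‖latticeChar b k v‖ = 1 :=
  Complex.norm_exp_ofReal_mul_I _

lemma mFourier_torusProj (k : ι → ℤ) (v : E) :
    UnitAddTorus.mFourier k (torusProj b v) = latticeChar b k v := by
  simp only [UnitAddTorus.mFourier, torusProj, ContinuousMap.coe_mk, fourier_coe_apply,
    latticeChar, ← Complex.exp_sum, latticeFreq_apply]
  congr 1
  push_cast
  rw [Finset.mul_sum, Finset.sum_mul]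
  refine Finset.sum_congr rfl fun i _ => ?_
  ring

lemma isLatticePeriodic_latticeChar (k : ι → ℤ) : IsLatticePeriodic b (latticeChar b k) := by
  classical
  intro i v
  have h : torusProj b (v + b i) = torusProj b v := by
    funext j
    simp only [torusProj, map_add, Module.Basis.repr_self, Finsupp.add_apply,
      Finsupp.single_apply, AddCircle.coe_add]
    split_ifs <;> simp
  rw [← mFourier_torusProj, h, mFourier_torusProj]

lemma hasFDerivAt_latticeChar (k : ι → ℤ) (v : E) :
    HasFDerivAt (latticeChar b k)
      ((latticeChar b k v * Complex.I) • Complex.ofRealCLM.comp (latticeFreq b k)) v := by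
  have h1 : HasFDerivAt (fun v => (latticeFreq b k v : ℂ))
      (Complex.ofRealCLM.comp (latticeFreq b k)) v :=
    (Complex.ofRealCLM.comp (latticeFreq b k)).hasFDerivAt
  have h2 := (h1.mul_const Complex.I).cexp
  rw [smul_smul] at h2
  exact h2

lemma contDiff_latticeChar (k : ι → ℤ) : ContDiff ℝ ∞ (latticeChar b k) := by
  unfold latticeChar
  exact ((Complex.ofRealCLM.contDiff.comp (latticeFreq b k).contDiff).mul contDiff_const).cexp

/-- The Fourier coefficients of a periodic function. -/
def latticeCoeff (b : Module.Basis ι ℝ E) (f : E → ℂ) (k : ι → ℤ) : ℂ :=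
  torusMean b fun v => latticeChar b (-k) v * f v

lemma IsLatticePeriodic.mul {f g : E → ℂ} (hf : IsLatticePeriodic b f)
    (hg : IsLatticePeriodic b g) : IsLatticePeriodic b fun v => f v * g v := fun i v => by
  change f _ * g _ = _
  rw [hf, hg]

lemma latticeCoeff_zero (f : E → ℂ) : latticeCoeff b f 0 = torusMean b f := by
  simp [latticeCoeff, latticeChar, latticeFreq_apply]

/-- Integration by parts: the derivative of `e₋ₖ f` has mean zero. -/
lemma latticeCoeff_fderiv {f : E → ℂ} (hf : IsLatticePeriodic b f) (hs : ContDiff ℝ ∞ f) (w : E)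
    (k : ι → ℤ) : latticeCoeff b (fun v => fderiv ℝ f v w) k =
      Complex.I * latticeFreq b k w * latticeCoeff b f k := by
  have hper := (isLatticePeriodic_latticeChar (b := b) (-k)).mul hf
  have hd : ∀ v, fderiv ℝ (fun v => latticeChar b (-k) v * f v) v w =
      latticeChar b (-k) v * fderiv ℝ f v w -
        Complex.I * latticeFreq b k w * (latticeChar b (-k) v * f v) := by
    intro v
    have h1 := (hasFDerivAt_latticeChar (b := b) (-k) v).fun_mul
      (hs.differentiable (by simp) v).hasFDerivAt
    rw [h1.fderiv]
    simp [latticeFreq_neg]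
    ring
  have h2 := torusMean_fderiv hper
    (((contDiff_latticeChar (b := b) (-k)).mul hs).of_le (by simp)) w
  simp only [hd] at h2
  have hfc : Continuous fun v => fderiv ℝ f v w :=
    (hs.continuous_fderiv (by simp)).clm_apply continuous_const
  have hcc : Continuous (latticeChar b (-k)) := (contDiff_latticeChar (-k)).continuous
  have i1 := ((isLatticePeriodic_latticeChar (b := b) (-k)).mul (hf.fderiv_apply w)).integrable
    (hcc.mul hfc)
  have i2 := hper.integrable (hcc.mul hs.continuous)
  simp only [Function.comp_def] at i1 i2
  rw [torusMean, integral_sub i1 (i2.const_mul _), integral_const_mul] at h2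
  exact sub_eq_zero.mp h2

lemma norm_latticeCoeff_le {f : E → ℂ} {C : ℝ} (hC : ∀ v, ‖f v‖ ≤ C) (k : ι → ℤ) :
    ‖latticeCoeff b f k‖ ≤ C := by
  have := norm_integral_le_of_norm_le_const (μ := torusMeasure ι) (C := C)
    (f := fun t => latticeChar b (-k) (torusSection b t) * f (torusSection b t))
    (Filter.Eventually.of_forall fun t => by rw [norm_mul, norm_latticeChar, one_mul]; exact hC _)
  simpa [latticeCoeff, torusMean] using this

/-- Each derivative in the direction `b i` gains a factor `k i` in the decay of the coefficients. -/
lemma exists_pow_mul_norm_latticeCoeff_le (i : ι) (m : ℕ) {f : E → ℂ}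
    (hf : IsLatticePeriodic b f) (hs : ContDiff ℝ ∞ f) :
    ∃ C, ∀ k : ι → ℤ, ‖k i‖ ^ m * ‖latticeCoeff b f k‖ ≤ C := by
  induction m generalizing f with
  | zero =>
    obtain ⟨C, hC⟩ := hf.exists_bound hs.continuous
    exact ⟨C, fun k => by simpa using norm_latticeCoeff_le hC k⟩
  | succ m ih =>
    have hs' : ContDiff ℝ ∞ fun v => fderiv ℝ f v (b i) :=
      (hs.fderiv_right (by simp)).clm_apply contDiff_const
    obtain ⟨C, hC⟩ := ih (hf.fderiv_apply (b i)) hs'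
    refine ⟨C, fun k => le_trans ?_ (hC k)⟩
    rw [latticeCoeff_fderiv hf hs, latticeFreq_basis, pow_succ, mul_assoc]
    refine mul_le_mul_of_nonneg_left ?_ (by positivity)
    rw [norm_mul, norm_mul, Complex.norm_I, one_mul]
    refine mul_le_mul_of_nonneg_right ?_ (norm_nonneg _)
    rw [Complex.norm_real, norm_mul, Real.norm_of_nonneg (by positivity), Int.norm_eq_abs,
      Real.norm_eq_abs]
    have := Real.pi_gt_three
    nlinarith [abs_nonneg (k i : ℝ)]

end LatticeFourier

section LatticeFourier

variable {ι E : Type*} [Fintype ι] [NormedAddCommGroup E] [NormedSpace ℝ E]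
  [FiniteDimensional ℝ E] {b : Module.Basis ι ℝ E}

/-- A family of coefficients that decays faster than any power of the index. -/
def IsRapidlyDecreasing (c : (ι → ℤ) → ℂ) : Prop :=
  ∀ m : ℕ, Summable fun k => ‖k‖ ^ m * ‖c k‖

lemma exists_summable_inv_pow_norm (ι : Type*) [Fintype ι] :
    ∃ N : ℕ, Summable fun k : ι → ℤ => ‖k‖⁻¹ ^ N := by
  set L : Submodule ℤ (ι → ℝ) := Submodule.span ℤ (range (Pi.basisFun ℝ ι)) with hL
  have hmem : ∀ k : ι → ℤ, (fun i => (k i : ℝ)) ∈ L := by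
    intro k
    rw [hL, (Pi.basisFun ℝ ι).mem_span_iff_repr_mem ℤ]
    intro i
    exact ⟨k i, by simp⟩
  refine ⟨Module.finrank ℤ L + 1, ?_⟩
  have h := ZLattice.summable_norm_pow_inv L _ (Nat.lt_succ_self (Module.finrank ℤ L))
  have hinj : Function.Injective fun k : ι → ℤ => (⟨fun i => (k i : ℝ), hmem k⟩ : L) := by
    intro k k' hk
    funext i
    have : (k i : ℝ) = k' i := congrFun (congrArg Subtype.val hk) i
    exact_mod_cast this
  refine (h.comp_injective hinj).congr fun k => ?_
  have : ‖(⟨fun i => (k i : ℝ), hmem k⟩ : L)‖ = ‖k‖ := by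
    change ‖fun i => (k i : ℝ)‖ = ‖k‖
    simp only [Pi.norm_def]
    congr 2
  simp only [Function.comp_apply, this]

lemma isRapidlyDecreasing_of_bound {c : (ι → ℤ) → ℂ}
    (h : ∀ m : ℕ, ∃ C, ∀ k, ‖k‖ ^ m * ‖c k‖ ≤ C) : IsRapidlyDecreasing c := by
  intro m
  obtain ⟨N, hN⟩ := exists_summable_inv_pow_norm ι
  obtain ⟨C, hC⟩ := h (m + N)
  refine Summable.of_norm_bounded_eventually (hN.mul_left C) ?_
  have h0 : ({0}ᶜ : Set (ι → ℤ)) ∈ Filter.cofinite := (finite_singleton _).compl_mem_cofinite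
  filter_upwards [h0] with k hk
  have hk' : 0 < ‖k‖ := norm_pos_iff.mpr hk
  rw [Real.norm_of_nonneg (by positivity), inv_pow, ← div_eq_mul_inv, le_div_iff₀ (by positivity)]
  refine le_trans (le_of_eq ?_) (hC k)
  ring

lemma IsRapidlyDecreasing.mul {c a : (ι → ℤ) → ℂ} (hc : IsRapidlyDecreasing c) (p : ℕ) (C : ℝ)
    (ha : ∀ k, ‖a k‖ ≤ C * ‖k‖ ^ p) : IsRapidlyDecreasing fun k => a k * c k := by
  intro m
  refine Summable.of_norm_bounded ((hc (m + p)).mul_left C) fun k => ?_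
  rw [Real.norm_of_nonneg (by positivity), norm_mul]
  calc ‖k‖ ^ m * (‖a k‖ * ‖c k‖) ≤ ‖k‖ ^ m * ((C * ‖k‖ ^ p) * ‖c k‖) := by
        gcongr; exact ha k
    _ = _ := by ring

lemma IsLatticePeriodic.isRapidlyDecreasing {f : E → ℂ} (hf : IsLatticePeriodic b f)
    (hs : ContDiff ℝ ∞ f) : IsRapidlyDecreasing (latticeCoeff b f) := by
  refine isRapidlyDecreasing_of_bound fun m => ?_
  choose C hC using fun i => exists_pow_mul_norm_latticeCoeff_le i m hf hs
  obtain ⟨C', hC'⟩ := hf.exists_bound hs.continuous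
  have hC0 : ∀ i, 0 ≤ C i := fun i => le_trans (by positivity) (hC i 0)
  have hC'0 : 0 ≤ C' := (norm_nonneg _).trans (hC' 0)
  refine ⟨C' + ∑ i, C i, fun k => ?_⟩
  rcases isEmpty_or_nonempty ι with hι | hι
  · have hk : k = 0 := Subsingleton.elim _ _
    have h1 := norm_latticeCoeff_le (b := b) hC' k
    subst hk
    rcases m.eq_zero_or_pos with rfl | hm
    · simpa using h1
    · simpa [hm.ne'] using hC'0
  · obtain ⟨i, -, hi⟩ := Finset.exists_mem_eq_sup' (Finset.univ_nonempty (α := ι)) fun i => ‖k i‖₊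
    have hk : ‖k‖ = ‖k i‖ := by
      rw [Pi.norm_def, ← Finset.sup'_eq_sup Finset.univ_nonempty, hi]
      rfl
    rw [hk]
    have := Finset.single_le_sum (fun j _ => hC0 j) (Finset.mem_univ i)
    linarith [hC i k]

/-- The function with given Fourier coefficients. -/
def latticeSeries (b : Module.Basis ι ℝ E) (c : (ι → ℤ) → ℂ) (v : E) : ℂ :=
  ∑' k, c k * latticeChar b k v

lemma IsLatticePeriodic.eq_latticeSeries {f : E → ℂ} (hf : IsLatticePeriodic b f)
    (hs : ContDiff ℝ ∞ f) : f = latticeSeries b (latticeCoeff b f) := by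
  set F : C(UnitAddTorus ι, ℂ) := ⟨f ∘ torusSection b, hf.continuous_comp_section hs.continuous⟩
    with hF
  have hcoeff : UnitAddTorus.mFourierCoeff F = latticeCoeff b f := by
    funext k
    have h1 : UnitAddTorus.mFourierCoeff F k =
        ∫ t, UnitAddTorus.mFourier (-k) t • F t ∂torusMeasure ι := rfl
    rw [h1, latticeCoeff, torusMean]
    congr 1
    funext t
    rw [← mFourier_torusProj, torusProj_section]
    rfl
  have hsum : Summable (UnitAddTorus.mFourierCoeff F) := by
    rw [hcoeff]
    exact Summable.of_norm (by simpa using hf.isRapidlyDecreasing hs 0)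
  funext v
  have h := (UnitAddTorus.hasSum_mFourier_series_apply_of_summable hsum (torusProj b v)).tsum_eq
  simp only [hcoeff, mFourier_torusProj, smul_eq_mul] at h
  rw [latticeSeries, h]
  exact (hf.apply_section v).symm

lemma isLatticePeriodic_latticeSeries (c : (ι → ℤ) → ℂ) :
    IsLatticePeriodic b (latticeSeries b c) := fun i v => by
  simp only [latticeSeries, isLatticePeriodic_latticeChar _ i v]

lemma exists_norm_latticeFreq_le (b : Module.Basis ι ℝ E) :
    ∃ M, ∀ k, ‖latticeFreq b k‖ ≤ M * ‖k‖ := by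
  refine ⟨(2 * Real.pi) * ∑ i, ‖LinearMap.toContinuousLinearMap (b.coord i)‖, fun k => ?_⟩
  rw [latticeFreq, norm_smul, Real.norm_of_nonneg (by positivity), mul_assoc _ (∑ i, _) ‖k‖]
  refine mul_le_mul_of_nonneg_left ?_ (by positivity)
  rw [Finset.sum_mul]
  refine (norm_sum_le _ _).trans (Finset.sum_le_sum fun i _ => ?_)
  rw [norm_smul, mul_comm]
  refine mul_le_mul_of_nonneg_left ?_ (norm_nonneg _)
  have := norm_le_pi_norm k i
  rwa [Int.norm_eq_abs] at this

lemma IsRapidlyDecreasing.mul_latticeFreq {c : (ι → ℤ) → ℂ} (hc : IsRapidlyDecreasing c) (w : E) :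
    IsRapidlyDecreasing fun k => (Complex.I * latticeFreq b k w) * c k := by
  obtain ⟨M, hM⟩ := exists_norm_latticeFreq_le b
  refine hc.mul 1 (M * ‖w‖) fun k => ?_
  rw [norm_mul, Complex.norm_I, one_mul, Complex.norm_real]
  calc ‖latticeFreq b k w‖ ≤ ‖latticeFreq b k‖ * ‖w‖ := ContinuousLinearMap.le_opNorm _ _
    _ ≤ M * ‖k‖ * ‖w‖ := by gcongr; exact hM k
    _ = _ := by ring

lemma IsRapidlyDecreasing.summable {c : (ι → ℤ) → ℂ} (hc : IsRapidlyDecreasing c) (v : E) :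
    Summable fun k => c k * latticeChar b k v :=
  Summable.of_norm (by simpa [norm_latticeChar] using hc 0)

lemma IsRapidlyDecreasing.differentiable_latticeSeries {c : (ι → ℤ) → ℂ}
    (hc : IsRapidlyDecreasing c) (v : E) : DifferentiableAt ℝ (latticeSeries b c) v ∧ 
      ∀ w, fderiv ℝ (latticeSeries b c) v w =
        latticeSeries b (fun k => (Complex.I * latticeFreq b k w) * c k) v := by
  obtain ⟨M, hM⟩ := exists_norm_latticeFreq_le b
  set f' : (ι → ℤ) → E → E →L[ℝ] ℂ := fun k v =>
    c k • ((latticeChar b k v * Complex.I) • Complex.ofRealCLM.comp (latticeFreq b k)) with hf'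
  have hbound : ∀ k v, ‖f' k v‖ ≤ M * (‖k‖ ^ 1 * ‖c k‖) := by
    intro k v
    simp only [hf', norm_smul, norm_mul, norm_latticeChar, Complex.norm_I, one_mul, pow_one]
    have h1 := (ContinuousLinearMap.opNorm_comp_le Complex.ofRealCLM (latticeFreq b k)).trans_eq
      (by rw [Complex.ofRealCLM_norm, one_mul])
    calc ‖c k‖ * _ ≤ ‖c k‖ * (M * ‖k‖) := by gcongr; exact h1.trans (hM k)
      _ = _ := by ring
  have hu := (hc 1).mul_left M
  have hF := hasFDerivAt_tsum (f := fun k v => c k * latticeChar b k v) (x₀ := v) hu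
    (fun k v => (hasFDerivAt_latticeChar k v).const_mul (c k)) hbound (hc.summable v) v
  refine ⟨hF.differentiableAt, fun w => ?_⟩
  have hF' : HasFDerivAt (latticeSeries b c) (∑' k, f' k v) v := hF
  rw [hF'.fderiv]
  have hsum : Summable fun k => f' k v := Summable.of_norm_bounded hu fun k => hbound k v
  have := (ContinuousLinearMap.apply ℝ ℂ w).map_tsum hsum
  simp only [ContinuousLinearMap.apply_apply] at this
  rw [this, latticeSeries]
  congr 1
  funext k
  simp [hf']
  ring

lemma IsRapidlyDecreasing.contDiff_latticeSeries {c : (ι → ℤ) → ℂ}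
    (hc : IsRapidlyDecreasing c) : ContDiff ℝ ∞ (latticeSeries b c) := by
  rw [contDiff_infty]
  intro m
  induction m generalizing c with
  | zero =>
    exact contDiff_zero.mpr (continuous_iff_continuousAt.mpr fun v =>
      (hc.differentiable_latticeSeries v).1.continuousAt)
  | succ m ih =>
    rw [Nat.cast_add, Nat.cast_one, contDiff_succ_iff_fderiv_apply]
    refine ⟨fun v => (hc.differentiable_latticeSeries v).1, by simp, fun w => ?_⟩
    have : (fun v => fderiv ℝ (latticeSeries b c) v w) =
        latticeSeries b fun k => (Complex.I * latticeFreq b k w) * c k :=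
      funext fun v => (hc.differentiable_latticeSeries v).2 w
    rw [this]
    exact ih (hc.mul_latticeFreq w)

variable {κ : Type*} [Fintype κ]

/-- The sum of the second derivatives of `f` along the vectors of the family `u`. -/
def sumSqDeriv (u : κ → E) (f : E → ℂ) (v : E) : ℂ :=
  ∑ i, fderiv ℝ (fun w => fderiv ℝ f w (u i)) v (u i)

/-- The symbol of the operator `-sumSqDeriv u` on the torus. -/
def latticeSymbol (b : Module.Basis ι ℝ E) (u : κ → E) (k : ι → ℤ) : ℝ :=
  ∑ i, latticeFreq b k (u i) ^ 2

/-- If the vectors `u` span `E`, the nonzero frequencies stay away from the kernel of the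
operator. -/
lemma exists_inv_latticeSymbol_le {u : κ → E} (hu : ∀ v, ∃ a : κ → ℝ, v = ∑ i, a i • u i) :
    ∃ C, ∀ k, k ≠ 0 → 0 < latticeSymbol b u k ∧ (latticeSymbol b u k)⁻¹ ≤ C := by
  choose a ha using fun j => hu (b j)
  have key : ∀ k : ι → ℤ, ∀ j, k j ≠ 0 →
      1 ≤ (∑ i, a j i ^ 2) * latticeSymbol b u k := by
    intro k j hj
    have h1 : latticeFreq b k (b j) = ∑ i, a j i * latticeFreq b k (u i) := by
      conv_lhs => rw [ha j]
      simp
    have h2 := Finset.sum_mul_sq_le_sq_mul_sq Finset.univ (a j) fun i => latticeFreq b k (u i)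
    rw [← h1, latticeFreq_basis] at h2
    refine le_trans ?_ h2
    have h3 : (1 : ℝ) ≤ (k j : ℝ) ^ 2 := by
      have : 1 ≤ |k j| := Int.one_le_abs hj
      have h4 : (1 : ℝ) ≤ |(k j : ℝ)| := by exact_mod_cast this
      rw [← sq_abs]
      nlinarith
    have h4 : 1 ≤ (2 * Real.pi) ^ 2 := by nlinarith [Real.pi_gt_three]
    rw [mul_pow]
    nlinarith
  refine ⟨∑ j, ∑ i, a j i ^ 2, fun k hk => ?_⟩
  obtain ⟨j, hj⟩ := Function.ne_iff.mp hk
  have h1 := key k j hj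
  have h0 : 0 ≤ latticeSymbol b u k := Finset.sum_nonneg fun i _ => sq_nonneg _
  have hpos : 0 < latticeSymbol b u k := by
    refine lt_of_le_of_ne h0 fun h => ?_
    rw [← h, mul_zero] at h1
    linarith
  refine ⟨hpos, ?_⟩
  rw [inv_le_iff_one_le_mul₀ hpos]
  refine h1.trans (mul_le_mul_of_nonneg_right ?_ h0)
  exact Finset.single_le_sum (f := fun j => ∑ i, a j i ^ 2)
    (fun j _ => Finset.sum_nonneg fun i _ => sq_nonneg _) (Finset.mem_univ j)

lemma sumSqDeriv_latticeSeries {c : (ι → ℤ) → ℂ} (hc : IsRapidlyDecreasing c) (u : κ → E) :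
    sumSqDeriv u (latticeSeries b c) =
      latticeSeries b fun k => -(latticeSymbol b u k : ℂ) * c k := by
  funext v
  have h1 : ∀ i, (fun w => fderiv ℝ (latticeSeries b c) w (u i)) =
      latticeSeries b fun k => (Complex.I * latticeFreq b k (u i)) * c k := fun i =>
    funext fun w => (hc.differentiable_latticeSeries w).2 (u i)
  simp only [sumSqDeriv, h1, ((hc.mul_latticeFreq _).differentiable_latticeSeries v).2]
  simp only [latticeSeries]
  rw [← Summable.tsum_finsetSum fun i _ =>
    ((hc.mul_latticeFreq (b := b) (u i)).mul_latticeFreq (b := b) (u i)).summable v]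
  congr 1
  funext k
  simp only [latticeSymbol]
  push_cast
  rw [← Finset.sum_neg_distrib, Finset.sum_mul, Finset.sum_mul]
  refine Finset.sum_congr rfl fun i _ => ?_
  linear_combination (latticeFreq b k (u i) : ℂ) ^ 2 * c k * latticeChar b k v * Complex.I_sq

/-- Solvability of the Poisson equation on a torus: the equation is divided by its symbol, which is
bounded away from zero at the nonzero frequencies. -/
theorem IsLatticePeriodic.exists_sumSqDeriv_eq {u : κ → E}
    (hu : ∀ v, ∃ a : κ → ℝ, v = ∑ i, a i • u i) {f : E → ℂ} (hf : IsLatticePeriodic b f)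
    (hs : ContDiff ℝ ∞ f) : ∃ φ : E → ℂ, IsLatticePeriodic b φ ∧ ContDiff ℝ ∞ φ ∧
      ∀ v, sumSqDeriv u φ v = f v - torusMean b f := by
  obtain ⟨C, hC⟩ := exists_inv_latticeSymbol_le (b := b) hu
  have hc := hf.isRapidlyDecreasing hs
  -- The symbol vanishes at the frequency zero, and so does its junk inverse.
  have h0 : latticeSymbol b u 0 = 0 := by simp [latticeSymbol, latticeFreq_apply]
  have hd : IsRapidlyDecreasing fun k => -(latticeSymbol b u k : ℂ)⁻¹ * latticeCoeff b f k := by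
    refine hc.mul 0 |C| fun k => ?_
    by_cases hk : k = 0
    · simp [hk, h0]
    · rw [norm_neg, norm_inv, Complex.norm_real, Real.norm_of_nonneg (hC k hk).1.le, pow_zero,
        mul_one]
      exact (hC k hk).2.trans (le_abs_self C)
  refine ⟨_, isLatticePeriodic_latticeSeries _, hd.contDiff_latticeSeries, fun v => ?_⟩
  rw [sumSqDeriv_latticeSeries hd, eq_sub_iff_add_eq]
  conv_rhs => rw [hf.eq_latticeSeries hs]
  simp only [latticeSeries]
  rw [(hc.summable v).tsum_eq_add_tsum_ite 0, latticeCoeff_zero, add_comm]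
  congr 1
  · simp [latticeChar, latticeFreq_apply]
  · congr 1
    funext k
    split_ifs with hk
    · simp [hk, h0]
    · have : (latticeSymbol b u k : ℂ) ≠ 0 := by exact_mod_cast (hC k hk).1.ne'
      field_simp

/-- Periodic solutions of the Laplace equation are constant. -/
theorem IsLatticePeriodic.eq_torusMean {u : κ → E}
    (hu : ∀ v, ∃ a : κ → ℝ, v = ∑ i, a i • u i) {f : E → ℂ} (hf : IsLatticePeriodic b f)
    (hs : ContDiff ℝ ∞ f) (h : ∀ v, sumSqDeriv u f v = 0) (v : E) : f v = torusMean b f := by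
  obtain ⟨C, hC⟩ := exists_inv_latticeSymbol_le (b := b) hu
  have hs' : ∀ (w : E) {g : E → ℂ}, ContDiff ℝ ∞ g → ContDiff ℝ ∞ fun v => fderiv ℝ g v w :=
    fun w g hg => (hg.fderiv_right (by simp)).clm_apply contDiff_const
  have hcoeff : ∀ k, latticeCoeff b (sumSqDeriv u f) k =
      -(latticeSymbol b u k : ℂ) * latticeCoeff b f k := by
    intro k
    have h1 : latticeCoeff b (sumSqDeriv u f) k =
        ∑ i, latticeCoeff b (fun v => fderiv ℝ (fun w => fderiv ℝ f w (u i)) v (u i)) k := by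
      simp only [latticeCoeff, torusMean, sumSqDeriv, Finset.mul_sum]
      refine integral_finsetSum _ fun i _ => ?_
      exact ((isLatticePeriodic_latticeChar (b := b) (-k)).mul
        ((hf.fderiv_apply (u i)).fderiv_apply (u i))).integrable
        ((contDiff_latticeChar (-k)).continuous.mul (hs' _ (hs' _ hs)).continuous)
    rw [h1]
    simp only [latticeCoeff_fderiv (hf.fderiv_apply _) (hs' _ hs), latticeCoeff_fderiv hf hs]
    simp only [latticeSymbol]
    push_cast
    rw [← Finset.sum_neg_distrib, Finset.sum_mul]
    refine Finset.sum_congr rfl fun i _ => ?_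
    linear_combination (latticeFreq b k (u i) : ℂ) ^ 2 * latticeCoeff b f k * Complex.I_sq
  have hz : ∀ k, k ≠ 0 → latticeCoeff b f k = 0 := by
    intro k hk
    have h1 := hcoeff k
    have h2 : sumSqDeriv u f = fun _ => 0 := funext h
    rw [h2] at h1
    have h3 : latticeCoeff b (fun _ => (0 : ℂ)) k = 0 := by simp [latticeCoeff, torusMean]
    rw [h3] at h1
    have : (latticeSymbol b u k : ℂ) ≠ 0 := by exact_mod_cast (hC k hk).1.ne'
    simpa [this] using h1.symm
  conv_lhs => rw [hf.eq_latticeSeries hs]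
  rw [latticeSeries, tsum_eq_single 0 fun k hk => by rw [hz k hk, zero_mul], latticeCoeff_zero]
  simp [latticeChar, latticeFreq_apply]

end LatticeFourier

/-! ### The `∂∂̄`-lemma on a complex torus -/

section Torus

variable {n : ℕ}

/-- The operator `∑ ∂²/∂vᵏ∂v̄ᵏ`, a quarter of the Euclidean Laplacian. -/
def complexLaplacian (f : CSpace n → ℂ) (v : CSpace n) : ℂ :=
  ∑ k, wirtinger (-Complex.I) k (wirtinger Complex.I k f) v

/-- The standard basis of `ℂⁿ` as a real vector space. -/
def realStdVec (n : ℕ) : Fin n ⊕ Fin n → CSpace n :=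
  Sum.elim stdVec fun i => Complex.I • stdVec i

lemma exists_eq_sum_realStdVec (v : CSpace n) :
    ∃ a : Fin n ⊕ Fin n → ℝ, v = ∑ i, a i • realStdVec n i := by
  refine ⟨Sum.elim (fun i => (v i).re) fun i => (v i).im, ?_⟩
  conv_lhs => rw [CSpace.eq_sum_stdVec v]
  simp only [Fintype.sum_sum_type, Sum.elim_inl, Sum.elim_inr, realStdVec,
    ← Finset.sum_add_distrib]

lemma complexLaplacian_congr {f g : CSpace n → ℂ} {v : CSpace n} (h : f =ᶠ[𝓝 v] g) :
    complexLaplacian f v = complexLaplacian g v :=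
  Finset.sum_congr rfl fun _ _ => (wirtinger_congr (wirtinger_congr h)).self_of_nhds

lemma sumSqDeriv_realStdVec {f : CSpace n → ℂ} {v : CSpace n} (hf : ContDiffAt ℝ ∞ f v) :
    sumSqDeriv (realStdVec n) f v = 4 * complexLaplacian f v := by
  simp only [sumSqDeriv, Fintype.sum_sum_type, realStdVec, Sum.elim_inl, Sum.elim_inr,
    ← Finset.sum_add_distrib, complexLaplacian, Finset.mul_sum, hf.fderiv_fderiv_apply]
  refine Finset.sum_congr rfl fun k _ => ?_
  rw [wirtinger, fderiv_wirtinger hf, fderiv_wirtinger hf,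
    hf.fderiv_fderiv_comm (Complex.I • stdVec k) (stdVec k)]
  linear_combination (fderiv ℝ (fderiv ℝ f) v (Complex.I • stdVec k) (Complex.I • stdVec k)) *
    Complex.I_mul_I

lemma complexLaplacian_wirtinger {c : ℂ} {i : Fin n} {f : CSpace n → ℂ} {O : Set (CSpace n)}
    (hO : IsOpen O) (hf : ∀ w ∈ O, ContDiffAt ℝ ∞ f w) {v : CSpace n} (hv : v ∈ O) :
    complexLaplacian (wirtinger c i f) v = wirtinger c i (complexLaplacian f) v := by
  have h1 : wirtinger c i (complexLaplacian f) v =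
      ∑ k, wirtinger c i (wirtinger (-Complex.I) k (wirtinger Complex.I k f)) v := by
    unfold complexLaplacian
    exact wirtinger_sum _ fun k _ => (hf v hv).wirtinger.wirtinger.differentiableAt (by simp)
  rw [h1]
  refine Finset.sum_congr rfl fun k _ => ?_
  rw [wirtinger_comm (c := c) (hf v hv).wirtinger]
  refine (wirtinger_congr ?_).self_of_nhds
  filter_upwards [hO.mem_nhds hv] with w hw
  exact wirtinger_comm (hf w hw)

/-- A field of matrices that is locally the complex Hessian of a smooth real function. -/
def IsHessianField (H : CSpace n → Matrix (Fin n) (Fin n) ℂ) : Prop :=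
  ∀ z, ∃ (O : Set (CSpace n)) (u : CSpace n → ℝ), IsOpen O ∧ z ∈ O ∧
    (∀ w ∈ O, ContDiffAt ℝ ∞ u w) ∧ ∀ w ∈ O, complexHessian u w = H w

lemma complexHessian_apply (u : CSpace n → ℝ) (v : CSpace n) (i j : Fin n) :
    complexHessian u v i j =
      wirtinger (-Complex.I) i (wirtinger Complex.I j fun w => (u w : ℂ)) v := by
  simp only [complexHessian, Matrix.of_apply, dHol_eq_wirtinger, dAnti_eq_wirtinger]

lemma isHermitian_complexHessian {u : CSpace n → ℝ} {v : CSpace n} (hu : ContDiffAt ℝ ∞ u v) :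
    (complexHessian u v).IsHermitian := by
  ext i j
  rw [Matrix.conjTranspose_apply, RCLike.star_def]
  simp only [complexHessian, Matrix.of_apply]
  rw [← dAnti_conj]
  simp only [← dHol_conj, Complex.conj_ofReal]
  simp only [dHol_eq_wirtinger, dAnti_eq_wirtinger]
  exact wirtinger_comm hu.ofReal

lemma trace_complexHessian (u : CSpace n → ℝ) (v : CSpace n) :
    (complexHessian u v).trace = complexLaplacian (fun w => (u w : ℂ)) v := by
  simp only [Matrix.trace, Matrix.diag_apply, complexHessian_apply, complexLaplacian]

namespace IsHessianField

variable {H : CSpace n → Matrix (Fin n) (Fin n) ℂ}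

lemma contDiff (hH : IsHessianField H) (i j : Fin n) : ContDiff ℝ ∞ fun v => H v i j := by
  refine contDiff_iff_contDiffAt.mpr fun z => ?_
  obtain ⟨O, u, hO, hz, hu, hHu⟩ := hH z
  have h : ContDiffAt ℝ ∞ (wirtinger (-Complex.I) i (wirtinger Complex.I j fun w => (u w : ℂ))) z :=
    (hu z hz).ofReal.wirtinger.wirtinger
  refine h.congr_of_eventuallyEq ?_
  filter_upwards [hO.mem_nhds hz] with w hw
  rw [← hHu w hw, complexHessian_apply]

lemma isHermitian (hH : IsHessianField H) (z : CSpace n) : (H z).IsHermitian := by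
  obtain ⟨O, u, hO, hz, hu, hHu⟩ := hH z
  rw [← hHu z hz]
  exact isHermitian_complexHessian (hu z hz)

lemma sub_complexHessian (hH : IsHessianField H) {φ : CSpace n → ℝ} (hφ : ContDiff ℝ ∞ φ) :
    IsHessianField fun v => H v - complexHessian φ v := by
  intro z
  obtain ⟨O, u, hO, hz, hu, hHu⟩ := hH z
  refine ⟨O, fun w => u w + (-1) * φ w, hO, hz,
    fun w hw => (hu w hw).add (contDiffAt_const.mul hφ.contDiffAt), fun w hw => ?_⟩
  rw [complexHessian_add (hu w hw) (contDiffAt_const.mul hφ.contDiffAt),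
    complexHessian_const_mul _ hφ.contDiffAt, hHu w hw]
  simp [sub_eq_add_neg]

variable {ι : Type*} [Fintype ι] {b : Module.Basis ι ℝ (CSpace n)}

/-- A periodic Hessian field of constant trace is constant, since its entries are harmonic. -/
theorem apply_eq_torusMean (hH : IsHessianField H) (hp : IsLatticePeriodic b H) {c : ℂ}
    (hc : ∀ v, (H v).trace = c) (v : CSpace n) (i j : Fin n) :
    H v i j = torusMean b fun w => H w i j := by
  have hper : IsLatticePeriodic b fun w => H w i j := fun k w => by
    change H (w + b k) i j = _
    rw [hp k w]
  refine hper.eq_torusMean exists_eq_sum_realStdVec (hH.contDiff i j) (fun z => ?_) v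
  rw [sumSqDeriv_realStdVec (hH.contDiff i j).contDiffAt]
  -- Locally, the Laplacian of an entry is a second derivative of the Laplacian of `u`, which is the
  -- constant trace.
  obtain ⟨O, u, hO, hz, hu, hHu⟩ := hH z
  have h1 : (fun w => H w i j) =ᶠ[𝓝 z]
      wirtinger (-Complex.I) i (wirtinger Complex.I j fun w => (u w : ℂ)) := by
    filter_upwards [hO.mem_nhds hz] with w hw
    rw [← hHu w hw, complexHessian_apply]
  have h2 : ∀ w ∈ O, complexLaplacian (fun w => (u w : ℂ)) w = c := fun w hw => by
    rw [← trace_complexHessian, hHu w hw, hc]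
  have h3 : ∀ w ∈ O, complexLaplacian (wirtinger Complex.I j fun w => (u w : ℂ)) w = 0 := by
    intro w hw
    rw [complexLaplacian_wirtinger hO (fun w hw => (hu w hw).ofReal) hw,
      (wirtinger_congr (g := fun _ => c) ?_).self_of_nhds, wirtinger_const]
    filter_upwards [hO.mem_nhds hw] with x hx using h2 x hx
  rw [complexLaplacian_congr h1,
    complexLaplacian_wirtinger hO (fun w hw => (hu w hw).ofReal.wirtinger) hz,
    (wirtinger_congr (g := fun _ => 0) ?_).self_of_nhds, wirtinger_const, mul_zero]
  filter_upwards [hO.mem_nhds hz] with x hx using h3 x hx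

end IsHessianField

lemma sumSqDeriv_clm_comp {κ E : Type*} [Fintype κ] [NormedAddCommGroup E] [NormedSpace ℝ E]
    (L : ℂ →L[ℝ] ℂ) (u : κ → E) {f : E → ℂ} (hf : ContDiff ℝ ∞ f) (v : E) :
    sumSqDeriv u (fun w => L (f w)) v = L (sumSqDeriv u f v) := by
  have h1 : ∀ {g : E → ℂ}, ContDiff ℝ ∞ g → ∀ w x,
      fderiv ℝ (fun w => L (g w)) w x = L (fderiv ℝ g w x) := fun {g} hg w x => by
    have h : HasFDerivAt (fun w => L (g w)) (L.comp (fderiv ℝ g w)) w :=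
      L.hasFDerivAt.comp w (hg.differentiable (by simp) w).hasFDerivAt
    rw [h.fderiv]
    rfl
  have h2 : ∀ x : E, ContDiff ℝ ∞ fun w => fderiv ℝ f w x := fun x =>
    (hf.fderiv_right (by simp)).clm_apply contDiff_const
  simp only [sumSqDeriv, h1 hf, h1 (h2 _), map_sum]

variable {ι : Type*} [Fintype ι] {b : Module.Basis ι ℝ (CSpace n)}
  {H : CSpace n → Matrix (Fin n) (Fin n) ℂ}

lemma IsLatticePeriodic.complexHessian {φ : CSpace n → ℝ} (hφ : IsLatticePeriodic b φ) :
    IsLatticePeriodic b (complexHessian φ) := by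
  have h : ∀ (c : ℂ) (i : Fin n) {f : CSpace n → ℂ}, IsLatticePeriodic b f →
      IsLatticePeriodic b (wirtinger c i f) := fun c i f hf k v => by
    have h1 := fun x => hf.fderiv_apply x k v
    simp only at h1
    simp only [wirtinger, h1]
  intro k v
  ext i j
  rw [complexHessian_apply, complexHessian_apply]
  refine h _ i (h _ j fun k v => ?_) k v
  change ((φ (v + b k) : ℝ) : ℂ) = φ v
  rw [hφ]

/-- The `∂∂̄`-lemma on a torus: up to the Hessian of a periodic function, a periodic Hessian field
equals its mean. The function solves the Poisson equation for the trace. -/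
theorem IsHessianField.exists_sub_complexHessian_eq (hH : IsHessianField H)
    (hp : IsLatticePeriodic b H) : ∃ φ : CSpace n → ℝ, IsLatticePeriodic b φ ∧ ContDiff ℝ ∞ φ ∧
      ∀ v i j, (H v - complexHessian φ v) i j = torusMean b fun w => H w i j := by
  -- The factor `4` is that of the Euclidean Laplacian relative to `∑ ∂²/∂vᵏ∂v̄ᵏ`.
  set f : CSpace n → ℂ := fun v => 4 * (H v).trace with hf
  have hfper : IsLatticePeriodic b f := fun k v => by simp only [hf, hp k v]
  have hfs : ContDiff ℝ ∞ f :=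
    contDiff_const.mul (ContDiff.sum fun i _ => hH.contDiff i i)
  obtain ⟨ψ, hψper, hψs, hψ⟩ := hfper.exists_sumSqDeriv_eq exists_eq_sum_realStdVec hfs
  set L : ℂ →L[ℝ] ℂ := Complex.ofRealCLM.comp Complex.reCLM with hL
  have hLf : ∀ v, L (f v) = f v := by
    intro v
    have h1 : starRingEnd ℂ (f v) = f v := by
      have h2 := congrArg Matrix.trace (hH.isHermitian v)
      rw [Matrix.trace_conjTranspose, RCLike.star_def] at h2
      simp only [hf, map_mul, h2, map_ofNat]
    exact Complex.conj_eq_iff_re.mp h1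
  set φ : CSpace n → ℝ := fun v => (ψ v).re with hφ
  have hφs : ContDiff ℝ ∞ φ := Complex.reCLM.contDiff.comp hψs
  have hφper : IsLatticePeriodic b φ := fun k v => by simp only [hφ, hψper k v]
  have hLap : ∀ v, (complexHessian φ v).trace = (H v).trace - L (torusMean b f) / 4 := by
    intro v
    have h1 : sumSqDeriv (realStdVec n) (fun w => L (ψ w)) v = f v - L (torusMean b f) := by
      rw [sumSqDeriv_clm_comp L _ hψs, hψ, map_sub, hLf]
    have h2 := sumSqDeriv_realStdVec (f := fun w => (φ w : ℂ)) (v := v) hφs.contDiffAt.ofReal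
    have h3 : (fun w => (φ w : ℂ)) = fun w => L (ψ w) := rfl
    rw [trace_complexHessian]
    rw [h3, h1] at h2
    rw [h3]
    simp only [hf] at h2
    linear_combination -h2 / 4
  have hEper : IsLatticePeriodic b fun v => H v - complexHessian φ v := fun k v => by
    change H (v + b k) - complexHessian φ (v + b k) = _
    rw [hp k v, hφper.complexHessian k v]
  refine ⟨φ, hφper, hφs, fun v i j => ?_⟩
  rw [(hH.sub_complexHessian hφs).apply_eq_torusMean hEper
    (c := L (torusMean b f) / 4) (fun v => by rw [Matrix.trace_sub, hLap]; ring) v i j]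
  -- The entries of a Hessian of a periodic function are derivatives, so they have mean zero.
  have hg : ∀ {c : ℂ} {k : Fin n} {g : CSpace n → ℂ}, ContDiff ℝ ∞ g → IsLatticePeriodic b g →
      ContDiff ℝ ∞ (wirtinger c k g) ∧ torusMean b (wirtinger c k g) = 0 := by
    intro c k g hgs hgp
    refine ⟨contDiff_iff_contDiffAt.mpr fun v => hgs.contDiffAt.wirtinger, ?_⟩
    have h1 : ∀ x, Integrable ((fun v => fderiv ℝ g v x) ∘ torusSection b) (torusMeasure ι) :=
      fun x => (hgp.fderiv_apply x).integrable
        ((hgs.continuous_fderiv (by simp)).clm_apply continuous_const)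
    have h2 : ∀ x, torusMean b (fun v => fderiv ℝ g v x) = 0 := fun x =>
      torusMean_fderiv hgp (hgs.of_le (by simp)) x
    simp only [Function.comp_def] at h1
    simp only [torusMean] at h2
    simp only [torusMean, wirtinger]
    rw [integral_div, integral_add (h1 _) ((h1 _).const_mul _), integral_const_mul, h2, h2]
    simp
  have hφc : ContDiff ℝ ∞ fun w => (φ w : ℂ) := Complex.ofRealCLM.contDiff.comp hφs
  have hφcp : IsLatticePeriodic b fun w => (φ w : ℂ) := fun k v => by
    change ((φ (v + b k) : ℝ) : ℂ) = φ v
    rw [hφper]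
  have hwp : IsLatticePeriodic b (wirtinger Complex.I j fun w => (φ w : ℂ)) := fun k v => by
    have h1 := fun x => hφcp.fderiv_apply x k v
    simp only at h1
    simp only [wirtinger, h1]
  have h0 := (hg (c := -Complex.I) (k := i) (hg (c := Complex.I) (k := j) hφc hφcp).1 hwp).2
  have h1 : Integrable ((fun v => H v i j) ∘ torusSection b) (torusMeasure ι) :=
    IsLatticePeriodic.integrable (fun k v => by
      change H (v + b k) i j = _
      rw [hp k v]) (hH.contDiff i j).continuous
  have h2 : Integrable ((fun v => complexHessian φ v i j) ∘ torusSection b) (torusMeasure ι) := by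
    refine IsLatticePeriodic.integrable (fun k v => ?_) ?_
    · change complexHessian φ (v + b k) i j = _
      rw [hφper.complexHessian k v]
    · simp only [complexHessian_apply]
      exact (hg (hg hφc hφcp).1 hwp).1.continuous
  simp only [Function.comp_def] at h1 h2
  simp only [torusMean, Matrix.sub_apply] at h0 ⊢
  rw [integral_sub h1 h2]
  simp only [complexHessian_apply, h0, sub_zero]

lemma torusMean_pos {f : CSpace n → ℂ} (hf : IsLatticePeriodic b f) (hc : Continuous f)
    (h : ∀ v, 0 < f v) : 0 < torusMean b f := by
  have h1 : ∀ v, f v = ((f v).re : ℂ) := fun v =>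
    (Complex.conj_eq_iff_re.mp (Complex.conj_eq_iff_im.mpr (Complex.pos_iff.mp (h v)).2.symm)).symm
  have hp : IsLatticePeriodic b fun v => (f v).re := fun k v => by
    change (f _).re = _
    rw [hf]
  have hi := hp.integrable (Complex.continuous_re.comp hc)
  have h2 : torusMean b f = ((∫ t, (f (torusSection b t)).re ∂torusMeasure ι : ℝ) : ℂ) := by
    rw [torusMean, ← integral_complex_ofReal]
    congr 1
    funext t
    exact h1 _
  rw [h2, Complex.zero_lt_real]
  have h3 : ∀ v, 0 < (f v).re := fun v => (Complex.pos_iff.mp (h v)).1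
  refine (integral_pos_iff_support_of_nonneg (fun t => (h3 _).le) hi).mpr ?_
  have h4 : (Function.support fun t => (f (torusSection b t)).re) = univ :=
    eq_univ_of_forall fun t => (h3 _).ne'
  change 0 < torusMeasure ι (Function.support fun t => (f (torusSection b t)).re)
  rw [h4]
  simp

/-- The mean of a periodic field of positive definite matrices is positive definite. -/
lemma IsHessianField.posDef_torusMean (hH : IsHessianField H) (hp : IsLatticePeriodic b H)
    (hpos : ∀ v, (H v).PosDef) :
    (Matrix.of fun i j => torusMean b fun w => H w i j).PosDef := by
  have hi : ∀ i j, Integrable (fun t => H (torusSection b t) i j) (torusMeasure ι) := fun i j =>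
    IsLatticePeriodic.integrable (f := fun w => H w i j) (fun k v => by
      change H (v + b k) i j = _
      rw [hp k v]) (hH.contDiff i j).continuous
  refine posDef_of_sesqForm ?_ fun x hx => ?_
  · ext i j
    rw [Matrix.conjTranspose_apply, RCLike.star_def, Matrix.of_apply, Matrix.of_apply, torusMean,
      torusMean, ← integral_conj]
    congr 1
    funext t
    exact (hpos _).isHermitian.apply i j
  · have h1 : sesqForm (Matrix.of fun i j => torusMean b fun w => H w i j) x x =
        torusMean b fun v => sesqForm (H v) x x := by
      simp only [sesqForm, Matrix.of_apply, torusMean]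
      rw [integral_finsetSum _ fun i _ => integrable_finsetSum _ fun j _ => (hi i j).const_mul _]
      refine Finset.sum_congr rfl fun i _ => ?_
      rw [integral_finsetSum _ fun j _ => (hi i j).const_mul _]
      exact Finset.sum_congr rfl fun j _ => (integral_const_mul _ _).symm
    rw [h1]
    refine torusMean_pos (fun k v => ?_) ?_ fun v => (hpos v).sesqForm_pos hx
    · change sesqForm (H (v + b k)) x x = _
      rw [hp k v]
    · unfold sesqForm
      exact continuous_finsetSum _ fun i _ => continuous_finsetSum _ fun j _ =>
        continuous_const.mul (hH.contDiff i j).continuous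

end Torus

/-! ### Metrics of constant curvature -/

section ConstantCurvature

variable {n : ℕ} {A : Type*} [TopologicalSpace A] [ChartedSpace (CSpace n) A]
  {Λ : Submodule ℤ (CSpace n)} {pr : CSpace n → A}

/-- A smooth function on `ℂⁿ` that is invariant under the lattice descends to the torus. -/
lemma IsTorusProjection.exists_contMDiff_comp_eq [IsManifold 𝓘(ℂ, CSpace n) ω A]
    (hpr : IsTorusProjection Λ pr) {φ : CSpace n → ℝ} (hφ : ContDiff ℝ ∞ φ)
    (hp : ∀ l ∈ Λ, ∀ v, φ (v + l) = φ v) :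
    ∃ ψ : A → ℝ, ContMDiff 𝓘(ℝ, CSpace n) 𝓘(ℝ, ℝ) ∞ ψ ∧ ∀ v, ψ (pr v) = φ v := by
  have : IsManifold 𝓘(ℂ, CSpace n) 1 A := IsManifold.of_le (n := ω) le_top
  have hψ : ∀ v, φ (Function.surjInv hpr.surjective (pr v)) = φ v := by
    intro v
    have h1 := (hpr.eq_iff v _).mp (Function.surjInv_eq hpr.surjective (pr v)).symm
    have h2 := hp _ h1 v
    rwa [add_sub_cancel] at h2
  refine ⟨fun x => φ (Function.surjInv hpr.surjective x), fun x => ?_, hψ⟩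
  obtain ⟨v, rfl⟩ := hpr.surjective x
  have hq : IsOpenQuotientMap pr := ⟨hpr.surjective, hpr.holomorphic.continuous,
    isOpenMap_of_bijective_mfderiv hpr.holomorphic hpr.bijective_mfderiv⟩
  have hcomp : (fun x => φ (Function.surjInv hpr.surjective x)) ∘ pr = φ := funext hψ
  have hc : Continuous fun x => φ (Function.surjInv hpr.surjective x) := by
    rw [← hq.continuous_comp_iff, hcomp]
    exact hφ.continuous
  refine contMDiffAt_of_contDiffAt_comp (I := 𝓘(ℂ, CSpace n)) (fun _ => rfl)
    (Filter.Eventually.of_forall hpr.holomorphic) (hpr.bijective_mfderiv v) ?_ hc.continuousAt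
  rw [hcomp]
  exact hφ.contDiffAt

variable {N : A → Type*} [TopologicalSpace (TotalSpace ℂ N)] [∀ x, TopologicalSpace (N x)]
  [∀ x, AddCommGroup (N x)] [∀ x, Module ℂ (N x)] [FiberBundle ℂ N] [VectorBundle ℂ ℂ N]
  [IsManifold 𝓘(ℂ, CSpace n) ω A] [ContMDiffVectorBundle ω ℂ N 𝓘(ℂ, CSpace n)]
  {ρ : TotalSpace ℂ N → ℝ}

/-- The curvature of a metric is a lattice invariant field of Hessians on `ℂⁿ`. -/
lemma IsHermitianMetric.exists_curvature (hpr : IsTorusProjection Λ pr)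
    (hρ : IsHermitianMetric n ρ) :
    ∃ H : CSpace n → Matrix (Fin n) (Fin n) ℂ, IsHessianField H ∧
      (∀ l ∈ Λ, ∀ v, H (v + l) = H v) ∧
      ∀ (O : Set (CSpace n)) (s : CSpace n → TotalSpace ℂ N), IsLocalFrame pr O s →
        ∀ z ∈ O, complexHessian (fun w => Real.log (ρ (s w))) z = H z := by
  choose O s hO hs using fun z => exists_isLocalFrame (N := N) hpr.holomorphic z
  have hH : ∀ (O' : Set (CSpace n)) (s' : CSpace n → TotalSpace ℂ N), IsLocalFrame pr O' s' →
      ∀ z ∈ O', complexHessian (fun w => Real.log (ρ (s' w))) z =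
        complexHessian (fun w => Real.log (ρ (s z w))) z := fun O' s' hs' z hz =>
    hρ.complexHessian_log_eq (hs z) hs' (hO z) hz
  refine ⟨fun z => complexHessian (fun w => Real.log (ρ (s z w))) z, fun z =>
    ⟨O z, fun w => Real.log (ρ (s z w)), (hs z).isOpen, hO z,
      fun w hw => hρ.contDiffAt_log (hs z) hw, fun w hw => hH _ _ (hs z) w hw⟩,
    fun l hl v => ?_, hH⟩
  -- The translate of a frame by a lattice vector is again a frame.
  have ht : MDifferentiable 𝓘(ℂ, CSpace n) 𝓘(ℂ, CSpace n) fun w : CSpace n => w + l :=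
    (differentiable_id.add_const l).mdifferentiable
  have hsl : IsLocalFrame pr ((fun w => w + l) ⁻¹' O (v + l)) fun w => s (v + l) (w + l) :=
    ⟨(hs _).isOpen.preimage (continuous_id.add continuous_const),
      fun w hw => (MDifferentiableAt.comp w ((hs (v + l)).mdifferentiableAt hw)
        (ht w)).mdifferentiableWithinAt,
      fun w hw => ((hs _).proj_eq _ hw).trans (hpr.add_eq hl w),
      fun w hw => (hs _).ne_zero _ hw⟩
  refine Eq.trans ?_ (hH _ _ hsl v (hO (v + l)))
  set u := fun w => Real.log (ρ (s (v + l) w))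
  change complexHessian u (v + l) = complexHessian (fun w => u (w + l)) v
  have hw : ∀ (c : ℂ) (i : Fin n) (f : CSpace n → ℂ),
      wirtinger c i (fun w => f (w + l)) = fun w => wirtinger c i f (w + l) := fun c i f => by
    funext w
    simp only [wirtinger, fderiv_comp_add_right]
  ext i j
  rw [complexHessian_apply, complexHessian_apply, hw _ _ fun w => (u w : ℂ), hw]

/-- Every class of curvatures on a torus contains a constant one: the curvature of the given metric
is made constant by a conformal factor from the `∂∂̄`-lemma. -/
theorem IsTorusProjection.exists_invariant_metric [DiscreteTopology Λ] [IsZLattice ℝ Λ]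
    (hpr : IsTorusProjection Λ pr) (hN : IsNegativeLineBundle pr N) :
    ∃ ρ : TotalSpace ℂ N → ℝ,
      IsHermitianMetric n ρ ∧ IsNegativelyCurved pr ρ ∧ HasInvariantCurvature pr ρ := by
  obtain ⟨ρ₀, hρ₀, hneg⟩ := hN
  have : Module.Free ℤ Λ := ZLattice.module_free ℝ Λ
  have : Module.Finite ℤ Λ := ZLattice.module_finite ℝ Λ
  let b := (Module.Free.chooseBasis ℤ Λ).ofZLatticeBasis ℝ Λ
  have hb : Submodule.span ℤ (range b) = Λ := (Module.Free.chooseBasis ℤ Λ).ofZLatticeBasis_span ℝ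
  have hbΛ : ∀ i, b i ∈ Λ := fun i => hb.le (Submodule.subset_span (mem_range_self i))
  obtain ⟨H, hH, hHp, hHρ⟩ := hρ₀.exists_curvature hpr
  have hHb : IsLatticePeriodic b H := fun i v => hHp _ (hbΛ i) v
  have hHpos : ∀ v, (H v).PosDef := fun v => by
    obtain ⟨O, s, hO, hs⟩ := exists_isLocalFrame (N := N) hpr.holomorphic v
    rw [← hHρ O s hs v hO]
    exact hneg O s hs v hO
  obtain ⟨φ, hφp, hφs, hφ⟩ := hH.exists_sub_complexHessian_eq hHb
  obtain ⟨ψ, hψs, hψ⟩ := hpr.exists_contMDiff_comp_eq hφs fun l hl v =>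
    hφp.apply_add (hb.ge hl) v
  set W : Matrix (Fin n) (Fin n) ℂ := Matrix.of fun i j => torusMean b fun w => H w i j with hW
  -- The conformal factor `exp (-φ)` subtracts the Hessian of `φ` from the curvature.
  set ρ : TotalSpace ℂ N → ℝ := fun v => Real.exp (-ψ v.proj) * ρ₀ v with hρdef
  have hcurv : ∀ (O : Set (CSpace n)) (s : CSpace n → TotalSpace ℂ N), IsLocalFrame pr O s →
      ∀ z ∈ O, complexHessian (fun w => Real.log (ρ (s w))) z = W := by
    intro O s hs z hz
    have h1 : (fun w => Real.log (ρ (s w))) =ᶠ[𝓝 z]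
        fun w => Real.log (ρ₀ (s w)) + (-1) * φ w := by
      filter_upwards [hs.isOpen.mem_nhds hz] with w hw
      simp only [hρdef]
      rw [Real.log_mul (Real.exp_ne_zero _) (hρ₀.apply_pos (hs.ne_zero w hw)).ne', Real.log_exp,
        hs.proj_eq w hw, hψ]
      ring
    rw [complexHessian_congr h1, complexHessian_add (hρ₀.contDiffAt_log hs hz)
      (contDiffAt_const.mul hφs.contDiffAt), complexHessian_const_mul _ hφs.contDiffAt,
      hHρ O s hs z hz]
    ext i j
    rw [hW, Matrix.of_apply, ← hφ z i j]
    simp [sub_eq_add_neg]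
  refine ⟨ρ, ⟨fun x v hv => mul_pos (Real.exp_pos _) (hρ₀.pos x v hv), fun x a v => ?_, ?_⟩,
    fun O s hs z hz => ?_, W, hcurv⟩
  · simp only [hρdef, hρ₀.smul x a v]
    ring
  · have hproj : ContMDiff (𝓘(ℝ, CSpace n).prod 𝓘(ℝ, ℂ)) 𝓘(ℝ, CSpace n) ∞
        (TotalSpace.proj : TotalSpace ℂ N → A) := contMDiff_proj N
    have h1 : ContMDiff 𝓘(ℝ, CSpace n) 𝓘(ℝ, ℝ) ∞ fun x => Real.exp (-ψ x) :=
      (Real.contDiff_exp.comp contDiff_neg).contMDiff.comp hψs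
    have h2 := h1.comp hproj
    exact ContMDiff.smul h2 hρ₀.smooth
  · rw [hcurv O s hs z hz]
    exact hH.posDef_torusMean hHb hHpos

end ConstantCurvature

end

theorem mainTheorem4 (n : ℕ)
    (A : Type*) [TopologicalSpace A] [ChartedSpace (CSpace n) A]
    [IsManifold 𝓘(ℂ, CSpace n) ω A]
    (Λ : Submodule ℤ (CSpace n)) [DiscreteTopology Λ] [IsZLattice ℝ Λ]
    (pr : CSpace n → A) (hpr : IsTorusProjection Λ pr)
    (N : A → Type*) [TopologicalSpace (TotalSpace ℂ N)] [∀ x, TopologicalSpace (N x)]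
    [∀ x, AddCommGroup (N x)] [∀ x, Module ℂ (N x)] [FiberBundle ℂ N] [VectorBundle ℂ ℂ N]
    [ContMDiffVectorBundle ω ℂ N 𝓘(ℂ, CSpace n)]
    (hN : IsNegativeLineBundle pr N) :
    (∃ ρ : TotalSpace ℂ N → ℝ,
      IsHermitianMetric n ρ ∧ IsNegativelyCurved pr ρ ∧ HasInvariantCurvature pr ρ) ∧
    ∀ ρ : TotalSpace ℂ N → ℝ,
      IsHermitianMetric n ρ → IsNegativelyCurved pr ρ → HasInvariantCurvature pr ρ →
      ∃ (Ψ : CSpace (n + 1) → TotalSpace ℂ N)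
        (g : SesquilinearField (𝓘(ℂ, CSpace n).prod 𝓘(ℂ, ℂ)) (TotalSpace ℂ N)),
        IsBallUniformization (𝓘(ℂ, CSpace n).prod 𝓘(ℂ, ℂ)) (puncturedDiscBundle ρ 0) Ψ ∧
        IsInducedBergmanMetric (𝓘(ℂ, CSpace n).prod 𝓘(ℂ, ℂ)) Ψ g ∧
        ∀ k : ℝ, 0 < k →
          ∃ (U : Set (TotalSpace ℂ N))
            (Γ : Set (QuasiCoordinate (𝓘(ℂ, CSpace n).prod 𝓘(ℂ, ℂ)) (n + 1)
              (puncturedDiscBundle ρ k))),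
            IsQuasiCoordinateSystem (𝓘(ℂ, CSpace n).prod 𝓘(ℂ, ℂ))
              (zeroSectionSet N) (puncturedDiscBundle ρ k) U g Γ ∧
            ∃ (T : Set (CSpace (n + 1))) (ε : ℝ), Bornology.IsBounded T ∧ 0 < ε ∧
              ∀ x ∈ U, ∃ β ∈ Γ, β.domain = T ∧ ∃ y ∈ T, β.map y = x ∧
                ENNReal.ofReal ε ≤ Metric.infEDist y (frontier T) := by
  refine ⟨hpr.exists_invariant_metric hN, fun ρ hρ hneg hinv => ?_⟩
  obtain ⟨P, hP⟩ := hρ.exists_isCuspUniformization hpr hneg hinv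
  refine ⟨_, hP.inducedMetric, hP.isBallUniformization, hP.isInducedBergmanMetric, fun k hk => ?_⟩
  rw [hρ.zeroSectionSet_eq]
  exact hP.exists_quasiCoordinateSystem hk
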